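/- **Setting.** Let $F$ be a number field with ring of integers $O_F$ and algebraic closure $F^c$, and let $G$ be a finite abelian group. For every finite place $v$ of $F$ let $F_v$ be the completion, $O_{F_v}$ its valuation ring, $F_v^c$ an algebraic closure of $F_v$, $O_{F_v^c}$ the integral closure of $O_{F_v}$ in $F_v^c$, and fix an $F$-embedding $F^c\to F_v^c$. *Relative $K$-groups.* For $R\in\{O_F,O_{F_v}\}$ and an extension $R\to\Lambda$ of commutative rings, $K_0(RG,\Lambda)$ denotes the relative algebraic $K$-group: the abelian group generated by classes $[M,N;\xi]$ of triples in which $M,N$ are finitely generated projective $RG$-modules and $\xi:\Lambda\otimes_R M\xrightarrow{\sim}\Lambda\otimes_R N$ is an isomorphism of $\Lambda G$-modules, subject to additivity on short exact sequences of triples and to $[M,P;\eta\circ\xi]=[M,N;\xi]+[N,P;\eta]$. Let $$\lambda_v:K_0(O_FG,F^c)\to K_0(O_{F_v}G,F_v^c),\qquad [M,N;\xi]\mapsto[M_v,N_v;\xi_v],$$ where $M_v=O_{F_v}\otimes_{O_F}M$, $N_v=O_{F_v}\otimes_{O_F}N$ and $\xi_v=F_v^c\otimes_{F^c}\xi$.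 Let $J(K_0(O_FG,F^c))$ be the restricted direct product, over all finite places $v$, of the groups $K_0(O_{F_v}G,F_v^c)$ with respect to the images of $K_0(O_{F_v}G,O_{F_v^c})$. The maps $\lambda_v$ are the components of a homomorphism $\lambda:K_0(O_FG,F^c)\to J(K_0(O_FG,F^c))$. *Galois algebras.* Let $K$ be $F$ (with $R=O_F$) or $F_v$ (with $R=O_{F_v}$), and let $\Omega_K=\mathrm{Gal}(K^c/K)$ act trivially on $G$, so that $H^1(K,G)$ is the set of continuous homomorphisms $\pi:\Omega_K\to G$. For $\pi\in H^1(K,G)$ let $K_\pi$ be the algebra of all functions $a:G\to K^c$ with $\omega(a(\gamma))=a(\gamma\,\pi(\omega))$ for all $\omega\in\Omega_K$ and $\gamma\in G$, with $G$ acting by $(g\cdot a)(\gamma)=a(\gamma g)$, and let $O_\pi$ be the integral closure of $R$ in $K_\pi$. Let $H^1_t(K,G)$ (respectively $H^1_{nr}(K,G)$) be the set of those $\pi$ for which $K_\pi/K$, i.e. the fixed field of $\ker\pi$ over $K$, is at most tamely ramified (respectively unramified) at all finite places. For $\pi\in H^1_t(K,G)$ the $RG$-module $O_\pi$ is finitely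 generated and projective, and the resolvend map $r_G(a)=\sum_{s\in G}a(s)s^{-1}$ induces an isomorphism $K^c\otimes_R O_\pi\xrightarrow{\sim}K^cG$ of $K^cG$-modules; this defines maps $$\Psi:H^1_t(F,G)\to K_0(O_FG,F^c),\qquad \Psi_v:H^1_t(F_v,G)\to K_0(O_{F_v}G,F_v^c),\qquad [\pi]\mapsto[O_\pi,RG;r_G].$$ Let $J(H^1_t(F,G))$ be the restricted direct product, over all finite places $v$, of the pointed sets $H^1_t(F_v,G)$ with respect to the subsets $H^1_{nr}(F_v,G)$. The maps $\Psi_v$ induce a map $\Psi^{id}:J(H^1_t(F,G))\to J(K_0(O_FG,F^c))$. Write $K\mathcal R(O_FG)=\mathrm{Im}(\Psi)$. An element $x\in K_0(O_FG,F^c)$ is *cohomological* if $x\in\mathrm{Im}(\Psi)$, and *locally cohomological* if $\lambda_v(x)\in\mathrm{Im}(\Psi_v)$ for every finite place $v$ of $F$. **Theorem.** For every number field $F$, every finite abelian group $G$ and every choice of the embeddings $F^c\to F_v^c$: 1. an element of $K_0(O_FG,F^c)$ is cohomological if and only if it is locally cohomological; 2. $\lambda(K\mathcal R(O_FG))=\mathrm{Im}(\lambda)\cap\mathrm{Im}(\Psi^{id})$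 in $J(K_0(O_FG,F^c))$. -/

import Mathlib

universe u

open scoped TensorProduct

noncomputable section

namespace RelativeK

section RelK0

variable (A B : Type u) [CommRing A] [CommRing B] [Algebra A B]

/-- A twisted form `(M, N; ξ)` relative to the ring extension `A → B`: finitely generated projective
`A`-modules `M`, `N` together with an isomorphism of `B`-modules `ξ : B ⊗_A M ≃ B ⊗_A N`.

For `A = R[G]` and `B = Λ[G] = R[G] ⊗_R Λ` one has `B ⊗_A M = Λ ⊗_R M`, so these are the
categorical `Λ`-twisted `R[G]`-forms. -/
structure TwistedForm where
  M : Type u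
  N : Type u
  [addCommGroupM : AddCommGroup M]
  [addCommGroupN : AddCommGroup N]
  [moduleM : Module A M]
  [moduleN : Module A N]
  [finiteM : Module.Finite A M]
  [finiteN : Module.Finite A N]
  [projectiveM : Module.Projective A M]
  [projectiveN : Module.Projective A N]
  ξ : B ⊗[A] M ≃ₗ[B] B ⊗[A] N

attribute [instance] TwistedForm.addCommGroupM TwistedForm.addCommGroupN TwistedForm.moduleM
  TwistedForm.moduleN TwistedForm.finiteM TwistedForm.finiteN TwistedForm.projectiveM
  TwistedForm.projectiveN

variable {A B}

/-- A short exact sequence `0 → X → Y → Z → 0` of twisted forms: a pair of short exact sequences of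
`A`-modules that are compatible with the three isomorphisms over `B`. -/
structure TwistedForm.ShortExact (X Y Z : TwistedForm A B) where
  f : X.M →ₗ[A] Y.M
  g : Y.M →ₗ[A] Z.M
  f' : X.N →ₗ[A] Y.N
  g' : Y.N →ₗ[A] Z.N
  f_injective : Function.Injective f
  exact : Function.Exact f g
  g_surjective : Function.Surjective g
  f'_injective : Function.Injective f'
  exact' : Function.Exact f' g'
  g'_surjective : Function.Surjective g'
  comm_left : ∀ x, Y.ξ (f.baseChange B x) = f'.baseChange B (X.ξ x)
  comm_right : ∀ y, Z.ξ (g.baseChange B y) = g'.baseChange B (Y.ξ y)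

variable (A B)

/-- The relations of the relative `K`-group: additivity on short exact sequences, and
`[M, P; η ∘ ξ] = [M, N; ξ] + [N, P; η]`. -/
inductive relK0Relation : FreeAbelianGroup (TwistedForm A B) → Prop
  | exact (X Y Z : TwistedForm A B) (h : X.ShortExact Y Z) :
      relK0Relation (.of Y - (.of X + .of Z))
  | comp (M N P : Type u) [AddCommGroup M] [AddCommGroup N] [AddCommGroup P]
      [Module A M] [Module A N] [Module A P]
      [Module.Finite A M] [Module.Finite A N] [Module.Finite A P]
      [Module.Projective A M] [Module.Projective A N] [Module.Projective A P]
      (ξ : B ⊗[A] M ≃ₗ[B] B ⊗[A] N) (η : B ⊗[A] N ≃ₗ[B] B ⊗[A] P) :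
      relK0Relation (.of ⟨M, P, ξ.trans η⟩ - (.of ⟨M, N, ξ⟩ + .of ⟨N, P, η⟩))

/-- The relative algebraic `K`-group `K₀(A, B)` of a homomorphism `A → B` of commutative rings. -/
def RelK0 : Type (u + 1) :=
  FreeAbelianGroup (TwistedForm A B) ⧸ AddSubgroup.closure {r | relK0Relation A B r}

instance : AddCommGroup (RelK0 A B) :=
  inferInstanceAs (AddCommGroup
    (FreeAbelianGroup (TwistedForm A B) ⧸ AddSubgroup.closure {r | relK0Relation A B r}))

variable {A B}

/-- The class `[M, N; ξ]` of a twisted form in the relative `K`-group. -/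
def TwistedForm.cls (X : TwistedForm A B) : RelK0 A B :=
  QuotientAddGroup.mk (FreeAbelianGroup.of X)

theorem TwistedForm.cls_exact {X Y Z : TwistedForm A B} (h : X.ShortExact Y Z) :
    Y.cls = X.cls + Z.cls := by
  rw [← sub_eq_zero]
  exact (QuotientAddGroup.eq_zero_iff _).2
    (AddSubgroup.subset_closure (relK0Relation.exact X Y Z h))

theorem TwistedForm.cls_comp (M N P : Type u) [AddCommGroup M] [AddCommGroup N] [AddCommGroup P]
    [Module A M] [Module A N] [Module A P]
    [Module.Finite A M] [Module.Finite A N] [Module.Finite A P]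
    [Module.Projective A M] [Module.Projective A N] [Module.Projective A P]
    (ξ : B ⊗[A] M ≃ₗ[B] B ⊗[A] N) (η : B ⊗[A] N ≃ₗ[B] B ⊗[A] P) :
    TwistedForm.cls ⟨M, P, ξ.trans η⟩ =
      TwistedForm.cls ⟨M, N, ξ⟩ + TwistedForm.cls ⟨N, P, η⟩ := by
  rw [← sub_eq_zero]
  exact (QuotientAddGroup.eq_zero_iff _).2
    (AddSubgroup.subset_closure (relK0Relation.comp M N P ξ η))

/-- The homomorphism out of the relative `K`-group defined by a function on twisted forms that
respects the relations. -/
def RelK0.lift {H : Type*} [AddCommGroup H] (φ : TwistedForm A B → H)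
    (hφ : ∀ r, relK0Relation A B r → FreeAbelianGroup.lift φ r = 0) : RelK0 A B →+ H :=
  QuotientAddGroup.lift _ (FreeAbelianGroup.lift φ)
    ((AddSubgroup.closure_le _).2 fun r hr => hφ r hr)

@[simp]
theorem RelK0.lift_cls {H : Type*} [AddCommGroup H] (φ : TwistedForm A B → H)
    (hφ : ∀ r, relK0Relation A B r → FreeAbelianGroup.lift φ r = 0) (X : TwistedForm A B) :
    RelK0.lift φ hφ X.cls = φ X :=
  FreeAbelianGroup.lift_apply_of φ X

theorem RelK0.induction {p : RelK0 A B → Prop} (hcls : ∀ X : TwistedForm A B, p X.cls)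
    (hzero : p 0) (hneg : ∀ x, p x → p (-x)) (hadd : ∀ x y, p x → p y → p (x + y))
    (x : RelK0 A B) : p x := by
  obtain ⟨y, rfl⟩ := QuotientAddGroup.mk_surjective x
  induction y using FreeAbelianGroup.induction_on with
  | zero => exact hzero
  | of X => exact hcls X
  | neg X h => exact hneg _ h
  | add a b ha hb => exact hadd _ _ ha hb

end RelK0

section Functoriality

open TensorProduct.AlgebraTensorModule

variable {A B : Type u} [CommRing A] [CommRing B] [Algebra A B]

/-- Extension of scalars of the isomorphism of a twisted form along `B → B'`, where
`B' ⊗_A M` is identified with `B' ⊗_B (B ⊗_A M)`. -/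
def extendIso (B' : Type u) [CommRing B'] [Algebra A B'] [Algebra B B'] [IsScalarTower A B B']
    {M N : Type u} [AddCommGroup M] [AddCommGroup N] [Module A M] [Module A N]
    (ξ : B ⊗[A] M ≃ₗ[B] B ⊗[A] N) : B' ⊗[A] M ≃ₗ[B'] B' ⊗[A] N :=
  (cancelBaseChange A B B' B' M).symm ≪≫ₗ
    (LinearEquiv.baseChange B B' _ _ ξ) ≪≫ₗ cancelBaseChange A B B' B' N

/-- The isomorphism `B ⊗_{A'} (A' ⊗_A M) ≃ B ⊗_{A'} (A' ⊗_A N)` that corresponds to an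
isomorphism `B ⊗_A M ≃ B ⊗_A N`. -/
def localIso (A' : Type u) [CommRing A'] [Algebra A A'] [Algebra A' B] [IsScalarTower A A' B]
    {M N : Type u} [AddCommGroup M] [AddCommGroup N] [Module A M] [Module A N]
    (ξ : B ⊗[A] M ≃ₗ[B] B ⊗[A] N) : B ⊗[A'] (A' ⊗[A] M) ≃ₗ[B] B ⊗[A'] (A' ⊗[A] N) :=
  cancelBaseChange A A' B B M ≪≫ₗ ξ ≪≫ₗ (cancelBaseChange A A' B B N).symm

/-- The twisted form `(M, N; B' ⊗_B ξ)` relative to `A → B'`. -/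
def TwistedForm.extendTarget (B' : Type u) [CommRing B'] [Algebra A B'] [Algebra B B']
    [IsScalarTower A B B'] (X : TwistedForm A B) : TwistedForm A B' :=
  ⟨X.M, X.N, extendIso B' X.ξ⟩

/-- The twisted form `(A' ⊗_A M, A' ⊗_A N; ξ)` relative to `A' → B`. -/
def TwistedForm.extendSource (A' : Type u) [CommRing A'] [Algebra A A'] [Algebra A' B]
    [IsScalarTower A A' B] (X : TwistedForm A B) : TwistedForm A' B :=
  ⟨A' ⊗[A] X.M, A' ⊗[A] X.N, localIso A' X.ξ⟩

theorem extendIso_tmul_one (B' : Type u) [CommRing B'] [Algebra A B'] [Algebra B B']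
    [IsScalarTower A B B'] {M N : Type u} [AddCommGroup M] [AddCommGroup N] [Module A M]
    [Module A N] (ξ : B ⊗[A] M ≃ₗ[B] B ⊗[A] N) (m : M) :
    extendIso B' ξ (1 ⊗ₜ m) = cancelBaseChange A B B' B' N (1 ⊗ₜ[B] ξ (1 ⊗ₜ m)) := by
  simp [extendIso]

theorem cancelBaseChange_naturality (B' : Type u) [CommRing B'] [Algebra A B'] [Algebra B B']
    [IsScalarTower A B B'] {M N : Type u} [AddCommGroup M] [AddCommGroup N] [Module A M]
    [Module A N] (f : M →ₗ[A] N) (x : B' ⊗[B] (B ⊗[A] M)) :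
    cancelBaseChange A B B' B' N ((f.baseChange B).baseChange B' x) =
      f.baseChange B' (cancelBaseChange A B B' B' M x) := by
  induction x using TensorProduct.induction_on with
  | zero => simp
  | add x y hx hy => simp only [map_add, hx, hy]
  | tmul b y =>
    induction y using TensorProduct.induction_on with
    | zero => simp
    | add x y hx hy => simp only [TensorProduct.tmul_add, map_add, hx, hy]
    | tmul c m => simp

theorem cancelBaseChange_symm_naturality (B' : Type u) [CommRing B'] [Algebra A B'] [Algebra B B']
    [IsScalarTower A B B'] {M N : Type u} [AddCommGroup M] [AddCommGroup N] [Module A M]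
    [Module A N] (f : M →ₗ[A] N) (x : B' ⊗[A] M) :
    (cancelBaseChange A B B' B' N).symm (f.baseChange B' x) =
      (f.baseChange B).baseChange B' ((cancelBaseChange A B B' B' M).symm x) := by
  rw [LinearEquiv.symm_apply_eq, cancelBaseChange_naturality, LinearEquiv.apply_symm_apply]

theorem baseChange_comm (B' : Type u) [CommRing B'] [Algebra A B'] [Algebra B B']
    [IsScalarTower A B B'] {M N M' N' : Type u} [AddCommGroup M] [AddCommGroup N] [Module A M]
    [Module A N] [AddCommGroup M'] [AddCommGroup N'] [Module A M'] [Module A N']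
    (ξ : B ⊗[A] M ≃ₗ[B] B ⊗[A] N) (η : B ⊗[A] M' ≃ₗ[B] B ⊗[A] N')
    (f : M →ₗ[A] M') (f' : N →ₗ[A] N')
    (h : ∀ x, η (f.baseChange B x) = f'.baseChange B (ξ x)) (x : B' ⊗[A] M) :
    extendIso B' η (f.baseChange B' x) = f'.baseChange B' (extendIso B' ξ x) := by
  simp only [extendIso, LinearEquiv.trans_apply]
  rw [cancelBaseChange_symm_naturality]
  generalize (cancelBaseChange A B B' B' M).symm x = y
  rw [← cancelBaseChange_naturality]
  congr 1
  induction y using TensorProduct.induction_on with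
  | zero => simp
  | add x y hx hy => simp only [map_add, hx, hy]
  | tmul b y => simp [h]

/-- Extension of scalars preserves short exact sequences of twisted forms. -/
def TwistedForm.ShortExact.extendTarget (B' : Type u) [CommRing B'] [Algebra A B'] [Algebra B B']
    [IsScalarTower A B B'] {X Y Z : TwistedForm A B} (h : X.ShortExact Y Z) :
    (X.extendTarget B').ShortExact (Y.extendTarget B') (Z.extendTarget B') where
  f := h.f
  g := h.g
  f' := h.f'
  g' := h.g'
  f_injective := h.f_injective
  exact := h.exact
  g_surjective := h.g_surjective
  f'_injective := h.f'_injective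
  exact' := h.exact'
  g'_surjective := h.g'_surjective
  comm_left := baseChange_comm B' X.ξ Y.ξ h.f h.f' h.comm_left
  comm_right := baseChange_comm B' Y.ξ Z.ξ h.g h.g' h.comm_right

theorem baseChange_injective_of_split (A' : Type u) [CommRing A'] [Algebra A A']
    {M N P : Type u} [AddCommGroup M] [AddCommGroup N] [AddCommGroup P] [Module A M] [Module A N]
    [Module A P] [Module.Projective A P] (f : M →ₗ[A] N) (g : N →ₗ[A] P)
    (hf : Function.Injective f) (h : Function.Exact f g) (hg : Function.Surjective g) :
    Function.Injective (f.baseChange A') := by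
  obtain ⟨s, hs⟩ := Module.projective_lifting_property g LinearMap.id hg
  obtain ⟨-, l, hl⟩ := (h.split_tfae'.out 0 1 rfl rfl :
    (Function.Injective f ∧ ∃ l, g ∘ₗ l = LinearMap.id) ↔
      (Function.Surjective g ∧ ∃ l, l ∘ₗ f = LinearMap.id)).1 ⟨hf, s, hs⟩
  refine Function.LeftInverse.injective (g := l.baseChange A') fun x => ?_
  rw [← LinearMap.comp_apply, ← LinearMap.baseChange_comp, hl, LinearMap.baseChange_id,
    LinearMap.id_apply]

theorem localIso_comm (A' : Type u) [CommRing A'] [Algebra A A'] [Algebra A' B]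
    [IsScalarTower A A' B] {M N M' N' : Type u} [AddCommGroup M] [AddCommGroup N] [Module A M]
    [Module A N] [AddCommGroup M'] [AddCommGroup N'] [Module A M'] [Module A N']
    (ξ : B ⊗[A] M ≃ₗ[B] B ⊗[A] N) (η : B ⊗[A] M' ≃ₗ[B] B ⊗[A] N')
    (f : M →ₗ[A] M') (f' : N →ₗ[A] N')
    (h : ∀ x, η (f.baseChange B x) = f'.baseChange B (ξ x)) (x : B ⊗[A'] (A' ⊗[A] M)) :
    localIso A' η ((f.baseChange A').baseChange B x) =
      (f'.baseChange A').baseChange B (localIso A' ξ x) := by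
  simp only [localIso, LinearEquiv.trans_apply]
  rw [cancelBaseChange_naturality, h, cancelBaseChange_symm_naturality]

/-- Localisation preserves short exact sequences of twisted forms. -/
def TwistedForm.ShortExact.extendSource (A' : Type u) [CommRing A'] [Algebra A A'] [Algebra A' B]
    [IsScalarTower A A' B] {X Y Z : TwistedForm A B} (h : X.ShortExact Y Z) :
    (X.extendSource A').ShortExact (Y.extendSource A') (Z.extendSource A') where
  f := h.f.baseChange A'
  g := h.g.baseChange A'
  f' := h.f'.baseChange A'
  g' := h.g'.baseChange A'
  f_injective := baseChange_injective_of_split A' h.f h.g h.f_injective h.exact h.g_surjective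
  exact := lTensor_exact A' h.exact h.g_surjective
  g_surjective := LinearMap.lTensor_surjective A' h.g_surjective
  f'_injective := baseChange_injective_of_split A' h.f' h.g' h.f'_injective h.exact' h.g'_surjective
  exact' := lTensor_exact A' h.exact' h.g'_surjective
  g'_surjective := LinearMap.lTensor_surjective A' h.g'_surjective
  comm_left := localIso_comm A' X.ξ Y.ξ h.f h.f' h.comm_left
  comm_right := localIso_comm A' Y.ξ Z.ξ h.g h.g' h.comm_right

/-- The homomorphism `K₀(A, B) → K₀(A, B')`, `[M, N; ξ] ↦ [M, N; B' ⊗_B ξ]`. -/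
def RelK0.extendTarget (A B B' : Type u) [CommRing A] [CommRing B] [Algebra A B] [CommRing B']
    [Algebra A B'] [Algebra B B'] [IsScalarTower A B B'] : RelK0 A B →+ RelK0 A B' :=
  RelK0.lift (fun X => (X.extendTarget B').cls) <| by
    rintro _ (⟨X, Y, Z, h⟩ | ⟨M, N, P, ξ, η⟩)
    · simp only [map_sub, map_add, FreeAbelianGroup.lift_apply_of]
      rw [TwistedForm.cls_exact (h.extendTarget B'), sub_self]
    · simp only [map_sub, map_add, FreeAbelianGroup.lift_apply_of]
      rw [sub_eq_zero]
      refine Eq.trans ?_ (TwistedForm.cls_comp M N P (extendIso B' ξ) (extendIso B' η))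
      simp only [TwistedForm.extendTarget]
      congr 2
      ext x
      simp only [extendIso, LinearEquiv.trans_apply, LinearEquiv.symm_apply_apply]
      congr 1
      generalize (cancelBaseChange A B B' B' M).symm x = y
      induction y using TensorProduct.induction_on with
      | zero => simp
      | add x y hx hy => simp only [map_add, hx, hy]
      | tmul b y => simp

/-- The homomorphism `K₀(A, B) → K₀(A', B)`, `[M, N; ξ] ↦ [A' ⊗_A M, A' ⊗_A N; ξ]`. -/
def RelK0.extendSource (A A' B : Type u) [CommRing A] [CommRing B] [Algebra A B] [CommRing A']
    [Algebra A A'] [Algebra A' B] [IsScalarTower A A' B] : RelK0 A B →+ RelK0 A' B :=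
  RelK0.lift (fun X => (X.extendSource A').cls) <| by
    rintro _ (⟨X, Y, Z, h⟩ | ⟨M, N, P, ξ, η⟩)
    · simp only [map_sub, map_add, FreeAbelianGroup.lift_apply_of]
      rw [TwistedForm.cls_exact (h.extendSource A'), sub_self]
    · simp only [map_sub, map_add, FreeAbelianGroup.lift_apply_of]
      rw [sub_eq_zero]
      refine Eq.trans ?_ (TwistedForm.cls_comp _ _ _ (localIso A' ξ) (localIso A' η))
      simp only [TwistedForm.extendSource]
      congr 2
      ext x
      simp [localIso]

end Functoriality

end RelativeK

namespace RelativeK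

section Integral

open TensorProduct.AlgebraTensorModule

variable {A D B : Type u} [CommRing A] [CommRing D] [CommRing B] [Algebra A D] [Algebra D B]
  [Algebra A B] [IsScalarTower A D B]

variable (A D B) in
/-- The map `D ⊗_A N → B ⊗_A N` induced by `D → B`. -/
def extendMap (N : Type u) [AddCommGroup N] [Module A N] : D ⊗[A] N →ₗ[D] B ⊗[A] N :=
  TensorProduct.AlgebraTensorModule.map (Algebra.linearMap D B) LinearMap.id

theorem extendMap_injective (N : Type u) [AddCommGroup N] [Module A N] [Module.Projective A N]
    (h : Function.Injective (algebraMap D B)) : Function.Injective (extendMap A D B N) :=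
  Module.Flat.rTensor_preserves_injective_linearMap (M := N)
    (IsScalarTower.toAlgHom A D B).toLinearMap h

theorem cancelBaseChange_one_tmul (N : Type u) [AddCommGroup N] [Module A N] (y : D ⊗[A] N) :
    cancelBaseChange A D B B N (1 ⊗ₜ y) = extendMap A D B N y := by
  induction y using TensorProduct.induction_on with
  | zero => simp
  | add x y hx hy => simp only [TensorProduct.tmul_add, map_add, hx, hy]
  | tmul c m => simp [extendMap, Algebra.smul_def]

theorem map_extendMap_mem {M N : Type u} [AddCommGroup M] [AddCommGroup N] [Module A M]
    [Module A N] (ξ : B ⊗[A] M ≃ₗ[B] B ⊗[A] N)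
    (h : ∀ m, ξ (1 ⊗ₜ m) ∈ LinearMap.range (extendMap A D B N)) (y : D ⊗[A] M) :
    ξ (extendMap A D B M y) ∈ LinearMap.range (extendMap A D B N) := by
  induction y using TensorProduct.induction_on with
  | zero => simp
  | add x y hx hy => rw [map_add, map_add]; exact add_mem hx hy
  | tmul c m =>
    have : extendMap A D B M (c ⊗ₜ m) = c • ((1 : B) ⊗ₜ[A] m) := by
      simp [extendMap, TensorProduct.smul_tmul', Algebra.smul_def]
    rw [this, ← IsScalarTower.algebraMap_smul B, map_smul, IsScalarTower.algebraMap_smul]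
    exact Submodule.smul_mem _ _ (h m)

/-- A twisted form relative to `A → B` whose isomorphism and its inverse are defined over a subring
`D` of `B` comes from a twisted form relative to `A → D`. -/
theorem cls_mem_range_extendTarget (X : TwistedForm A B)
    (hD : Function.Injective (algebraMap D B))
    (h : ∀ m, X.ξ (1 ⊗ₜ m) ∈ LinearMap.range (extendMap A D B X.N))
    (h' : ∀ n, X.ξ.symm (1 ⊗ₜ n) ∈ LinearMap.range (extendMap A D B X.M)) :
    X.cls ∈ (RelK0.extendTarget A D B).range := by
  have hmap : (LinearMap.range (extendMap A D B X.M)).map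
      (X.ξ.restrictScalars D : B ⊗[A] X.M ≃ₗ[D] B ⊗[A] X.N).toLinearMap =
      LinearMap.range (extendMap A D B X.N) := by
    apply le_antisymm
    · rintro _ ⟨_, ⟨y, rfl⟩, rfl⟩
      exact map_extendMap_mem X.ξ h y
    · rintro _ ⟨y, rfl⟩
      exact ⟨_, map_extendMap_mem X.ξ.symm h' y, X.ξ.apply_symm_apply _⟩
  let e : D ⊗[A] X.M ≃ₗ[D] D ⊗[A] X.N :=
    (LinearEquiv.ofInjective _ (extendMap_injective X.M hD)) ≪≫ₗ
      (X.ξ.restrictScalars D).submoduleMap _ ≪≫ₗ LinearEquiv.ofEq _ _ hmap ≪≫ₗ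
      (LinearEquiv.ofInjective _ (extendMap_injective X.N hD)).symm
  have he (y) : extendMap A D B X.N (e y) = X.ξ (extendMap A D B X.M y) := by
    have := congrArg Subtype.val ((LinearEquiv.ofInjective _
      (extendMap_injective (A := A) (B := B) X.N hD)).apply_symm_apply
      (LinearEquiv.ofEq _ _ hmap ((X.ξ.restrictScalars D).submoduleMap _
        (LinearEquiv.ofInjective _ (extendMap_injective X.M hD) y))))
    exact this
  refine ⟨TwistedForm.cls ⟨X.M, X.N, e⟩, ?_⟩
  have hext : extendIso B e = X.ξ := by
    apply LinearEquiv.toLinearMap_injective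
    apply TensorProduct.AlgebraTensorModule.curry_injective
    refine LinearMap.ext_ring (LinearMap.ext fun m => ?_)
    change extendIso B e (1 ⊗ₜ m) = X.ξ (1 ⊗ₜ m)
    rw [extendIso_tmul_one, cancelBaseChange_one_tmul, he]
    simp [extendMap]
  simp only [RelK0.extendTarget, RelK0.lift_cls, TwistedForm.extendTarget, hext]

variable (A B) in
/-- The class `[M, A; ξ]` of a finitely generated projective `A`-module `M`, where
`ξ : B ⊗_A M ≃ B = B ⊗_A A` is the isomorphism `b ⊗ m ↦ b • f m` afforded by an `A`-linear map
`f : M → B` that exhibits `B` as the base change of `M`. -/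
def rankOneClass (M : Type u) [AddCommGroup M] [Module A M] [Module.Finite A M]
    [Module.Projective A M] (f : M →ₗ[A] B) (hf : IsBaseChange B f) : RelK0 A B :=
  TwistedForm.cls ⟨M, A, hf.equiv ≪≫ₗ (TensorProduct.AlgebraTensorModule.rid A B B).symm⟩

end Integral

end RelativeK

namespace GaloisAlg

open scoped AlgebraMonoidAlgebra
open MonoidAlgebra (single)

section Defs

variable (R K C G : Type u) [CommRing R] [Field K] [Field C] [Algebra R K] [Algebra K C]
  [Algebra R C] [IsScalarTower R K C] [CommGroup G]

/-- `H¹(K, G)` for an abelian group `G` on which the absolute Galois group `Gal(C/K)` acts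
trivially (`C` an algebraic closure of `K`), i.e. the set of continuous homomorphisms
`Gal(C/K) → G`; continuity is expressed by openness of the kernel. (A `1`-cocycle is a homomorphism
and all `1`-coboundaries are trivial.) -/
structure H1 where
  toHom : Gal(C/K) →* G
  isOpen_ker : IsOpen (toHom.ker : Set Gal(C/K))

variable {K C G}

/-- The Galois algebra `K_π = Map_{Gal(C/K)}(^π G, C)`: functions `a : G → C` with
`ω (a γ) = a (γ * π ω)`. -/
def H1.algebra (π : H1 K C G) : Subalgebra K (G → C) where
  carrier := {a | ∀ (ω : Gal(C/K)) (γ : G), ω (a γ) = a (γ * π.toHom ω)}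
  mul_mem' ha hb ω γ := by simp [ha ω γ, hb ω γ]
  add_mem' ha hb ω γ := by simp [ha ω γ, hb ω γ]
  algebraMap_mem' r ω γ := by simp

/-- Translation by `g` on `K_π`: `(g • a) γ = a (γ * g)`. -/
def H1.translate (π : H1 K C G) (g : G) : π.algebra →ₐ[K] π.algebra where
  toFun a := ⟨fun γ => a.1 (γ * g), fun ω γ => by
    rw [a.2 ω (γ * g), mul_right_comm γ g (π.toHom ω)]⟩
  map_one' := rfl
  map_mul' _ _ := rfl
  map_zero' := rfl
  map_add' _ _ := rfl
  commutes' _ := rfl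

/-- `O_π`: the integral closure of `R` in the Galois algebra `K_π`. -/
def H1.integers (π : H1 K C G) : Subalgebra R π.algebra := integralClosure R π.algebra

/-- The type of elements of `O_π`, which is made into a module over the group ring `R[G]` below. -/
def H1.Integers (π : H1 K C G) : Type u := π.integers R

instance (π : H1 K C G) : AddCommGroup (π.Integers R) :=
  inferInstanceAs (AddCommGroup (π.integers R))

instance (π : H1 K C G) : Module R (π.Integers R) := inferInstanceAs (Module R (π.integers R))

/-- The tautological identification of `π.Integers R` with `O_π`. -/
def H1.integersEquiv (π : H1 K C G) : π.Integers R ≃ₗ[R] π.integers R := LinearEquiv.refl R _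

/-- The action of `G` on `O_π` given by `(g • a) γ = a (γ * g)`. -/
def H1.rep (π : H1 K C G) : Representation R G (π.Integers R) where
  toFun g :=
    { toFun a := (π.integersEquiv R).symm ⟨π.translate g (π.integersEquiv R a).1,
        IsIntegral.map ((π.translate g).restrictScalars R) (π.integersEquiv R a).2⟩
      map_add' a b := rfl
      map_smul' r a := rfl }
  map_one' := by
    refine LinearMap.ext fun a => Subtype.ext (Subtype.ext (funext fun γ => ?_))
    exact congrArg a.1.1 (mul_one γ)
  map_mul' g h := by
    refine LinearMap.ext fun a => Subtype.ext (Subtype.ext (funext fun γ => ?_))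
    exact congrArg a.1.1 (mul_assoc γ g h).symm

/-- `O_π` as a module over the group ring `R[G]`, so that `(α • a) γ = ∑ g, α g * a (γ * g)`. -/
instance (π : H1 K C G) : Module (MonoidAlgebra R G) (π.Integers R) :=
  Module.compHom _ (π.rep R).asAlgebraHom.toRingHom

theorem H1.smul_def (π : H1 K C G) (α : MonoidAlgebra R G) (a : π.Integers R) :
    α • a = (π.rep R).asAlgebraHom α a := rfl

instance (π : H1 K C G) : IsScalarTower R (MonoidAlgebra R G) (π.Integers R) where
  smul_assoc r α a := by rw [H1.smul_def, H1.smul_def, map_smul, LinearMap.smul_apply]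

/-- The function `G → C` underlying an element of `O_π`. -/
def H1.toFun (π : H1 K C G) (a : π.Integers R) : G → C := (π.integersEquiv R a).1.1

theorem H1.toFun_add (π : H1 K C G) (a b : π.Integers R) :
    π.toFun R (a + b) = π.toFun R a + π.toFun R b := rfl

theorem H1.toFun_smul (π : H1 K C G) (r : R) (a : π.Integers R) :
    π.toFun R (r • a) = r • π.toFun R a := rfl

theorem H1.toFun_single_smul (π : H1 K C G) (g : G) (a : π.Integers R) :
    π.toFun R (single g (1 : R) • a) = fun γ => π.toFun R a (γ * g) := by
  rw [H1.smul_def, Representation.asAlgebraHom_single, one_smul]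
  rfl

theorem H1.toFun_injective (π : H1 K C G) : Function.Injective (π.toFun R) :=
  fun _ _ h => (π.integersEquiv R).injective (Subtype.ext (Subtype.ext h))

variable [Fintype G]

/-- The resolvend map `Map(G, C) → C[G]`, `a ↦ ∑ s, a(s) s⁻¹`. -/
def resolvend : (G → C) →ₗ[C] MonoidAlgebra C G where
  toFun a := ∑ s, single s⁻¹ (a s)
  map_add' a b := by simp [Finset.sum_add_distrib]
  map_smul' r a := by simp [Finset.smul_sum]

theorem coeff_resolvend (a : G → C) (t : G) : (resolvend a).coeff t = a t⁻¹ := by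
  classical
  simp [resolvend, Finsupp.single_apply, inv_eq_iff_eq_inv]

theorem resolvend_injective : Function.Injective (resolvend : (G → C) →ₗ[C] MonoidAlgebra C G) := by
  intro a b h
  funext t
  simpa [coeff_resolvend] using congrArg (fun x => MonoidAlgebra.coeff x t⁻¹) h

theorem single_mul_resolvend (a : G → C) (g : G) :
    single g 1 * resolvend a = resolvend (fun γ => a (γ * g)) := by
  ext t
  simp [coeff_resolvend]

/-- The resolvend map on `O_π`, as a homomorphism of `R[G]`-modules `O_π → C[G]`. -/
def H1.resolvend (π : H1 K C G) : π.Integers R →ₗ[MonoidAlgebra R G] MonoidAlgebra C G :=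
  MonoidAlgebra.equivariantOfLinearOfComm
    ({ toFun a := GaloisAlg.resolvend (π.toFun R a)
       map_add' a b := by rw [H1.toFun_add, map_add]
       map_smul' r a := by
        rw [H1.toFun_smul, ← IsScalarTower.algebraMap_smul C, map_smul,
          IsScalarTower.algebraMap_smul, RingHom.id_apply] } :
      π.Integers R →ₗ[R] MonoidAlgebra C G) fun g a => by
      rw [Algebra.smul_def, MonoidAlgebra.algebraMap_def, MonoidAlgebra.mapRingHom_single, map_one]
      exact (congrArg GaloisAlg.resolvend (H1.toFun_single_smul R π g a)).trans
        (single_mul_resolvend _ g).symm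

theorem H1.resolvend_apply (π : H1 K C G) (a : π.Integers R) :
    π.resolvend R a = GaloisAlg.resolvend (π.toFun R a) := rfl

theorem isIntegral_pi {ι : Type u} [Fintype ι] (a : ι → C) (h : ∀ γ, IsIntegral R (a γ)) : IsIntegral R a := by
  classical
  choose p hp hpa using h
  refine ⟨∏ γ, p γ, Polynomial.monic_prod_of_monic _ _ fun γ _ => hp γ, ?_⟩
  funext γ
  have := Polynomial.hom_eval₂ (∏ γ, p γ) (algebraMap R (ι → C)) (Pi.evalRingHom _ γ) a
  rw [Pi.evalRingHom_apply] at this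
  rw [this, ← Finset.mul_prod_erase _ _ (Finset.mem_univ γ), Polynomial.eval₂_mul]
  have h2 : Polynomial.eval₂ (algebraMap R C) (a γ) (p γ) = 0 := hpa γ
  exact (congrArg (· * _) h2).trans (zero_mul _)

/-- The element of `O_π` given by an integral-valued function in `K_π`. -/
def H1.mkInt (π : H1 K C G) (a : G → C) (ha : a ∈ π.algebra) (h : ∀ γ, IsIntegral R (a γ)) :
    π.Integers R :=
  (π.integersEquiv R).symm ⟨⟨a, ha⟩,
    (isIntegral_algHom_iff (π.algebra.val.restrictScalars R) Subtype.val_injective).1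
      (isIntegral_pi R a h)⟩

end Defs

section Field

variable {K C G : Type u} [Field K] [Field C] [Algebra K C] [CommGroup G]

/-- The field `K^π`, the fixed field of the kernel of `π`; the algebra `K_π` is a product of copies
of this field. -/
def H1.field (π : H1 K C G) : IntermediateField K C := IntermediateField.fixedField π.toHom.ker

variable [IsGalois K C]

theorem H1.fixingSubgroup_field (π : H1 K C G) : π.field.fixingSubgroup = π.toHom.ker :=
  InfiniteGalois.fixingSubgroup_fixedField
    ⟨π.toHom.ker, Subgroup.isClosed_of_isOpen _ π.isOpen_ker⟩

instance (π : H1 K C G) : FiniteDimensional K π.field := by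
  rw [← InfiniteGalois.isOpen_iff_finite, π.fixingSubgroup_field]
  exact π.isOpen_ker

instance (π : H1 K C G) : IsGalois K π.field := by
  rw [← InfiniteGalois.normal_iff_isGalois, π.fixingSubgroup_field]
  infer_instance

theorem H1.exists_bar (π : H1 K C G) : ∃ p : Gal(π.field/K) →* G, Function.Injective p ∧
    ∀ ω : Gal(C/K), p (AlgEquiv.restrictNormalHom π.field ω) = π.toHom ω := by
  have hs := AlgEquiv.restrictNormalHom_surjective (F := K) (K₁ := π.field) C
  have hk : (AlgEquiv.restrictNormalHom (F := K) (K₁ := C) π.field).ker = π.toHom.ker := by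
    rw [IntermediateField.restrictNormalHom_ker, π.fixingSubgroup_field]
  have h1 := MonoidHom.liftOfRightInverse_comp_apply _ _ (Function.rightInverse_surjInv hs)
    ⟨π.toHom, hk.le⟩
  refine ⟨MonoidHom.liftOfRightInverse _ _ (Function.rightInverse_surjInv hs)
    ⟨π.toHom, hk.le⟩, ?_, h1⟩
  rw [injective_iff_map_eq_one]
  intro σ hσ
  obtain ⟨ω, rfl⟩ := hs σ
  have h2 : ω ∈ π.toHom.ker := (h1 ω).symm.trans hσ
  rwa [← hk] at h2

/-- The homomorphism `Gal(K^π/K) → G` induced by `π`. -/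
def H1.bar (π : H1 K C G) : Gal(π.field/K) →* G := π.exists_bar.choose

theorem H1.bar_injective (π : H1 K C G) : Function.Injective π.bar := π.exists_bar.choose_spec.1

theorem H1.bar_restrict (π : H1 K C G) (ω : Gal(C/K)) :
    π.bar (AlgEquiv.restrictNormalHom π.field ω) = π.toHom ω := π.exists_bar.choose_spec.2 ω

open Classical in
/-- The function on `G` that takes the value `σ b` at the image of `σ ∈ Gal(K^π/K)` in `G` and
vanishes elsewhere. -/
def H1.spread (π : H1 K C G) (b : π.field) : G → C := fun γ =>
  ∑ σ : Gal(π.field/K), if π.bar σ = γ then ((σ b : π.field) : C) else 0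

theorem H1.spread_mem (π : H1 K C G) (b : π.field) : π.spread b ∈ π.algebra := by
  intro ω γ
  simp only [H1.spread, map_sum]
  refine Fintype.sum_equiv (Equiv.mulLeft (AlgEquiv.restrictNormalHom π.field ω)) _ _ fun σ => ?_
  have h1 : π.bar (AlgEquiv.restrictNormalHom π.field ω * σ) = γ * π.toHom ω ↔ π.bar σ = γ := by
    rw [map_mul, π.bar_restrict, mul_comm, mul_left_inj]
  rw [Equiv.coe_mulLeft]
  by_cases h : π.bar σ = γ
  · rw [if_pos h, if_pos (h1.2 h)]
    exact (AlgEquiv.restrictNormal_commutes ω π.field (σ b)).symm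
  · rw [if_neg h, if_neg (mt h1.1 h), map_zero]

theorem H1.isIntegral_spread (R : Type u) [CommRing R] [Algebra R K] [Algebra R C]
    [IsScalarTower R K C] (π : H1 K C G) (b : π.field) (hb : IsIntegral R b) (γ : G) :
    IsIntegral R (π.spread b γ) := by
  refine IsIntegral.sum _ fun σ _ => ?_
  split_ifs with h
  · exact (hb.map (σ.toAlgHom.restrictScalars R)).map (π.field.val.restrictScalars R)
  · exact isIntegral_zero

theorem H1.sum_spread [Fintype G] (π : H1 K C G) (b : π.field) :
    ∑ γ, π.spread b γ = ((∑ σ : Gal(π.field/K), σ b : π.field) : C) := by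
  simp only [H1.spread]
  rw [Finset.sum_comm, AddSubmonoidClass.coe_finsetSum]
  exact Finset.sum_congr rfl fun σ _ => by
    rw [Fintype.sum_eq_single (π.bar σ) fun γ h => if_neg h.symm, if_pos rfl]

theorem H1.isUnit_resolvend_spread [Fintype G] (π : H1 K C G) (b : π.field)
    (hb : LinearIndependent K fun σ : Gal(π.field/K) => σ b) :
    IsUnit (GaloisAlg.resolvend (π.spread b)) := by
  have hC : IsArtinianRing (MonoidAlgebra C G) := IsArtinianRing.of_finite C _
  refine IsArtinianRing.isUnit_of_mem_nonZeroDivisors ?_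
  rw [mem_nonZeroDivisors_iff_right]
  intro β hβ
  have hres : GaloisAlg.resolvend (π.spread b) =
      ∑ σ : Gal(π.field/K), single (π.bar σ)⁻¹ ((σ b : π.field) : C) := by
    ext t
    simp only [coeff_resolvend, H1.spread, MonoidAlgebra.coeff_sum, Finsupp.finsetSum_apply,
      MonoidAlgebra.coeff_single]
    exact Finset.sum_congr rfl fun σ _ => by
      classical simp [Finsupp.single_apply, inv_eq_iff_eq_inv]
  have hcoef (t : G) : ∑ σ : Gal(π.field/K), β.coeff (t * π.bar σ) * ((σ b : π.field) : C) = 0 := by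
    have := congrArg (fun x => MonoidAlgebra.coeff x t) hβ
    simpa [hres, Finset.mul_sum] using this
  have hcomm (σ τ : Gal(π.field/K)) : σ * τ = τ * σ :=
    π.bar_injective (by rw [map_mul, map_mul, mul_comm])
  have hspan : Submodule.span K (Set.range fun σ : Gal(π.field/K) => σ b) = ⊤ :=
    hb.span_eq_top_of_card_eq_finrank' (by
      rw [← IsGalois.card_aut_eq_finrank, Nat.card_eq_fintype_card])
  ext t
  have hlin : ∑ ρ : Gal(π.field/K), β.coeff (t * π.bar ρ) •
      (π.field.val.comp (ρ : π.field →ₐ[K] π.field)).toLinearMap = 0 := by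
    refine LinearMap.ext_on_range hspan fun τ => ?_
    have h := hcoef (t * π.bar τ⁻¹)
    rw [LinearMap.zero_apply, ← h]
    simp only [LinearMap.sum_apply, LinearMap.smul_apply]
    refine Fintype.sum_equiv (Equiv.mulLeft τ) _ _ fun ρ => ?_
    simp only [Equiv.coe_mulLeft]
    rw [mul_assoc, ← map_mul, inv_mul_cancel_left]
    rw [hcomm τ ρ]
    rfl
  have h0 := (Fintype.linearIndependent_iff.1 ((linearIndependent_algHom_toLinearMap K π.field C).comp
    (fun ρ : Gal(π.field/K) => π.field.val.comp (ρ : π.field →ₐ[K] π.field)) fun ρ ρ' h => by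
      ext x
      exact congrArg (fun f : π.field →ₐ[K] C => f x) h)) _ hlin 1
  simpa using h0

end Field

end GaloisAlg

namespace GaloisAlg

open scoped Pointwise

section GaloisRing

variable {R S Γ : Type u} [CommRing R] [CommRing S] [Algebra R S] [Group Γ] [Fintype Γ]
  [MulSemiringAction Γ S] [SMulCommClass Γ R S]

/-- If the order of the inertia group of a maximal ideal `P` is not divisible by the residue
characteristic, then the trace takes a value outside `P`. -/
theorem exists_sum_smul_notMem (p : Ideal R) (P : Ideal S) [P.IsMaximal] [P.LiesOver p]
    (h : ((Nat.card (P.inertia Γ) : ℕ) : S ⧸ P) ≠ 0) : ∃ y : S, ∑ σ : Γ, σ • y ∉ P := by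
  classical
  let _ : Field (S ⧸ P) := Ideal.Quotient.field P
  let φ := Ideal.Quotient.stabilizerHom P p Γ
  obtain ⟨b, hb⟩ : ∃ b : S ⧸ P, ∑ σ : MulAction.stabilizer Γ P, φ σ b ≠ 0 := by
    by_contra! hcon
    have hli := linearIndependent_iff'.1 (linearIndependent_monoidHom (S ⧸ P) (S ⧸ P))
    let ψ : MulAction.stabilizer Γ P → ((S ⧸ P) →* (S ⧸ P)) := fun σ =>
      ((φ σ : (S ⧸ P) →+* (S ⧸ P)) : (S ⧸ P) →* (S ⧸ P))
    have h0 := hli (Finset.univ.image ψ)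
      (fun τ => ((Finset.univ.filter fun σ => ψ σ = τ).card : S ⧸ P)) (by
        funext x
        have := Finset.sum_comp (s := Finset.univ) (fun τ : (S ⧸ P) →* (S ⧸ P) => τ x) ψ
        rw [Finset.sum_apply, Pi.zero_apply, ← hcon x]
        refine Eq.trans ?_ this.symm
        simp) (ψ 1) (Finset.mem_image_of_mem _ (Finset.mem_univ _))
    apply h
    rw [← h0]
    congr 1
    rw [← Ideal.Quotient.map_ker_stabilizer_subtype P p Γ,
      ← Nat.card_congr ((φ.ker.equivMapOfInjective _ (Subgroup.subtype_injective _)).toEquiv)]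
    refine Nat.subtype_card _ fun σ => ?_
    rw [Finset.mem_filter_univ, MonoidHom.mem_ker]
    constructor
    · intro hσ
      ext x
      simpa [ψ] using DFunLike.congr_fun hσ x
    · intro hσ
      ext x
      simp [ψ, hσ]
  obtain ⟨y₀, rfl⟩ := Ideal.Quotient.mk_surjective b
  have hsep (σ : Γ) (hσ : σ ∉ MulAction.stabilizer Γ P) : ∃ e : S, σ • e ∈ P ∧ e - 1 ∈ P := by
    have hne : P ≠ σ⁻¹ • P := fun hP => hσ (by
      rw [MulAction.mem_stabilizer_iff]
      nth_rewrite 1 [hP]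
      rw [smul_inv_smul])
    have hmax : (σ⁻¹ • P).IsMaximal := by
      rw [Ideal.pointwise_smul_eq_comap]
      exact Ideal.comap_isMaximal_of_equiv _
    obtain ⟨a, ha, c, hc, hac⟩ := Submodule.mem_sup.1
      ((Ideal.eq_top_iff_one _).1 (Ideal.IsMaximal.coprime_of_ne ‹P.IsMaximal› hmax hne))
    refine ⟨c, Ideal.mem_inv_pointwise_smul_iff.1 hc, ?_⟩
    rw [← hac, sub_add_cancel_right]
    exact neg_mem ha
  choose! e he he1 using hsep
  set E : S := ∏ σ ∈ Finset.univ.filter (· ∉ MulAction.stabilizer Γ P), e σ with hE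
  have hE1 : Ideal.Quotient.mk P E = 1 := by
    rw [hE, map_prod]
    refine Finset.prod_eq_one fun σ hσ => ?_
    rw [← map_one (Ideal.Quotient.mk P), Ideal.Quotient.eq]
    exact he1 σ (Finset.mem_filter.1 hσ).2
  have hE0 (σ : Γ) (hσ : σ ∉ MulAction.stabilizer Γ P) : σ • E ∈ P := by
    rw [hE, Finset.smul_prod']
    rw [← Finset.mul_prod_erase _ _ (Finset.mem_filter.2 ⟨Finset.mem_univ σ, hσ⟩)]
    exact Ideal.mul_mem_right _ _ (he σ hσ)
  refine ⟨E * y₀, fun hmem => hb ?_⟩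
  rw [← Ideal.Quotient.eq_zero_iff_mem, map_sum] at hmem
  rw [← hmem]
  have hsub := Finset.sum_subtype (F := inferInstanceAs (Fintype (MulAction.stabilizer Γ P))) (Finset.univ.filter (· ∈ MulAction.stabilizer Γ P))
    (p := (· ∈ MulAction.stabilizer Γ P)) (by simp)
    (fun σ => Ideal.Quotient.mk P (σ • (E * y₀)))
  rw [← Finset.sum_filter_add_sum_filter_not Finset.univ (· ∈ MulAction.stabilizer Γ P),
    Finset.sum_eq_zero (s := Finset.univ.filter (· ∉ MulAction.stabilizer Γ P)), add_zero, hsub]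
  · refine Finset.sum_congr rfl fun σ _ => ?_
    have : Ideal.Quotient.mk P (E * y₀) = Ideal.Quotient.mk P y₀ := by rw [map_mul, hE1, one_mul]
    rw [← this]
    rfl
  · intro σ hσ
    rw [Ideal.Quotient.eq_zero_iff_mem, smul_mul']
    exact Ideal.mul_mem_right _ _ (hE0 σ (Finset.mem_filter.1 hσ).2)

theorem mem_span_of_inertia_eq_bot
    (h : ∀ (P : Ideal S) (_ : P.IsMaximal), P.inertia Γ = ⊥) [DecidableEq Γ] :
    (Pi.single 1 1 : Γ → S) ∈
      Submodule.span S (Set.range fun (y : S) (σ : Γ) => σ • y) := by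
  set W := Submodule.span S (Set.range fun (y : S) (σ : Γ) => σ • y) with hW
  have hgen (y : S) : (fun σ : Γ => σ • y) ∈ W := Submodule.subset_span ⟨y, rfl⟩
  have hone : (1 : Γ → S) ∈ W := by
    convert hgen 1 using 1
    funext σ; simp
  have hmul (v w : Γ → S) (hv : v ∈ W) (hw : w ∈ W) : v * w ∈ W := by
    have : W * W ≤ W := by
      rw [hW, Submodule.span_mul_span]
      refine Submodule.span_mono ?_
      rintro _ ⟨_, ⟨y, rfl⟩, _, ⟨z, rfl⟩, rfl⟩
      exact ⟨y * z, by funext σ; simp⟩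
    exact this (Submodule.mul_mem_mul hv hw)
  have hsep (σ : Γ) (hσ : σ ≠ 1) : ∃ w ∈ W, w 1 = 1 ∧ w σ = 0 := by
    have htop : Ideal.span (Set.range fun s : S => s - σ • s) = ⊤ := by
      by_contra hne
      obtain ⟨P, hP, hle⟩ := Ideal.exists_le_maximal _ hne
      have : σ ∈ P.inertia Γ := fun x => by
        have := hle (Ideal.subset_span ⟨x, rfl⟩)
        rw [← neg_sub]
        exact neg_mem this
      rw [h P hP] at this
      exact hσ this
    have h1 : (1 : S) ∈ Ideal.span (Set.range fun s : S => s - σ • s) := htop ▸ Submodule.mem_top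
    suffices H : ∀ x ∈ Ideal.span (Set.range fun s : S => s - σ • s), ∃ w ∈ W, w 1 = x ∧ w σ = 0 from
      H 1 h1
    intro x hx
    induction hx using Submodule.span_induction with
    | mem x hx =>
      obtain ⟨s, rfl⟩ := hx
      exact ⟨(fun τ : Γ => τ • s) - (σ • s) • 1, sub_mem (hgen s) (W.smul_mem _ hone),
        by simp, by simp⟩
    | zero => exact ⟨0, zero_mem _, rfl, rfl⟩
    | add x y _ _ hx hy =>
      obtain ⟨v, hv, hv1, hv2⟩ := hx
      obtain ⟨w, hw, hw1, hw2⟩ := hy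
      exact ⟨v + w, add_mem hv hw, by simp [hv1, hw1], by simp [hv2, hw2]⟩
    | smul a x _ hx =>
      obtain ⟨v, hv, hv1, hv2⟩ := hx
      exact ⟨a • v, W.smul_mem _ hv, by simp [hv1], by simp [hv2]⟩
  choose! w hwW hw1 hw0 using hsep
  have hprod : ∏ σ ∈ Finset.univ.erase (1 : Γ), w σ ∈ W :=
    Finset.prod_induction _ (· ∈ W) hmul hone fun σ hσ => hwW σ (Finset.ne_of_mem_erase hσ)
  convert hprod using 1
  funext τ
  rw [Finset.prod_apply]
  by_cases hτ : τ = 1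
  · subst hτ
    rw [Pi.single_eq_same, Finset.prod_eq_one fun σ hσ => hw1 σ (Finset.ne_of_mem_erase hσ)]
  · rw [Pi.single_eq_of_ne hτ]
    exact (Finset.prod_eq_zero (f := fun σ => w σ τ) (Finset.mem_erase.2 ⟨hτ, Finset.mem_univ τ⟩)
      (hw0 τ hτ)).symm

end GaloisRing

end GaloisAlg

namespace GaloisAlg

open scoped AlgebraMonoidAlgebra
open MonoidAlgebra (single)

section Ramification

variable (R : Type u) {K C G : Type u} [CommRing R] [Field K] [Field C] [Algebra R K] [Algebra K C]
  [Algebra R C] [IsScalarTower R K C] [CommGroup G]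

/-- The class `π` is at most tamely ramified: no ramification index of `K^π/K` is divisible by the
residue characteristic. (All residue fields that occur below are finite, so that residue field
extensions are separable.) -/
def H1.IsTame (π : H1 K C G) : Prop :=
  ∀ P : Ideal (integralClosure R π.field), P.IsMaximal →
    ((P.ramificationIdx R : ℕ) : integralClosure R π.field ⧸ P) ≠ 0

/-- The class `π` is unramified: all ramification indices of `K^π/K` are equal to `1`. -/
def H1.IsUnramified (π : H1 K C G) : Prop :=
  ∀ P : Ideal (integralClosure R π.field), P.IsMaximal → P.ramificationIdx R = 1

variable {R} in
theorem H1.IsUnramified.isTame {π : H1 K C G} (h : π.IsUnramified R) : π.IsTame R := by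
  intro P hP
  have := Ideal.Quotient.nontrivial_iff.2 hP.ne_top
  rw [h P hP, Nat.cast_one]
  exact one_ne_zero

variable [IsGalois K C] [IsDedekindDomain R] [IsFractionRing R K]

instance (π : H1 K C G) : Module.IsTorsionFree R (integralClosure R π.field) := by
  have : Module.IsTorsionFree R C := .trans_faithfulSMul R K C
  exact Function.Injective.moduleIsTorsionFree
    (fun x : integralClosure R π.field => ((x : π.field) : C))
    (Subtype.val_injective.comp Subtype.val_injective) fun _ _ => rfl

instance (π : H1 K C G) : Module.Finite R (integralClosure R π.field) :=
  IsIntegralClosure.finite R K π.field _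

instance (π : H1 K C G) : IsFractionRing (integralClosure R π.field) π.field :=
  IsIntegralClosure.isFractionRing_of_finite_extension R K π.field _

instance (π : H1 K C G) : IsGaloisGroup Gal(π.field/K) R (integralClosure R π.field) :=
  IsGaloisGroup.of_isFractionRing _ _ _ K π.field

theorem H1.card_inertia (hR : ∀ p : Ideal R, p.IsMaximal → Finite (R ⧸ p)) (π : H1 K C G)
    (P : Ideal (integralClosure R π.field)) [P.IsMaximal] :
    Nat.card (P.inertia Gal(π.field/K)) = P.ramificationIdx R := by
  have : (P.under R).IsMaximal := Ideal.IsMaximal.under R P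
  have := hR (P.under R) this
  rw [Ideal.card_inertia_eq_ramificationIdxIn (P.under R) P]
  exact Ideal.ramificationIdxIn_eq_ramificationIdx (P.under R) P Gal(π.field/K)

theorem H1.IsTame.exists_trace_eq_one (hR : ∀ p : Ideal R, p.IsMaximal → Finite (R ⧸ p))
    {π : H1 K C G} (h : π.IsTame R) :
    ∃ y : integralClosure R π.field, ∑ σ : Gal(π.field/K), σ • y = 1 := by
  let T : integralClosure R π.field →ₗ[R] integralClosure R π.field :=
    ∑ σ : Gal(π.field/K), DistribSMul.toLinearMap R _ σ
  have hT (y) : T y = ∑ σ : Gal(π.field/K), σ • y := by simp [T]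
  let I : Ideal R := (LinearMap.range T).comap (Algebra.linearMap R _)
  suffices hI : I = ⊤ by
    have : (1 : R) ∈ I := hI ▸ Submodule.mem_top
    obtain ⟨y, hy⟩ := this
    exact ⟨y, by rw [← hT, hy, Algebra.linearMap_apply, map_one]⟩
  by_contra hne
  obtain ⟨p, hp, hle⟩ := Ideal.exists_le_maximal I hne
  obtain ⟨P, hP, hPp⟩ := Ideal.exists_maximal_ideal_liesOver_of_isIntegral
    (S := integralClosure R π.field) p
  have hcard : ((Nat.card (P.inertia Gal(π.field/K)) : ℕ) : integralClosure R π.field ⧸ P) ≠ 0 := by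
    rw [π.card_inertia R hR P]
    exact h P hP
  obtain ⟨y, hy⟩ := exists_sum_smul_notMem p P hcard
  obtain ⟨r, hr⟩ := Algebra.IsInvariant.isInvariant (A := R) (G := Gal(π.field/K))
    (∑ σ : Gal(π.field/K), σ • y) fun τ => by
      rw [Finset.smul_sum]
      exact Fintype.sum_equiv (Equiv.mulLeft τ) _ _ fun σ => by simp [mul_smul]
  apply hy
  have : r ∈ p := hle ⟨y, by rw [hT, ← hr, Algebra.linearMap_apply]⟩
  rw [Ideal.LiesOver.over (p := p) (P := P), Ideal.under_def, Ideal.mem_comap] at this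
  rwa [← hr]

end Ramification

section Projective

/-- An `R[G]`-module that is projective over `R` and on which a sum of conjugates of an `R`-linear
endomorphism is the identity is projective. -/
theorem projective_of_sum_conjugate {R G M : Type u} [CommRing R] [CommGroup G] [Fintype G]
    [AddCommGroup M] [Module R M] [Module (MonoidAlgebra R G) M]
    [IsScalarTower R (MonoidAlgebra R G) M] [Module.Projective R M] (c : M →ₗ[R] M)
    (hc : ∀ m, c.sumOfConjugatesEquivariant G m = m) :
    Module.Projective (MonoidAlgebra R G) M := by
  let p := Finsupp.linearCombination (MonoidAlgebra R G) (id : M → M)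
  have hp : Function.Surjective p := Finsupp.linearCombination_id_surjective _ _
  obtain ⟨s, hs⟩ := Module.projective_lifting_property (p.restrictScalars R) LinearMap.id hp
  rw [Module.projective_def']
  refine ⟨(s ∘ₗ c).sumOfConjugatesEquivariant G, LinearMap.ext fun m => ?_⟩
  change p _ = m
  rw [LinearMap.sumOfConjugatesEquivariant_apply, map_sum]
  refine Eq.trans ?_ (hc m)
  rw [LinearMap.sumOfConjugatesEquivariant_apply]
  refine Finset.sum_congr rfl fun g _ => ?_
  rw [LinearMap.conjugate_apply, map_smul, LinearMap.conjugate_apply]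
  congr 1
  exact LinearMap.congr_fun hs _

variable {R K C G : Type u} [CommRing R] [Field K] [Field C] [Algebra R K] [Algebra K C]
  [Algebra R C] [IsScalarTower R K C] [CommGroup G]

theorem H1.toFun_mem_field (π : H1 K C G) (a : π.Integers R) (γ : G) :
    π.toFun R a γ ∈ π.field := by
  rintro ⟨ω, hω⟩
  have := (π.integersEquiv R a).1.2 ω γ
  rw [MonoidHom.mem_ker.1 hω, mul_one] at this
  exact this

theorem H1.isIntegral_toFun (π : H1 K C G) (a : π.Integers R) (γ : G) :
    IsIntegral R (π.toFun R a γ) :=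
  ((π.integersEquiv R a).2.map (π.algebra.val.restrictScalars R)).map
    (Pi.evalAlgHom R (fun _ : G => C) γ)

variable [Fintype G] [IsGalois K C] [IsDedekindDomain R] [IsFractionRing R K]

instance (π : H1 K C G) : Module.Finite R (π.Integers R) := by
  let f : π.Integers R →ₗ[R] (G → integralClosure R π.field) :=
    { toFun a γ := ⟨⟨π.toFun R a γ, π.toFun_mem_field a γ⟩,
        (isIntegral_algHom_iff (π.field.val.restrictScalars R) Subtype.val_injective).1
          (π.isIntegral_toFun a γ)⟩
      map_add' a b := rfl
      map_smul' r a := rfl }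
  refine Module.Finite.of_injective f fun a b h => ?_
  refine π.toFun_injective R (funext fun γ => ?_)
  exact congrArg (fun x : integralClosure R π.field => ((x : π.field) : C)) (congrFun h γ)

instance (π : H1 K C G) : Module.IsTorsionFree R (π.Integers R) := by
  have : Module.IsTorsionFree R C := .trans_faithfulSMul R K C
  exact Function.Injective.moduleIsTorsionFree (π.toFun R) (π.toFun_injective R)
    fun r a => π.toFun_smul R r a

instance (π : H1 K C G) : Module.Projective R (π.Integers R) :=
  have : Module.FinitePresentation R (π.Integers R) :=
    Module.finitePresentation_of_finite R _
  Module.Flat.projective_of_finitePresentation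

instance (π : H1 K C G) : Module.Finite (MonoidAlgebra R G) (π.Integers R) :=
  Module.Finite.of_restrictScalars_finite R _ _

/-- The ring of integers of a tame Galois algebra is a projective module over the group ring. -/
theorem H1.IsTame.projective (hR : ∀ p : Ideal R, p.IsMaximal → Finite (R ⧸ p))
    {π : H1 K C G} (h : π.IsTame R) : Module.Projective (MonoidAlgebra R G) (π.Integers R) := by
  obtain ⟨y, hy⟩ := h.exists_trace_eq_one R hR
  let z : π.Integers R := π.mkInt R (π.spread y) (π.spread_mem y) (π.isIntegral_spread R y y.2)
  have hz : π.toFun R z = π.spread y := rfl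
  let e := π.integersEquiv R
  let c : π.Integers R →ₗ[R] π.Integers R :=
    e.symm.toLinearMap ∘ₗ LinearMap.mulLeft R (e z) ∘ₗ e.toLinearMap
  have hc (a : π.Integers R) : π.toFun R (c a) = π.spread y * π.toFun R a := rfl
  refine projective_of_sum_conjugate c fun m => π.toFun_injective R ?_
  rw [LinearMap.sumOfConjugatesEquivariant_apply]
  let t : π.Integers R →+ (G → C) := AddMonoidHom.mk' (π.toFun R) (π.toFun_add R)
  change t _ = _
  rw [map_sum]
  funext γ
  rw [Finset.sum_apply]
  have hterm (g : G) : t (c.conjugate g m) γ = π.spread y (γ * g⁻¹) * π.toFun R m γ := by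
    change π.toFun R _ γ = _
    rw [LinearMap.conjugate_apply, H1.toFun_single_smul, hc]
    change π.spread y (γ * g⁻¹) * π.toFun R _ (γ * g⁻¹) = _
    rw [H1.toFun_single_smul]
    change _ * π.toFun R m (γ * g⁻¹ * g) = _
    rw [inv_mul_cancel_right]
  simp only [hterm]
  rw [← Finset.sum_mul]
  have hsum : ∑ g, π.spread y (γ * g⁻¹) = 1 := by
    refine (Fintype.sum_equiv ((Equiv.inv G).trans (Equiv.mulLeft γ)) _ (π.spread (y : π.field))
      fun g => rfl).trans ?_
    rw [H1.sum_spread]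
    have := congrArg (fun x : integralClosure R π.field => ((x : π.field) : C)) hy
    simpa using this
  rw [hsum, one_mul]

end Projective

end GaloisAlg

namespace RelativeK

/-- A criterion for an `A`-linear map `M → B` to exhibit `B` as the base change of `M`. -/
theorem isBaseChange_of_unit {A B M : Type u} [CommRing A] [CommRing B] [Algebra A B]
    [AddCommGroup M] [Module A M] (f : M →ₗ[A] B) (a : M) (ha : IsUnit (f a))
    (h : ∀ m, ∃ d α : A, IsUnit (algebraMap A B d) ∧ d • m = α • a) : IsBaseChange B f := by
  let ψ : B ⊗[A] M →ₗ[A] B :=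
    TensorProduct.lift (((Algebra.linearMap B <| Module.End B (M →ₗ[A] B)).flip f).restrictScalars A)
  have hψ (b : B) (m : M) : ψ (b ⊗ₜ m) = b * f m := by simp [ψ]
  change Function.Bijective ψ
  obtain ⟨u, hu⟩ := ha
  have key (x : B ⊗[A] M) : ∃ b : B, x = b ⊗ₜ a := by
    induction x using TensorProduct.induction_on with
    | zero => exact ⟨0, by simp⟩
    | add x y hx hy =>
      obtain ⟨b, rfl⟩ := hx
      obtain ⟨c, rfl⟩ := hy
      exact ⟨b + c, by rw [TensorProduct.add_tmul]⟩
    | tmul b m =>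
      obtain ⟨d, α, ⟨w, hw⟩, hd⟩ := h m
      refine ⟨α • (b * (w⁻¹ : Bˣ)), ?_⟩
      rw [TensorProduct.smul_tmul, ← hd, ← TensorProduct.smul_tmul, Algebra.smul_def, ← hw]
      congr 1
      rw [mul_left_comm, Units.mul_inv, mul_one]
  constructor
  · rw [injective_iff_map_eq_zero]
    intro x hx
    obtain ⟨b, rfl⟩ := key x
    rw [hψ, ← hu] at hx
    rw [(Units.mul_left_eq_zero u).1 hx, TensorProduct.zero_tmul]
  · intro b
    exact ⟨(b * (u⁻¹ : Bˣ)) ⊗ₜ a, by rw [hψ, ← hu, mul_assoc, Units.inv_mul, mul_one]⟩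

end RelativeK

namespace GaloisAlg

open scoped AlgebraMonoidAlgebra
open MonoidAlgebra (single)

section Psi

variable (R : Type u) {K C G : Type u} [CommRing R] [Field K] [Field C] [Algebra R K] [Algebra K C]
  [Algebra R C] [IsScalarTower R K C] [CommGroup G] [Fintype G]

theorem H1.map_resolvend (π : H1 K C G) (a : π.Integers R) (ω : Gal(C/K)) :
    MonoidAlgebra.mapRingHom G (ω : C →+* C) (π.resolvend R a) =
      single (π.toHom ω) 1 * π.resolvend R a := by
  rw [H1.resolvend_apply, single_mul_resolvend]
  ext t
  rw [coeff_resolvend]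
  have h := (π.integersEquiv R a).1.2 ω t⁻¹
  simp only [MonoidAlgebra.coeff_mapRingHom, coeff_resolvend]
  exact h

variable [IsGalois K C] [IsDedekindDomain R] [IsFractionRing R K]

theorem H1.exists_isUnit_resolvend (π : H1 K C G) :
    ∃ a : π.Integers R, IsUnit (π.resolvend R a) := by
  obtain ⟨b, hb⟩ := exists_linearIndependent_algEquiv_apply K π.field
  have : Algebra.IsAlgebraic R π.field :=
    (IsFractionRing.comap_isAlgebraic_iff (A := R) (K := K)).2 inferInstance
  obtain ⟨r, hr, hrb⟩ := (Algebra.IsAlgebraic.isAlgebraic (R := R) b).exists_integral_multiple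
  refine ⟨π.mkInt R (π.spread (r • b)) (π.spread_mem _) (π.isIntegral_spread R _ hrb), ?_⟩
  change IsUnit (GaloisAlg.resolvend (π.spread (r • b)))
  refine π.isUnit_resolvend_spread _ ?_
  have hr' : algebraMap R K r ≠ 0 := fun h => hr ((IsFractionRing.injective R K) (by rw [h, map_zero]))
  have h2 := hb.units_smul fun _ => Units.mk0 _ hr'
  have heq : (fun σ : Gal(π.field/K) => σ (r • b)) =
      (fun _ : Gal(π.field/K) => Units.mk0 (algebraMap R K r) hr') • fun σ : Gal(π.field/K) => σ b := by
    funext σ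
    rw [← IsScalarTower.algebraMap_smul K r b, map_smul]
    rfl
  rw [heq]
  exact h2

theorem H1.isBaseChange_resolvend (π : H1 K C G) :
    IsBaseChange (MonoidAlgebra C G) (π.resolvend R) := by
  obtain ⟨a, ha⟩ := π.exists_isUnit_resolvend R
  refine RelativeK.isBaseChange_of_unit _ a ha fun m => ?_
  obtain ⟨u, hu⟩ := ha
  obtain ⟨β, hβ⟩ : ∃ β, β * π.resolvend R a = π.resolvend R m :=
    ⟨π.resolvend R m * (u⁻¹ : (MonoidAlgebra C G)ˣ), by rw [← hu, mul_assoc, Units.inv_mul, mul_one]⟩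
  have hinv (ω : Gal(C/K)) : MonoidAlgebra.mapRingHom G (ω : C →+* C) β = β := by
    have h := congrArg (MonoidAlgebra.mapRingHom G (ω : C →+* C)) hβ
    rw [map_mul, H1.map_resolvend R π, H1.map_resolvend R π, ← hβ, mul_left_comm] at h
    have hs : IsUnit (single (π.toHom ω) (1 : C) : MonoidAlgebra C G) :=
      IsUnit.of_mul_eq_one (single (π.toHom ω)⁻¹ (1 : C) : MonoidAlgebra C G) (by
        rw [MonoidAlgebra.single_mul_single, mul_inv_cancel, one_mul, MonoidAlgebra.one_def])
    have h2 := hs.mul_left_cancel h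
    rw [← hu] at h2
    exact (Units.mul_left_inj u).1 h2
  have hfix (t : G) : ∃ k : K, algebraMap K C k = β.coeff t := by
    rw [← Set.mem_range, InfiniteGalois.mem_range_algebraMap_iff_fixed]
    intro ω
    have := congrArg (fun x => MonoidAlgebra.coeff x t) (hinv ω)
    simpa [MonoidAlgebra.coeff_mapRingHom] using this
  choose k hk using hfix
  obtain ⟨r, hr⟩ := IsLocalization.exist_integer_multiples_of_finite (nonZeroDivisors R) k
  choose s hs using hr
  let α : MonoidAlgebra R G := ∑ t, single t (s t)
  have hα : algebraMap (MonoidAlgebra R G) (MonoidAlgebra C G) α =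
      (r : R) • β := by
    classical
    ext t
    have h1 := hs t
    have h2 : algebraMap R C (s t) = (r : R) • β.coeff t := by
      rw [IsScalarTower.algebraMap_apply R K C, h1, Algebra.smul_def, map_mul,
        hk, ← IsScalarTower.algebraMap_apply, Algebra.smul_def]
    simpa [α, MonoidAlgebra.algebraMap_def, MonoidAlgebra.coeff_mapRingHom, Finsupp.single_apply] using h2
  refine ⟨algebraMap R _ r, α, ?_, ?_⟩
  · rw [← IsScalarTower.algebraMap_apply R, IsScalarTower.algebraMap_apply R C]
    refine IsUnit.map _ (IsUnit.mk0 _ ?_)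
    rw [IsScalarTower.algebraMap_apply R K C]
    exact (map_ne_zero _).2 (IsFractionRing.to_map_ne_zero_of_mem_nonZeroDivisors r.2)
  · apply π.toFun_injective R
    apply resolvend_injective
    rw [← H1.resolvend_apply, ← H1.resolvend_apply, map_smul, map_smul, Algebra.smul_def α, hα,
      ← hβ, algebraMap_smul, smul_mul_assoc]

/-- The class `Ψ([π]) = [O_π, R[G]; r_G]` in `K₀(R[G], C)` of a tame element `π` of `H¹(K, G)`, where
`R` is a Dedekind domain with finite residue fields and field of fractions `K`, and
`r_G : C ⊗_R O_π ≃ C[G]` is the isomorphism afforded by the resolvend map. -/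
def psi (hR : ∀ p : Ideal R, p.IsMaximal → Finite (R ⧸ p)) (π : H1 K C G) (h : π.IsTame R) :
    RelativeK.RelK0 (MonoidAlgebra R G) (MonoidAlgebra C G) :=
  have := h.projective hR
  RelativeK.rankOneClass _ _ (π.Integers R) (π.resolvend R) (π.isBaseChange_resolvend R)

end Psi

end GaloisAlg

namespace RelativeK

open TensorProduct.AlgebraTensorModule in
theorem rankOneClass_mem_range {A D B : Type u} [CommRing A] [CommRing D] [CommRing B]
    [Algebra A D] [Algebra D B] [Algebra A B] [IsScalarTower A D B]
    (M : Type u) [AddCommGroup M] [Module A M] [Module.Finite A M]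
    [Module.Projective A M] (f : M →ₗ[A] B) (hf : IsBaseChange B f)
    (hD : Function.Injective (algebraMap D B)) (h : ∀ m, f m ∈ Set.range (algebraMap D B))
    (h1 : (1 : B) ∈ Submodule.span D (Set.range f)) :
    rankOneClass A B M f hf ∈ (RelK0.extendTarget A D B).range := by
  have key (b : B) (hb : b ∈ Submodule.span D (Set.range f)) :
      hf.equiv.symm b ∈ LinearMap.range (extendMap A D B M) := by
    induction hb using Submodule.span_induction with
    | mem x hx =>
      obtain ⟨m, rfl⟩ := hx
      rw [hf.equiv_symm_apply]
      exact ⟨1 ⊗ₜ m, by simp [extendMap]⟩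
    | zero => simp
    | add x y _ _ hx hy => rw [map_add]; exact add_mem hx hy
    | smul d x _ hx =>
      rw [← IsScalarTower.algebraMap_smul B, map_smul, IsScalarTower.algebraMap_smul]
      exact Submodule.smul_mem _ _ hx
  refine cls_mem_range_extendTarget _ hD (fun m => ?_) fun n => ?_
  · obtain ⟨d, hd⟩ := h m
    refine ⟨d ⊗ₜ 1, ?_⟩
    rw [LinearEquiv.trans_apply, IsBaseChange.equiv_tmul, one_smul, ← hd]
    simp [extendMap]
  · rw [LinearEquiv.symm_trans_apply, LinearEquiv.symm_symm]
    refine key _ ?_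
    rw [rid_tmul, ← IsScalarTower.algebraMap_smul D]
    exact Submodule.smul_mem _ _ h1

end RelativeK

namespace GaloisAlg

open scoped AlgebraMonoidAlgebra
open MonoidAlgebra (single)

instance isScalarTower_monoidAlgebra {R S T G : Type u} [CommRing R] [CommRing S] [CommRing T]
    [Algebra R S] [Algebra S T] [Algebra R T] [IsScalarTower R S T] [CommGroup G] :
    IsScalarTower (MonoidAlgebra R G) (MonoidAlgebra S G) (MonoidAlgebra T G) := by
  refine IsScalarTower.of_algebraMap_eq fun x => ?_
  ext t
  simp [MonoidAlgebra.algebraMap_def, ← IsScalarTower.algebraMap_apply R S T]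

theorem algebraMap_monoidAlgebra_injective {R S G : Type u} [CommRing R] [CommRing S]
    [Algebra R S] [CommGroup G] (h : Function.Injective (algebraMap R S)) :
    Function.Injective (algebraMap (MonoidAlgebra R G) (MonoidAlgebra S G)) := by
  intro x y hxy
  ext t
  have := congrArg (fun x => MonoidAlgebra.coeff x t) hxy
  exact h (by simpa [MonoidAlgebra.algebraMap_def] using this)

theorem mem_range_algebraMap_monoidAlgebra {R S G : Type u} [CommRing R] [CommRing S]
    [Algebra R S] [CommGroup G] [Fintype G] (x : MonoidAlgebra S G)
    (h : ∀ t, x.coeff t ∈ Set.range (algebraMap R S)) :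
    x ∈ Set.range (algebraMap (MonoidAlgebra R G) (MonoidAlgebra S G)) := by
  choose s hs using h
  refine ⟨∑ t, single t (s t), ?_⟩
  classical
  ext t
  simp [MonoidAlgebra.algebraMap_def, hs]

section Unramified

variable (R : Type u) {K C G : Type u} [CommRing R] [Field K] [Field C] [Algebra R K] [Algebra K C]
  [Algebra R C] [IsScalarTower R K C] [CommGroup G] [Fintype G]
  [IsGalois K C] [IsDedekindDomain R] [IsFractionRing R K]

/-- The class `Ψ([π])` of an unramified `π` comes from `K₀(R[G], O_C)`, where `O_C` is the integral
closure of `R` in `C`. -/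
theorem psi_mem_range (hR : ∀ p : Ideal R, p.IsMaximal → Finite (R ⧸ p)) (π : H1 K C G)
    (h : π.IsUnramified R) :
    psi R hR π h.isTame ∈ (RelativeK.RelK0.extendTarget (MonoidAlgebra R G)
      (MonoidAlgebra (integralClosure R C) G) (MonoidAlgebra C G)).range := by
  have := h.isTame.projective hR
  refine RelativeK.rankOneClass_mem_range (π.Integers R) (π.resolvend R) _
    (algebraMap_monoidAlgebra_injective Subtype.val_injective) (fun m => ?_) ?_
  · refine mem_range_algebraMap_monoidAlgebra _ fun t => ?_
    rw [H1.resolvend_apply, coeff_resolvend]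
    exact ⟨⟨_, π.isIntegral_toFun m t⁻¹⟩, rfl⟩
  · let S := integralClosure R π.field
    let T : (Gal(π.field/K) → S) →+ MonoidAlgebra C G :=
      { toFun w := ∑ σ, single (π.bar σ)⁻¹ (((w σ : S) : π.field) : C)
        map_zero' := by simp
        map_add' w w' := by simp [Finset.sum_add_distrib] }
    have hT (w) : T w = ∑ σ, single (π.bar σ)⁻¹ (((w σ : S) : π.field) : C) := rfl
    classical
    have hspan := mem_span_of_inertia_eq_bot (S := S) (Γ := Gal(π.field/K)) ?_
    · have key (w : Gal(π.field/K) → S)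
          (hw : w ∈ Submodule.span S (Set.range fun (y : S) (σ : Gal(π.field/K)) => σ • y)) :
          T w ∈ Submodule.span (MonoidAlgebra (integralClosure R C) G)
            (Set.range (π.resolvend R)) := by
        induction hw using Submodule.span_induction with
        | mem x hx =>
          obtain ⟨y, rfl⟩ := hx
          refine Submodule.subset_span ⟨π.mkInt R (π.spread y) (π.spread_mem y)
            (π.isIntegral_spread R y y.2), ?_⟩
          change GaloisAlg.resolvend (π.spread y) = _
          rw [hT]
          ext t
          simp only [coeff_resolvend, H1.spread, MonoidAlgebra.coeff_sum, Finsupp.finsetSum_apply,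
            MonoidAlgebra.coeff_single]
          exact Finset.sum_congr rfl fun σ _ => by
            simp [Finsupp.single_apply, inv_eq_iff_eq_inv]; rfl
        | zero => rw [map_zero]; exact zero_mem _
        | add x y _ _ hx hy => rw [map_add]; exact add_mem hx hy
        | smul d x _ hx =>
          have hd : ((d : π.field) : C) ∈ integralClosure R C :=
            d.2.map (π.field.val.restrictScalars R)
          have : T (fun σ => d * x σ) = (single 1 ⟨_, hd⟩ : MonoidAlgebra (integralClosure R C) G) • T x := by
            rw [hT, hT, Algebra.smul_def, MonoidAlgebra.algebraMap_def,
              MonoidAlgebra.mapRingHom_single, Finset.mul_sum]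
            refine Finset.sum_congr rfl fun σ _ => ?_
            rw [MonoidAlgebra.single_mul_single, one_mul]
            rfl
          change T (fun σ => d * x σ) ∈ _
          rw [this]
          exact Submodule.smul_mem _ _ hx
      have h1 := key _ hspan
      convert h1 using 1
      rw [hT, Fintype.sum_eq_single 1 fun σ hσ => by simp [hσ]]
      simp [MonoidAlgebra.one_def]
    · intro P hP
      have := π.card_inertia R hR P
      rw [h P hP] at this
      exact Subgroup.card_eq_one.1 this

end Unramified

end GaloisAlg

namespace RelativeK

open IsDedekindDomain NumberField

section Completion

variable (F : Type u) [Field F] [NumberField F]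

theorem finite_quotient_ringOfIntegers (p : Ideal (𝓞 F)) (hp : p.IsMaximal) : Finite (𝓞 F ⧸ p) :=
  p.finiteQuotientOfFreeOfNeBot
    (Ring.ne_bot_of_isMaximal_of_not_isField hp (RingOfIntegers.not_isField F))

variable (v : HeightOneSpectrum (𝓞 F))

instance : CharZero (v.adicCompletion F) :=
  charZero_of_injective_algebraMap (algebraMap F (v.adicCompletion F)).injective

instance isScalarTower_adicCompletionIntegers :
    @IsScalarTower (𝓞 F) (v.adicCompletionIntegers F) (AlgebraicClosure (v.adicCompletion F))
      Algebra.toSMul Algebra.toSMul Algebra.toSMul :=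
  IsScalarTower.of_algebraMap_eq fun _ => rfl

theorem exists_sub_lt_one (x : v.adicCompletion F) (hx : Valued.v x ≤ 1) :
    ∃ a : 𝓞 F, Valued.v (x - algebraMap F (v.adicCompletion F) a) < 1 := by
  have hn : {y : v.adicCompletion F | Valued.v.restrict (y - x) < 1} ∈ nhds x :=
    Valued.mem_nhds.2 ⟨1, fun _ h => h⟩
  obtain ⟨k, hk⟩ := (HeightOneSpectrum.denseRange_algebraMap F v).mem_nhds hn
  have hk1 : Valued.v (algebraMap F (v.adicCompletion F) k - x) < 1 :=
    (Valuation.restrict_lt_one_iff _).1 hk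
  have hk2 : v.valuation F k ≤ 1 := by
    rw [← HeightOneSpectrum.valuedAdicCompletion_eq_valuation']
    have := Valuation.map_add_le Valued.v hk1.le hx
    rwa [sub_add_cancel] at this
  obtain ⟨a, ha⟩ := v.exists_valuation_sub_lt_of_integer hk2 1
  refine ⟨a, ?_⟩
  rw [← HeightOneSpectrum.valuedAdicCompletion_eq_valuation'] at ha
  have h3 : Valued.v (algebraMap F (v.adicCompletion F) (algebraMap (𝓞 F) F a - k)) < 1 := ha
  rw [map_sub] at h3
  have := Valuation.map_add_lt Valued.v h3 hk1
  rw [sub_add_sub_cancel] at this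
  rwa [Valuation.map_sub_swap]

theorem finite_quotient_adicCompletionIntegers (p : Ideal (v.adicCompletionIntegers F))
    (hp : p.IsMaximal) : Finite (v.adicCompletionIntegers F ⧸ p) := by
  have hv := finite_quotient_ringOfIntegers F v.asIdeal v.isMaximal
  have hpm : p = IsLocalRing.maximalIdeal _ := IsLocalRing.eq_maximalIdeal hp
  have hmem (y : v.adicCompletionIntegers F) : y ∈ p ↔ Valued.v (y : v.adicCompletion F) < 1 := by
    rw [hpm, IsLocalRing.mem_maximalIdeal, mem_nonunits_iff,
      HeightOneSpectrum.adicCompletionIntegers.isUnit_iff_valued_eq_one]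
    exact ⟨fun h => lt_of_le_of_ne y.2 h, fun h => h.ne⟩
  let φ := (Ideal.Quotient.mk p).comp (algebraMap (𝓞 F) (v.adicCompletionIntegers F))
  have hφ (a : 𝓞 F) (ha : a ∈ v.asIdeal) : φ a = 0 := by
    refine Ideal.Quotient.eq_zero_iff_mem.2 ((hmem _).2 ?_)
    rw [← v.valuation_lt_one_iff_mem (K := F),
      ← HeightOneSpectrum.valuedAdicCompletion_eq_valuation'] at ha
    exact ha
  refine Finite.of_surjective (Ideal.Quotient.lift v.asIdeal φ hφ) fun y => ?_
  obtain ⟨x, rfl⟩ := Ideal.Quotient.mk_surjective y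
  obtain ⟨a, ha⟩ := exists_sub_lt_one F v x x.2
  refine ⟨Ideal.Quotient.mk _ a, ?_⟩
  rw [Ideal.Quotient.lift_mk]
  refine (Ideal.Quotient.eq.2 ((hmem _).2 ?_)).symm
  exact ha

end Completion

end RelativeK

namespace RelativeK

section Localisation

open TensorProduct.AlgebraTensorModule

variable {A B A' B' D : Type u} [CommRing A] [CommRing B] [CommRing A'] [CommRing B'] [CommRing D]
  [Algebra A B] [Algebra A A'] [Algebra A B'] [Algebra B B'] [Algebra A' B'] [IsScalarTower A B B']
  [IsScalarTower A A' B'] [Algebra A' D] [Algebra D B'] [IsScalarTower A' D B']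

/-- The canonical map `B ⊗_A N → B' ⊗_{A'} (A' ⊗_A N)`. -/
def locTensor (A B A' B' N : Type u) [CommRing A] [CommRing B] [CommRing A'] [CommRing B']
    [Algebra A B] [Algebra A A'] [Algebra A B'] [Algebra B B'] [Algebra A' B'] [IsScalarTower A B B']
    [IsScalarTower A A' B'] [AddCommGroup N] [Module A N] :
    B ⊗[A] N →+ B' ⊗[A'] (A' ⊗[A] N) where
  toFun y := (cancelBaseChange A A' B' B' N).symm (cancelBaseChange A B B' B' N (1 ⊗ₜ y))
  map_zero' := by simp
  map_add' x y := by simp [TensorProduct.tmul_add]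

theorem locTensor_tmul_mem {N : Type u} [AddCommGroup N] [Module A N] (b : B) (n : N)
    (h : algebraMap B B' b ∈ Set.range (algebraMap D B')) :
    locTensor A B A' B' N (b ⊗ₜ n) ∈ LinearMap.range (extendMap A' D B' (A' ⊗[A] N)) := by
  obtain ⟨d, hd⟩ := h
  refine ⟨d ⊗ₜ (1 ⊗ₜ n), ?_⟩
  change _ = (cancelBaseChange A A' B' B' N).symm (cancelBaseChange A B B' B' N (1 ⊗ₜ (b ⊗ₜ n)))
  rw [LinearEquiv.eq_symm_apply]
  simp [extendMap, hd, Algebra.smul_def]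

theorem localIso_extendIso_one_tmul {M N : Type u} [AddCommGroup M] [Module A M]
    [AddCommGroup N] [Module A N] (ξ : B ⊗[A] M ≃ₗ[B] B ⊗[A] N) (m : M) :
    localIso A' (extendIso B' ξ) (1 ⊗ₜ (1 ⊗ₜ m)) = locTensor A B A' B' N (ξ (1 ⊗ₜ m)) := by
  simp only [localIso, LinearEquiv.trans_apply]
  have : cancelBaseChange A A' B' B' M (1 ⊗ₜ[A'] (1 ⊗ₜ[A] m)) = 1 ⊗ₜ m := by simp
  rw [this, extendIso_tmul_one]
  rfl

theorem localIso_extendIso_mem {M N : Type u} [AddCommGroup M] [Module A M]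
    [AddCommGroup N] [Module A N] (ξ : B ⊗[A] M ≃ₗ[B] B ⊗[A] N) (s : Set M)
    (hs : Submodule.span A s = ⊤)
    (h : ∀ m ∈ s, locTensor A B A' B' N (ξ (1 ⊗ₜ m)) ∈
      LinearMap.range (extendMap A' D B' (A' ⊗[A] N))) (y : A' ⊗[A] M) :
    localIso A' (extendIso B' ξ) (1 ⊗ₜ y) ∈
      LinearMap.range (extendMap A' D B' (A' ⊗[A] N)) := by
  have h1 (a : A') (y : A' ⊗[A] M) (hy : localIso A' (extendIso B' ξ) (1 ⊗ₜ y) ∈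
      LinearMap.range (extendMap A' D B' (A' ⊗[A] N))) :
      localIso A' (extendIso B' ξ) (1 ⊗ₜ (a • y)) ∈
      LinearMap.range (extendMap A' D B' (A' ⊗[A] N)) := by
    rw [TensorProduct.tmul_smul, ← IsScalarTower.algebraMap_smul B' a, map_smul,
      IsScalarTower.algebraMap_smul B' a, ← IsScalarTower.algebraMap_smul D a]
    exact Submodule.smul_mem _ _ hy
  have h2 (m : M) : localIso A' (extendIso B' ξ) (1 ⊗ₜ (1 ⊗ₜ m)) ∈
      LinearMap.range (extendMap A' D B' (A' ⊗[A] N)) := by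
    have hm : m ∈ Submodule.span A s := hs ▸ Submodule.mem_top
    induction hm using Submodule.span_induction with
    | mem x hx => rw [localIso_extendIso_one_tmul]; exact h x hx
    | zero => simp
    | add x y _ _ hx hy => rw [TensorProduct.tmul_add, TensorProduct.tmul_add, map_add]; exact add_mem hx hy
    | smul a x _ hx =>
      rw [TensorProduct.tmul_smul, ← IsScalarTower.algebraMap_smul A' a]
      exact h1 _ _ hx
  induction y using TensorProduct.induction_on with
  | zero => simp
  | add x y hx hy => rw [TensorProduct.tmul_add, map_add]; exact add_mem hx hy
  | tmul a m =>
    have := h1 a _ (h2 m)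
    rwa [TensorProduct.smul_tmul', smul_eq_mul, mul_one] at this

/-- The localisation map `K₀(A, B) → K₀(A', B')`,
`[M, N; ξ] ↦ [A' ⊗_A M, A' ⊗_A N; B' ⊗_B ξ]`. -/
def RelK0.localise (A B A' B' : Type u) [CommRing A] [CommRing B] [CommRing A'] [CommRing B']
    [Algebra A B] [Algebra A A'] [Algebra A B'] [Algebra B B'] [Algebra A' B']
    [IsScalarTower A B B'] [IsScalarTower A A' B'] : RelK0 A B →+ RelK0 A' B' :=
  (RelK0.extendSource A A' B').comp (RelK0.extendTarget A B B')

theorem localise_cls_mem_range (X : TwistedForm A B) (hD : Function.Injective (algebraMap D B'))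
    (s : Set X.M) (hs : Submodule.span A s = ⊤) (s' : Set X.N) (hs' : Submodule.span A s' = ⊤)
    (h : ∀ m ∈ s, locTensor A B A' B' X.N (X.ξ (1 ⊗ₜ m)) ∈
      LinearMap.range (extendMap A' D B' (A' ⊗[A] X.N)))
    (h' : ∀ n ∈ s', locTensor A B A' B' X.M (X.ξ.symm (1 ⊗ₜ n)) ∈
      LinearMap.range (extendMap A' D B' (A' ⊗[A] X.M))) :
    RelK0.localise A B A' B' X.cls ∈ (RelK0.extendTarget A' D B').range := by
  have : RelK0.localise A B A' B' X.cls = ((X.extendTarget B').extendSource A').cls := by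
    simp [RelK0.localise, RelK0.extendSource, RelK0.extendTarget]
  rw [this]
  refine cls_mem_range_extendTarget _ hD (localIso_extendIso_mem X.ξ s hs h) ?_
  exact localIso_extendIso_mem X.ξ.symm s' hs' h'

end Localisation

end RelativeK

namespace GaloisAlg

open scoped AlgebraMonoidAlgebra
open RelativeK

theorem exists_finite_locTensor {O C G N : Type u} [CommRing O] [CommRing C] [Algebra O C]
    [CommGroup G] [Fintype G] [AddCommGroup N] [Module (MonoidAlgebra O G) N]
    (y : MonoidAlgebra C G ⊗[MonoidAlgebra O G] N) :
    ∃ T : Set C, T.Finite ∧ ∀ (R E : Type u) [CommRing R] [CommRing E] [Algebra O R] [Algebra O E]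
      [Algebra C E] [Algebra R E] [IsScalarTower O C E] [IsScalarTower O R E],
      (∀ c ∈ T, IsIntegral R (algebraMap C E c)) →
      locTensor (MonoidAlgebra O G) (MonoidAlgebra C G) (MonoidAlgebra R G) (MonoidAlgebra E G) N y ∈
        LinearMap.range (extendMap (MonoidAlgebra R G) (MonoidAlgebra (integralClosure R E) G)
          (MonoidAlgebra E G) _) := by
  induction y using TensorProduct.induction_on with
  | zero =>
    refine ⟨∅, Set.finite_empty, fun R E => ?_⟩
    intros
    rw [map_zero]
    exact zero_mem _
  | add x y hx hy =>
    obtain ⟨T, hT, h⟩ := hx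
    obtain ⟨T', hT', h'⟩ := hy
    refine ⟨T ∪ T', hT.union hT', fun R E => ?_⟩
    intro _ _ _ _ _ _ _ _ hc
    rw [map_add]
    exact add_mem (h R E fun c hcT => hc c (.inl hcT)) (h' R E fun c hcT => hc c (.inr hcT))
  | tmul b n =>
    refine ⟨Set.range b.coeff, Set.finite_range _, fun R E => ?_⟩
    intro _ _ _ _ _ _ _ _ hc
    refine locTensor_tmul_mem b n (mem_range_algebraMap_monoidAlgebra _ fun t => ?_)
    exact ⟨⟨algebraMap C E (b.coeff t), hc _ ⟨t, rfl⟩⟩, by simp [MonoidAlgebra.algebraMap_def]⟩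

theorem exists_finite_localise {O C G : Type u} [CommRing O] [CommRing C] [Algebra O C]
    [CommGroup G] [Fintype G] (x : RelK0 (MonoidAlgebra O G) (MonoidAlgebra C G)) :
    ∃ T : Set C, T.Finite ∧ ∀ (R E : Type u) [CommRing R] [CommRing E] [Algebra O R] [Algebra O E]
      [Algebra C E] [Algebra R E] [IsScalarTower O C E] [IsScalarTower O R E],
      (∀ c ∈ T, IsIntegral R (algebraMap C E c)) →
      RelK0.localise (MonoidAlgebra O G) (MonoidAlgebra C G) (MonoidAlgebra R G) (MonoidAlgebra E G) x
        ∈ (RelK0.extendTarget (MonoidAlgebra R G) (MonoidAlgebra (integralClosure R E) G)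
          (MonoidAlgebra E G)).range := by
  induction x using RelK0.induction with
  | hcls X =>
    obtain ⟨s, hs⟩ := Module.Finite.fg_top (R := MonoidAlgebra O G) (M := X.M)
    obtain ⟨s', hs'⟩ := Module.Finite.fg_top (R := MonoidAlgebra O G) (M := X.N)
    choose T hT h using fun m => exists_finite_locTensor (X.ξ (1 ⊗ₜ m))
    choose T' hT' h' using fun n => exists_finite_locTensor (X.ξ.symm (1 ⊗ₜ n))
    refine ⟨(⋃ m ∈ s, T m) ∪ ⋃ n ∈ s', T' n, (s.finite_toSet.biUnion fun m _ => hT m).union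
      (s'.finite_toSet.biUnion fun n _ => hT' n), fun R E => ?_⟩
    intro _ _ _ _ _ _ _ _ hc
    refine localise_cls_mem_range X (algebraMap_monoidAlgebra_injective Subtype.val_injective)
      s hs s' hs' (fun m hm => h m R E fun c hcT => hc c (.inl ?_))
      fun n hn => h' n R E fun c hcT => hc c (.inr ?_)
    · exact Set.mem_biUnion hm hcT
    · exact Set.mem_biUnion hn hcT
  | hzero =>
    refine ⟨∅, Set.finite_empty, fun R E => ?_⟩
    intros
    rw [map_zero]
    exact zero_mem _
  | hneg x hx =>
    obtain ⟨T, hT, h⟩ := hx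
    refine ⟨T, hT, fun R E => ?_⟩
    intro _ _ _ _ _ _ _ _ hc
    rw [map_neg]
    exact neg_mem (h R E hc)
  | hadd x y hx hy =>
    obtain ⟨T, hT, h⟩ := hx
    obtain ⟨T', hT', h'⟩ := hy
    refine ⟨T ∪ T', hT.union hT', fun R E => ?_⟩
    intro _ _ _ _ _ _ _ _ hc
    rw [map_add]
    exact add_mem (h R E fun c hcT => hc c (.inl hcT)) (h' R E fun c hcT => hc c (.inr hcT))

end GaloisAlg

namespace RelativeK

open scoped AlgebraMonoidAlgebra RestrictedProduct
open IsDedekindDomain NumberField GaloisAlg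

section Main

variable (F : Type u) [Field F] [NumberField F] (G : Type u) [CommGroup G] [Fintype G]
  (v : HeightOneSpectrum (𝓞 F))

/-- `K₀(O_F G, F^c)`. -/
abbrev K0 : Type (u + 1) := RelK0 (MonoidAlgebra (𝓞 F) G) (MonoidAlgebra (AlgebraicClosure F) G)

/-- `K₀(O_{F_v} G, F_v^c)`. -/
abbrev K0Local : Type (u + 1) :=
  RelK0 (MonoidAlgebra (v.adicCompletionIntegers F) G)
    (MonoidAlgebra (AlgebraicClosure (v.adicCompletion F)) G)

/-- The subgroup of `K₀(O_{F_v} G, F_v^c)` given by the image of `K₀(O_{F_v} G, O_{F_v^c})`, where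
`O_{F_v^c}` is the integral closure of `O_{F_v}` in `F_v^c`. -/
def K0LocalIntegral : AddSubgroup (K0Local F G v) :=
  (RelK0.extendTarget (MonoidAlgebra (v.adicCompletionIntegers F) G)
    (MonoidAlgebra (integralClosure (v.adicCompletionIntegers F)
      (AlgebraicClosure (v.adicCompletion F))) G)
    (MonoidAlgebra (AlgebraicClosure (v.adicCompletion F)) G)).range

/-- The idele group `J(K₀(O_F G, F^c))`: the restricted product over the finite places `v` of `F` of
the groups `K₀(O_{F_v} G, F_v^c)` with respect to the images of `K₀(O_{F_v} G, O_{F_v^c})`. -/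
abbrev K0Idele : Type (u + 1) :=
  Πʳ v : HeightOneSpectrum (𝓞 F), [K0Local F G v, K0LocalIntegral F G v]

/-- `H¹_t(F, G)`: the classes in `H¹(F, G)` that are at most tamely ramified at all finite places. -/
abbrev H1Tame : Type u := {π : H1 F (AlgebraicClosure F) G // π.IsTame (𝓞 F)}

/-- `H¹_t(F_v, G)`. -/
abbrev H1TameLocal : Type u :=
  {π : H1 (v.adicCompletion F) (AlgebraicClosure (v.adicCompletion F)) G //
    π.IsTame (v.adicCompletionIntegers F)}

/-- `H¹_nr(F_v, G)`, as a subset of `H¹_t(F_v, G)`. -/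
def H1UnramifiedLocal : Set (H1TameLocal F G v) :=
  {π | π.1.IsUnramified (v.adicCompletionIntegers F)}

/-- `J(H¹_t(F, G))`: the restricted product of the pointed sets `H¹_t(F_v, G)` with respect to the
subsets `H¹_nr(F_v, G)`. -/
abbrev H1Idele : Type u :=
  Πʳ v : HeightOneSpectrum (𝓞 F), [H1TameLocal F G v, H1UnramifiedLocal F G v]

/-- `Ψ : H¹_t(F, G) → K₀(O_F G, F^c)`, `[π] ↦ [O_π, O_F G; r_G]`. -/
def Psi (π : H1Tame F G) : K0 F G :=
  psi (𝓞 F) (finite_quotient_ringOfIntegers F) π.1 π.2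

/-- `Ψ_v : H¹_t(F_v, G) → K₀(O_{F_v} G, F_v^c)`, `[π] ↦ [O_π, O_{F_v} G; r_G]`. -/
def PsiLocal (π : H1TameLocal F G v) : K0Local F G v :=
  psi (v.adicCompletionIntegers F) (finite_quotient_adicCompletionIntegers F v) π.1 π.2

/-- `Ψ^id : J(H¹_t(F, G)) → J(K₀(O_F G, F^c))`, the product of the maps `Ψ_v`. -/
def PsiIdele (π : H1Idele F G) : K0Idele F G :=
  ⟨fun v => PsiLocal F G v (π v), π.2.mono fun v hv =>
    psi_mem_range (v.adicCompletionIntegers F) (finite_quotient_adicCompletionIntegers F v) _ hv⟩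

variable {F}

/-- `λ_v : K₀(O_F G, F^c) → K₀(O_{F_v} G, F_v^c)`, `[M, N; ξ] ↦ [M_v, N_v; ξ_v]`, defined by means of
an embedding `F^c → F_v^c` over `F`. -/
def lambdaLocal (i : AlgebraicClosure F →ₐ[F] AlgebraicClosure (v.adicCompletion F)) :
    K0 F G →+ K0Local F G v :=
  letI : Algebra (AlgebraicClosure F) (AlgebraicClosure (v.adicCompletion F)) :=
    i.toRingHom.toAlgebra
  haveI : @IsScalarTower (𝓞 F) (AlgebraicClosure F) (AlgebraicClosure (v.adicCompletion F))
      Algebra.toSMul Algebra.toSMul Algebra.toSMul :=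
    IsScalarTower.of_algebraMap_eq fun x => (i.commutes (algebraMap (𝓞 F) F x)).symm
  RelK0.localise (MonoidAlgebra (𝓞 F) G) (MonoidAlgebra (AlgebraicClosure F) G)
    (MonoidAlgebra (v.adicCompletionIntegers F) G)
    (MonoidAlgebra (AlgebraicClosure (v.adicCompletion F)) G)

variable (i : ∀ v : HeightOneSpectrum (𝓞 F),
  AlgebraicClosure F →ₐ[F] AlgebraicClosure (v.adicCompletion F))

/-- An algebraic number is integral at almost all places. -/
theorem eventually_isIntegral (c : AlgebraicClosure F) :
    ∀ᶠ v in Filter.cofinite, IsIntegral (v.adicCompletionIntegers F) (i v c) := by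
  have : Algebra.IsAlgebraic (𝓞 F) (AlgebraicClosure F) :=
    (IsFractionRing.comap_isAlgebraic_iff (A := 𝓞 F) (K := F)).2 inferInstance
  obtain ⟨r, hr, hrc⟩ := (Algebra.IsAlgebraic.isAlgebraic (R := 𝓞 F) c).exists_integral_multiple
  have hfin := Ideal.finite_factors (I := Ideal.span {r}) (by simpa using hr)
  refine hfin.subset fun v hv => ?_
  by_contra hrv
  apply hv
  replace hrv : r ∉ v.asIdeal := fun h => hrv (Ideal.dvd_span_singleton.2 h)
  have hu : IsUnit (algebraMap (𝓞 F) (v.adicCompletionIntegers F) r) := by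
    rw [HeightOneSpectrum.adicCompletionIntegers.isUnit_iff_valued_eq_one]
    exact (HeightOneSpectrum.valuedAdicCompletion_eq_valuation' v (r : F)).trans
      (HeightOneSpectrum.valuation_eq_one_iff_notMem v |>.2 hrv)
  obtain ⟨w, hw⟩ := hu
  have h1 : IsIntegral (v.adicCompletionIntegers F) (i v (r • c)) := by
    have h2 : IsIntegral (𝓞 F) (i v (r • c)) := hrc.map ((i v).restrictScalars (𝓞 F))
    exact h2.tower_top
  have h3 : i v (r • c) = (w : v.adicCompletionIntegers F) • i v c := by
    have h5 : r • c = algebraMap F (AlgebraicClosure F) r * c := Algebra.smul_def (r : F) c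
    rw [hw, Algebra.smul_def, h5, map_mul]
    congr 1
    exact (i v).commutes (r : F)
  have h4 := h1.smul (w⁻¹ : (v.adicCompletionIntegers F)ˣ).1
  rw [h3, smul_smul, Units.inv_mul, one_smul] at h4
  exact h4

theorem lambdaLocal_mem (x : K0 F G) :
    ∀ᶠ v in Filter.cofinite, lambdaLocal G v (i v) x ∈ K0LocalIntegral F G v := by
  obtain ⟨T, hT, h⟩ := exists_finite_localise x
  have := (Set.Finite.eventually_all hT).2 fun c _ => eventually_isIntegral i c
  filter_upwards [this] with v hv
  let : Algebra (AlgebraicClosure F) (AlgebraicClosure (v.adicCompletion F)) :=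
    (i v).toRingHom.toAlgebra
  have : @IsScalarTower (𝓞 F) (AlgebraicClosure F) (AlgebraicClosure (v.adicCompletion F))
      Algebra.toSMul Algebra.toSMul Algebra.toSMul :=
    IsScalarTower.of_algebraMap_eq fun x => ((i v).commutes (algebraMap (𝓞 F) F x)).symm
  exact h (v.adicCompletionIntegers F) (AlgebraicClosure (v.adicCompletion F)) hv

/-- The localisation map `λ : K₀(O_F G, F^c) → J(K₀(O_F G, F^c))` with components `λ_v`. -/
def lambda : K0 F G →+ K0Idele F G where
  toFun x := ⟨fun v => lambdaLocal G v (i v) x, lambdaLocal_mem G i x⟩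
  map_zero' := Subtype.ext (funext fun _ => map_zero _)
  map_add' x y := Subtype.ext (funext fun _ => map_add _ x y)

variable (F)

/-- `KR(O_F G)`: the set of classes in `K₀(O_F G, F^c)` that are realised by the rings of integers of
tame Galois `G`-algebras over `F`, i.e. the image of `Ψ`. -/
def KR : Set (K0 F G) := Set.range (Psi F G)

variable {F G}

/-- An element of `K₀(O_F G, F^c)` is cohomological if it lies in the image of `Ψ`. -/
def IsCohomological (x : K0 F G) : Prop := x ∈ Set.range (Psi F G)

/-- `x` is cohomological at `v` if `λ_v x` lies in the image of `Ψ_v`. -/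
def IsCohomologicalAt (x : K0 F G) (v : HeightOneSpectrum (𝓞 F))
    (i : AlgebraicClosure F →ₐ[F] AlgebraicClosure (v.adicCompletion F)) : Prop :=
  lambdaLocal G v i x ∈ Set.range (PsiLocal F G v)

/-- `x` is locally cohomological if it is cohomological at all finite places. -/
def IsLocallyCohomological (x : K0 F G) : Prop := ∀ v, IsCohomologicalAt x v (i v)

end Main

end RelativeK

end

noncomputable section

open IsDedekindDomain NumberField
open scoped nonZeroDivisors

/-! ### Counting ideals: divergence of the sum of 1/N(P) over the primes of a number field -/

namespace IdealCount

section Count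

variable (K : Type*) [Field K] [NumberField K]

/-! One direction is the commutative square λ_v ∘ Ψ = Ψ_v ∘ res (`lambdaLocal_Psi`): the resolvends
of O_π generate those of its localisation over O_{F_v}G (`span_map_resolvend`). The substance is the
converse: a class that is cohomological at every finite place is cohomological.

The proof replaces classes by lattices. Write A = O_F G and B = F^c G. Serre's splitting theorem for
the order A, together with stable range one for the Artinian ring B, shows that every x in K₀(A, B)
is [I, A; ξ] with I projective of rank one (`exists_rankOneClass_eq`); such a class is given by a
finitely generated A-submodule Λ of B that spans B. Locally the class determines the lattice:
O_{F_v}G is semilocal, so there is a determinant with values in units modulo units (`detHom`), and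
it tells invertible lattices apart (`range_eq_of_rankOneClass_eq`). Hence λ_v(x) = Ψ_v(π_v) means
that Λ generates exactly the lattice r_G(O_{π_v}), and every ω in the chosen decomposition group at
v acts on the coefficients of elements of Λ as multiplication by π_v(ω).

Let H be the set of ω in Ω_F that act on Λ as multiplication by some element of G. It is a subgroup,
it is open because Λ is finitely generated, and it contains one decomposition group for each finite
place. Such a subgroup is all of Ω_F (`eq_top_of_forall_resGal_mem`). Since Λ spans B, the element
of G is unique, and this gives a homomorphism ρ : Ω_F → G that restricts to every π_v
(`exists_H1_of_forall_local`). Tameness of ρ is local because it amounts to the existence of an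
integral element of trace one. Finally Λ and r_G(O_ρ) agree at every place, hence are equal by a
Nakayama argument, so x = Ψ(ρ).

That one decomposition group per place suffices is proved by counting ideals, without density
theorems for Frobenius elements. The fixed field L of H embeds in every F_v, so each v has a prime
w(v) of L of the same norm. If L ≠ F, every prime v that splits completely in a Galois field N above
L has a second such lift w'(v). The products w(I)w'(v) are distinct ideals of L of norm N(I)N(v); as
ideals of norm at most x number about a constant times x, the sum of 1/N(v) over these v converges.
Then the sum of 1/N(P) over all primes P of N converges as well, which is false.

The statement on idele groups is formal once the local-global principle is known. -/

theorem finite_absNorm_le (x : ℝ) :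
    {I : (Ideal (𝓞 K))⁰ | (Ideal.absNorm (I : Ideal (𝓞 K)) : ℝ) ≤ x}.Finite := by
  have h := Ideal.finite_setOfPred_absNorm_le (S := 𝓞 K) ⌊x⌋₊
  refine (h.preimage (f := fun I : (Ideal (𝓞 K))⁰ => (I : Ideal (𝓞 K)))
    Subtype.val_injective.injOn).subset fun I hI => ?_
  exact Nat.le_floor hI

/-- The number of nonzero ideals of norm at most `x`. -/
noncomputable def normCount (x : ℝ) : ℕ :=
  Nat.card {I : (Ideal (𝓞 K))⁰ // (Ideal.absNorm (I : Ideal (𝓞 K)) : ℝ) ≤ x}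

/-- The number of ideals of norm at most x, divided by x, tends to the positive residue κ of the
Dedekind zeta function; κ/2 and 2κ serve as constants. Only linear growth in both directions is used
later. -/
theorem exists_normCount_bounds : ∃ a b X : ℝ, 0 < a ∧ a ≤ b ∧ 0 < X ∧
    ∀ x, X ≤ x → a * x ≤ normCount K x ∧ normCount K x ≤ b * x := by
  have h := Ideal.tendsto_norm_le_div_atTop₀ K
  have hpos := dedekindZeta_residue_pos K
  rw [dedekindZeta_residue_def] at hpos
  set κ : ℝ := (2 ^ InfinitePlace.nrRealPlaces K * (2 * Real.pi) ^ InfinitePlace.nrComplexPlaces K *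
    Units.regulator K * classNumber K) / (Units.torsionOrder K * Real.sqrt |discr K|)
  have h1 := h.eventually (Ioo_mem_nhds (half_lt_self hpos) (by linarith : κ < 2 * κ))
  obtain ⟨X, hX⟩ := Filter.eventually_atTop.1 h1
  refine ⟨κ / 2, 2 * κ, max X 1, by linarith, by linarith, by positivity, fun x hx => ?_⟩
  have hx0 : 0 < x := lt_of_lt_of_le one_pos ((le_max_right _ _).trans hx)
  obtain ⟨h2, h3⟩ := hX x ((le_max_left _ _).trans hx)
  exact ⟨((lt_div_iff₀ hx0).1 h2).le, ((div_lt_iff₀ hx0).1 h3).le⟩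

variable {K}

theorem absNorm_pos (I : (Ideal (𝓞 K))⁰) : (0 : ℝ) < Ideal.absNorm (I : Ideal (𝓞 K)) := by
  have := Ideal.absNorm_ne_zero_iff (I : Ideal (𝓞 K))
  have h0 : Ideal.absNorm (I : Ideal (𝓞 K)) ≠ 0 := Ideal.absNorm_ne_zero_of_nonZeroDivisors I
  positivity

variable (K)

open Classical in
/-- The nonzero ideals of norm at most `x` that are prime to a finite set of primes. -/
noncomputable def coprimeIdeals (E : Finset (HeightOneSpectrum (𝓞 K))) (x : ℝ) :
    Finset (Ideal (𝓞 K))⁰ :=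
  {I ∈ (finite_absNorm_le K x).toFinset | ∀ W ∈ E, ¬ W.asIdeal ∣ (I : Ideal (𝓞 K))}

variable {K} in
theorem mem_coprimeIdeals {E : Finset (HeightOneSpectrum (𝓞 K))} {x : ℝ} {I : (Ideal (𝓞 K))⁰} :
    I ∈ coprimeIdeals K E x ↔ (Ideal.absNorm (I : Ideal (𝓞 K)) : ℝ) ≤ x ∧
      ∀ W ∈ E, ¬ W.asIdeal ∣ (I : Ideal (𝓞 K)) := by
  classical
  rw [coprimeIdeals, Finset.mem_filter, Set.Finite.mem_toFinset]
  rfl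

theorem card_coprimeIdeals_empty (x : ℝ) : (coprimeIdeals K ∅ x).card = normCount K x := by
  rw [normCount, ← Nat.card_eq_finsetCard]
  exact Nat.card_congr (Equiv.subtypeEquivRight fun I => mem_coprimeIdeals.trans (by simp))

/-- Arbitrarily far out there are blocks y < N(I) ≤ My of ideals: each has a number of members
proportional to y, and each member contributes at least 1/(My). This contradicts the Cauchy
criterion. -/
theorem not_summable_inv_absNorm :
    ¬ Summable fun I : (Ideal (𝓞 K))⁰ => (Ideal.absNorm (I : Ideal (𝓞 K)) : ℝ)⁻¹ := by
  classical
  intro hs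
  obtain ⟨a, b, X, ha, hab, hX, hb⟩ := exists_normCount_bounds K
  have hb0 : 0 < b := ha.trans_le hab
  obtain ⟨s, h⟩ := summable_iff_vanishing_norm.1 hs (a / 2) (by positivity)
  obtain ⟨y, hyX, hys⟩ : ∃ y, X ≤ y ∧ ∀ I ∈ s, (Ideal.absNorm (I : Ideal (𝓞 K)) : ℝ) ≤ y := by
    obtain ⟨y, hy⟩ := (s.image fun I : (Ideal (𝓞 K))⁰ => (Ideal.absNorm (I : Ideal (𝓞 K)) : ℝ)).bddAbove
    exact ⟨max X y, le_max_left _ _, fun I hI =>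
      (hy (Finset.mem_coe.2 (Finset.mem_image_of_mem _ hI))).trans (le_max_right _ _)⟩
  have hy0 : 0 < y := hX.trans_le hyX
  -- With this M the block has at least a(My) - by = by members, and so contributes at least b/M =
  -- a/2.
  set M := 2 * b / a with hM
  have hM1 : 1 ≤ M := by rw [hM, one_le_div ha]; linarith
  set t := coprimeIdeals K ∅ (M * y) \ coprimeIdeals K ∅ y with ht
  have hdisj : Disjoint t s := by
    rw [Finset.disjoint_left]
    intro I hI hIs
    exact (Finset.mem_sdiff.1 hI).2 (mem_coprimeIdeals.2 ⟨hys I hIs, by simp⟩)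
  have hcard : b * y ≤ t.card := by
    have h1 := Finset.le_card_sdiff (coprimeIdeals K ∅ y) (coprimeIdeals K ∅ (M * y))
    rw [card_coprimeIdeals_empty, card_coprimeIdeals_empty, ← ht] at h1
    have h2 : normCount K (M * y) ≤ t.card + normCount K y := by omega
    have h3 : (normCount K (M * y) : ℝ) ≤ t.card + normCount K y := by exact_mod_cast h2
    have h4 := (hb (M * y) (by nlinarith)).1
    have h5 := (hb y hyX).2
    have : a * (M * y) = 2 * b * y := by rw [hM]; field_simp
    linarith
  have hlt := h t hdisj
  rw [Real.norm_of_nonneg (Finset.sum_nonneg fun I _ => by positivity)] at hlt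
  have hle : (t.card : ℝ) * (M * y)⁻¹ ≤ ∑ I ∈ t, (Ideal.absNorm (I : Ideal (𝓞 K)) : ℝ)⁻¹ := by
    rw [← nsmul_eq_mul]
    refine Finset.card_nsmul_le_sum _ _ _ fun I hI => ?_
    exact inv_anti₀ (absNorm_pos I) (mem_coprimeIdeals.1 (Finset.mem_sdiff.1 hI).1).1
  have : b * y * (M * y)⁻¹ = a / 2 := by rw [hM]; field_simp
  have h6 : b * y * (M * y)⁻¹ ≤ t.card * (M * y)⁻¹ := by gcongr
  linarith

/-- A prime ideal, as a nonzero ideal. -/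
def primeNZ {K : Type*} [Field K] [NumberField K] (W : HeightOneSpectrum (𝓞 K)) :
    (Ideal (𝓞 K))⁰ :=
  ⟨W.asIdeal, mem_nonZeroDivisors_of_ne_zero W.ne_bot⟩

theorem exists_mul_of_dvd {K : Type*} [Field K] [NumberField K] {W : HeightOneSpectrum (𝓞 K)}
    {I : (Ideal (𝓞 K))⁰} (h : W.asIdeal ∣ (I : Ideal (𝓞 K))) : ∃ J, I = primeNZ W * J := by
  obtain ⟨J, hJ⟩ := h
  have hJ0 : J ≠ 0 := by
    rintro rfl
    exact nonZeroDivisors.coe_ne_zero I (by rw [hJ, mul_zero])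
  exact ⟨⟨J, mem_nonZeroDivisors_of_ne_zero hJ0⟩, Subtype.ext hJ⟩

theorem absNorm_primeNZ_mul {K : Type*} [Field K] [NumberField K] (W : HeightOneSpectrum (𝓞 K))
    (J : (Ideal (𝓞 K))⁰) : (Ideal.absNorm ((primeNZ W * J : (Ideal (𝓞 K))⁰) : Ideal (𝓞 K)) : ℝ) =
      Ideal.absNorm W.asIdeal * Ideal.absNorm (J : Ideal (𝓞 K)) := by
  rw [Submonoid.coe_mul, map_mul, Nat.cast_mul]
  rfl

theorem two_le_absNorm {K : Type*} [Field K] [NumberField K] (W : HeightOneSpectrum (𝓞 K)) :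
    (2 : ℝ) ≤ Ideal.absNorm W.asIdeal := by
  have h0 : Ideal.absNorm W.asIdeal ≠ 0 := Ideal.absNorm_ne_zero_of_nonZeroDivisors (primeNZ W)
  have h1 : Ideal.absNorm W.asIdeal ≠ 1 := fun h =>
    W.isPrime.ne_top (Ideal.absNorm_eq_one_iff.1 h)
  have : 2 ≤ Ideal.absNorm W.asIdeal := by omega
  exact_mod_cast this

theorem mem_coprimeIdeals_of_mul {K : Type*} [Field K] [NumberField K]
    {E : Finset (HeightOneSpectrum (𝓞 K))} {x : ℝ} {W : HeightOneSpectrum (𝓞 K)}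
    {J : (Ideal (𝓞 K))⁰} (h : primeNZ W * J ∈ coprimeIdeals K E x) : J ∈ coprimeIdeals K E x := by
  rw [mem_coprimeIdeals] at h ⊢
  rw [absNorm_primeNZ_mul] at h
  refine ⟨le_trans ?_ h.1, fun V hV hd => h.2 V hV (hd.mul_left _)⟩
  have := two_le_absNorm W
  have := absNorm_pos J
  nlinarith

/-- Excluding one more prime W costs at most a factor 2: the ideals divisible by W are W·J with J in
the same range, so they contribute at most Z/N(W) ≤ Z/2 of the total Z. -/
theorem sum_coprimeIdeals_le (E : Finset (HeightOneSpectrum (𝓞 K))) (x : ℝ) :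
    ∑ I ∈ coprimeIdeals K ∅ x, (Ideal.absNorm (I : Ideal (𝓞 K)) : ℝ)⁻¹ ≤
      2 ^ E.card * ∑ I ∈ coprimeIdeals K E x, (Ideal.absNorm (I : Ideal (𝓞 K)) : ℝ)⁻¹ := by
  classical
  induction E using Finset.induction_on with
  | empty => simp
  | insert W E hW ih =>
    refine ih.trans ?_
    rw [Finset.card_insert_of_notMem hW, pow_succ, mul_assoc]
    gcongr
    set Z := ∑ I ∈ coprimeIdeals K E x, (Ideal.absNorm (I : Ideal (𝓞 K)) : ℝ)⁻¹ with hZ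
    have h1 : Z ≤ ∑ I ∈ coprimeIdeals K (insert W E) x, (Ideal.absNorm (I : Ideal (𝓞 K)) : ℝ)⁻¹ +
        ∑ J ∈ coprimeIdeals K E x,
          (Ideal.absNorm ((primeNZ W * J : (Ideal (𝓞 K))⁰) : Ideal (𝓞 K)) : ℝ)⁻¹ := by
      rw [← Finset.sum_image (f := fun I : (Ideal (𝓞 K))⁰ =>
        (Ideal.absNorm (I : Ideal (𝓞 K)) : ℝ)⁻¹) (g := fun J => primeNZ W * J)
        fun _ _ _ _ h => mul_left_cancel h]
      refine (Finset.sum_le_sum_of_subset_of_nonneg ?_ fun _ _ _ => by positivity).trans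
        (?_ : ∑ I ∈ coprimeIdeals K (insert W E) x ∪ (coprimeIdeals K E x).image (primeNZ W * ·),
          (Ideal.absNorm (I : Ideal (𝓞 K)) : ℝ)⁻¹ ≤ _)
      · intro I hI
        by_cases hd : W.asIdeal ∣ (I : Ideal (𝓞 K))
        · obtain ⟨J, rfl⟩ := exists_mul_of_dvd hd
          exact Finset.mem_union_right _ (Finset.mem_image_of_mem _ (mem_coprimeIdeals_of_mul hI))
        · rw [mem_coprimeIdeals] at hI
          refine Finset.mem_union_left _ (mem_coprimeIdeals.2 ⟨hI.1, fun V hV => ?_⟩)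
          rcases Finset.mem_insert.1 hV with rfl | hV
          · exact hd
          · exact hI.2 V hV
      · rw [← Finset.sum_union_inter]
        exact le_add_of_nonneg_right (Finset.sum_nonneg fun _ _ => by positivity)
    have h2 : ∑ J ∈ coprimeIdeals K E x,
        (Ideal.absNorm ((primeNZ W * J : (Ideal (𝓞 K))⁰) : Ideal (𝓞 K)) : ℝ)⁻¹ ≤ Z / 2 := by
      rw [hZ, Finset.sum_div]
      refine Finset.sum_le_sum fun J _ => ?_
      rw [absNorm_primeNZ_mul, mul_inv, div_eq_mul_inv, mul_comm]
      have := two_le_absNorm W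
      gcongr
    linarith

/-- The sum of the inverses of the norms of the prime ideals diverges. -/
theorem not_summable_inv_absNorm_prime :
    ¬ Summable fun W : HeightOneSpectrum (𝓞 K) => (Ideal.absNorm W.asIdeal : ℝ)⁻¹ := by
  classical
  intro hs
  obtain ⟨E, hE⟩ := summable_iff_vanishing_norm.1 hs (1 / 2) (by positivity)
  -- The primes outside E have sums below 1/2. An ideal I ≠ 1 prime to E is a prime outside E times
  -- an ideal of the same kind, so the sum Z satisfies Z ≤ 1 + Z/2.
  have hbound (x : ℝ) : ∑ I ∈ coprimeIdeals K E x, (Ideal.absNorm (I : Ideal (𝓞 K)) : ℝ)⁻¹ ≤ 2 := by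
    set S := coprimeIdeals K E x with hS
    set Z := ∑ I ∈ S, (Ideal.absNorm (I : Ideal (𝓞 K)) : ℝ)⁻¹ with hZ
    have hex (I : (Ideal (𝓞 K))⁰) (hI : I ≠ 1) : ∃ (W : HeightOneSpectrum (𝓞 K)) (J : (Ideal (𝓞 K))⁰),
        I = primeNZ W * J := by
      have htop : (I : Ideal (𝓞 K)) ≠ ⊤ := fun h => hI (Subtype.ext (h.trans Ideal.one_eq_top.symm))
      obtain ⟨P, hP, hIP⟩ := Ideal.exists_le_maximal _ htop
      have hP0 : P ≠ ⊥ := by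
        rintro rfl
        exact nonZeroDivisors.coe_ne_zero I (le_bot_iff.1 hIP)
      obtain ⟨J, hJ⟩ := exists_mul_of_dvd (W := ⟨P, hP.isPrime, hP0⟩) (Ideal.dvd_iff_le.2 hIP)
      exact ⟨_, J, hJ⟩
    -- `choose!` needs a default prime to assign to the ideal 1.
    have hne : Nonempty (HeightOneSpectrum (𝓞 K)) := by
      obtain ⟨P, hP, hPp⟩ := Ring.not_isField_iff_exists_prime.1 (RingOfIntegers.not_isField K)
      exact ⟨⟨P, hPp, hP⟩⟩
    choose! W J hWJ using hex
    set T := (S.erase 1).image W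
    have hT : Disjoint T E := by
      rw [Finset.disjoint_left]
      intro V hV hVE
      obtain ⟨I, hI, rfl⟩ := Finset.mem_image.1 hV
      obtain ⟨hI1, hIS⟩ := Finset.mem_erase.1 hI
      refine (mem_coprimeIdeals.1 hIS).2 _ hVE ?_
      nth_rewrite 2 [hWJ I hI1]
      exact Dvd.intro _ rfl
    have hT2 := hE T hT
    rw [Real.norm_of_nonneg (Finset.sum_nonneg fun I _ => by positivity)] at hT2
    have hZ0 : 0 ≤ Z := Finset.sum_nonneg fun I _ => by positivity
    have h1 : ∑ I ∈ S.erase 1, (Ideal.absNorm (I : Ideal (𝓞 K)) : ℝ)⁻¹ ≤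
        ∑ p ∈ T ×ˢ S, (Ideal.absNorm p.1.asIdeal : ℝ)⁻¹ *
          (Ideal.absNorm (p.2 : Ideal (𝓞 K)) : ℝ)⁻¹ := by
      have hinj : Set.InjOn (fun I => (W I, J I)) (S.erase 1 : Finset _) := by
        intro I hI I' hI' h
        rw [hWJ I (Finset.ne_of_mem_erase hI), hWJ I' (Finset.ne_of_mem_erase hI')]
        have h1 : W I = W I' := congrArg Prod.fst h
        have h2 : J I = J I' := congrArg Prod.snd h
        rw [h1, h2]
      rw [Finset.sum_congr rfl fun (I : (Ideal (𝓞 K))⁰) hI => show (Ideal.absNorm (I : Ideal (𝓞 K)) : ℝ)⁻¹ =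
        (fun p : HeightOneSpectrum (𝓞 K) × (Ideal (𝓞 K))⁰ => (Ideal.absNorm p.1.asIdeal : ℝ)⁻¹ *
          (Ideal.absNorm (p.2 : Ideal (𝓞 K)) : ℝ)⁻¹) (W I, J I) by
            nth_rewrite 1 [hWJ I (Finset.ne_of_mem_erase hI)]
            rw [absNorm_primeNZ_mul, mul_inv],
        ← Finset.sum_image (f := fun p : HeightOneSpectrum (𝓞 K) × (Ideal (𝓞 K))⁰ =>
          (Ideal.absNorm p.1.asIdeal : ℝ)⁻¹ * (Ideal.absNorm (p.2 : Ideal (𝓞 K)) : ℝ)⁻¹)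
          (g := fun I => (W I, J I)) hinj]
      refine Finset.sum_le_sum_of_subset_of_nonneg ?_ fun _ _ _ => by positivity
      intro p hp
      obtain ⟨I, hI, rfl⟩ := Finset.mem_image.1 hp
      refine Finset.mem_product.2 ⟨Finset.mem_image_of_mem _ hI, ?_⟩
      refine mem_coprimeIdeals_of_mul (W := W I) ?_
      rw [← hWJ I (Finset.ne_of_mem_erase hI)]
      exact Finset.mem_of_mem_erase hI
    simp only [Finset.sum_product] at h1
    rw [← Finset.sum_mul_sum] at h1
    have h2 : Z ≤ 1 + ∑ I ∈ S.erase 1, (Ideal.absNorm (I : Ideal (𝓞 K)) : ℝ)⁻¹ := by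
      by_cases h : (1 : (Ideal (𝓞 K))⁰) ∈ S
      · rw [hZ, ← Finset.add_sum_erase _ _ h]
        simp
      · rw [Finset.erase_eq_of_notMem h]
        linarith
    nlinarith
  refine not_summable_inv_absNorm K (summable_of_sum_le (c := 2 ^ E.card * 2)
    (fun _ => by positivity) fun t => ?_)
  obtain ⟨x, hx⟩ := (t.image fun I : (Ideal (𝓞 K))⁰ => (Ideal.absNorm (I : Ideal (𝓞 K)) : ℝ)).bddAbove
  calc _ ≤ ∑ I ∈ coprimeIdeals K ∅ x, (Ideal.absNorm (I : Ideal (𝓞 K)) : ℝ)⁻¹ :=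
        Finset.sum_le_sum_of_subset_of_nonneg (fun I hI => mem_coprimeIdeals.2
          ⟨hx (Finset.mem_coe.2 (Finset.mem_image_of_mem _ hI)), by simp⟩) fun _ _ _ => by positivity
    _ ≤ _ := sum_coprimeIdeals_le K E x
    _ ≤ _ := by gcongr; exact hbound x

end Count

end IdealCount

open IsDedekindDomain NumberField
open scoped nonZeroDivisors

namespace IdealCount

/-! ### Transfer of ideals along lifts of primes -/

section Transfer

open UniqueFactorizationMonoid

variable {F L : Type*} [Field F] [NumberField F] [Field L] [NumberField L]

open Classical in
/-- A map between sets of primes, extended to all ideals by sending non-primes to `⊤`. -/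
noncomputable def primeMap (w : HeightOneSpectrum (𝓞 F) → HeightOneSpectrum (𝓞 L))
    (P : Ideal (𝓞 F)) : Ideal (𝓞 L) :=
  if h : P.IsPrime ∧ P ≠ ⊥ then (w ⟨P, h.1, h.2⟩).asIdeal else ⊤

theorem primeMap_asIdeal (w : HeightOneSpectrum (𝓞 F) → HeightOneSpectrum (𝓞 L))
    (v : HeightOneSpectrum (𝓞 F)) : primeMap w v.asIdeal = (w v).asIdeal :=
  dif_pos (⟨v.isPrime, v.ne_bot⟩ : v.asIdeal.IsPrime ∧ v.asIdeal ≠ ⊥)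

theorem exists_of_mem_normalizedFactors {I P : Ideal (𝓞 F)} (h : P ∈ normalizedFactors I) :
    ∃ v : HeightOneSpectrum (𝓞 F), P = v.asIdeal := by
  have hp := prime_of_normalized_factor P h
  exact ⟨⟨P, Ideal.isPrime_of_prime hp, hp.ne_zero⟩, rfl⟩

/-- The multiplicative extension to ideals of a map between sets of primes. -/
noncomputable def idealMap (w : HeightOneSpectrum (𝓞 F) → HeightOneSpectrum (𝓞 L))
    (I : Ideal (𝓞 F)) : Ideal (𝓞 L) :=
  ((normalizedFactors I).map (primeMap w)).prod

variable {w : HeightOneSpectrum (𝓞 F) → HeightOneSpectrum (𝓞 L)}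

theorem absNorm_idealMap
    (hw : ∀ v, Ideal.absNorm (w v).asIdeal = Ideal.absNorm v.asIdeal) {I : Ideal (𝓞 F)}
    (hI : I ≠ ⊥) : Ideal.absNorm (idealMap w I) = Ideal.absNorm I := by
  rw [idealMap, map_multiset_prod, Multiset.map_map]
  conv_rhs => rw [← Ideal.prod_normalizedFactors_eq_self hI, map_multiset_prod]
  congr 1
  refine Multiset.map_congr rfl fun P hP => ?_
  obtain ⟨v, rfl⟩ := exists_of_mem_normalizedFactors hP
  rw [Function.comp_apply, primeMap_asIdeal, hw]

theorem prime_of_mem_map_primeMap {I : Ideal (𝓞 F)} {Q : Ideal (𝓞 L)}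
    (hQ : Q ∈ (normalizedFactors I).map (primeMap w)) :
    ∃ v : HeightOneSpectrum (𝓞 F), Q = (w v).asIdeal := by
  obtain ⟨P, hP, rfl⟩ := Multiset.mem_map.1 hQ
  obtain ⟨v, rfl⟩ := exists_of_mem_normalizedFactors hP
  exact ⟨v, primeMap_asIdeal w v⟩

theorem normalizedFactors_idealMap_mul (I : Ideal (𝓞 F)) (W : HeightOneSpectrum (𝓞 L)) :
    normalizedFactors (idealMap w I * W.asIdeal) =
      W.asIdeal ::ₘ (normalizedFactors I).map (primeMap w) := by
  rw [idealMap, mul_comm, ← Multiset.prod_cons]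
  refine normalizedFactors_prod_of_prime fun Q hQ => ?_
  rcases Multiset.mem_cons.1 hQ with rfl | hQ
  · exact W.prime
  · obtain ⟨v, rfl⟩ := prime_of_mem_map_primeMap hQ
    exact (w v).prime

/-- W is not a value of the section w, so it does not occur among the factors of either transferred
ideal and must be W'. After cancelling it, applying u to the remaining prime factors recovers the
ideal of F. -/
theorem eq_of_idealMap_mul_eq {u : HeightOneSpectrum (𝓞 L) → HeightOneSpectrum (𝓞 F)}
    (hu : ∀ v, u (w v) = v) {I J : Ideal (𝓞 F)} (hI : I ≠ ⊥) (hJ : J ≠ ⊥)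
    {W W' : HeightOneSpectrum (𝓞 L)} (hW : W ≠ w (u W))
    (h : idealMap w I * W.asIdeal = idealMap w J * W'.asIdeal) : W = W' ∧ I = J := by
  have h1 := congrArg normalizedFactors h
  rw [normalizedFactors_idealMap_mul, normalizedFactors_idealMap_mul] at h1
  have hWW : W = W' := by
    have : W.asIdeal ∈ W'.asIdeal ::ₘ (normalizedFactors J).map (primeMap w) := by
      rw [← h1]; exact Multiset.mem_cons_self _ _
    rcases Multiset.mem_cons.1 this with h2 | h2
    · exact HeightOneSpectrum.ext h2
    · obtain ⟨v, hv⟩ := prime_of_mem_map_primeMap h2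
      have h3 : W = w v := HeightOneSpectrum.ext hv
      exact absurd (by rw [h3, hu]) hW
  refine ⟨hWW, ?_⟩
  rw [hWW, Multiset.cons_inj_right] at h1
  have hlift := congrArg (Multiset.map (primeMap u)) h1
  rw [Multiset.map_map, Multiset.map_map] at hlift
  have hid (I : Ideal (𝓞 F)) : (normalizedFactors I).map (primeMap u ∘ primeMap w) =
      normalizedFactors I := by
    refine (Multiset.map_congr rfl fun P hP => ?_).trans (Multiset.map_id _)
    obtain ⟨v, rfl⟩ := exists_of_mem_normalizedFactors hP
    rw [Function.comp_apply, primeMap_asIdeal, primeMap_asIdeal, hu, id_eq]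
  rw [hid, hid] at hlift
  rw [← Ideal.prod_normalizedFactors_eq_self hI, hlift, Ideal.prod_normalizedFactors_eq_self hJ]

/-- If every prime `v` of `F` has a lift `w v` to `L` of the same norm and the primes in `T` have a
second such lift, then the sum of the inverses of the norms of the primes in `T` converges. -/
theorem summable_of_two_lifts (u : HeightOneSpectrum (𝓞 L) → HeightOneSpectrum (𝓞 F))
    (hu : ∀ v, u (w v) = v) (hw : ∀ v, Ideal.absNorm (w v).asIdeal = Ideal.absNorm v.asIdeal)
    (T : Set (HeightOneSpectrum (𝓞 F))) (w' : T → HeightOneSpectrum (𝓞 L))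
    (hu' : ∀ v, u (w' v) = v) (hne : ∀ v, w' v ≠ w v)
    (hw' : ∀ v : T, Ideal.absNorm (w' v).asIdeal = Ideal.absNorm v.1.asIdeal) :
    Summable fun v : T => (Ideal.absNorm v.1.asIdeal : ℝ)⁻¹ := by
  classical
  obtain ⟨a, _, X, ha, _, hX, hF⟩ := exists_normCount_bounds F
  obtain ⟨_, b, Y, _, _, _, hL⟩ := exists_normCount_bounds L
  refine summable_of_sum_le (c := b / a) (fun _ => by positivity) fun t => ?_
  obtain ⟨m, hm⟩ := (t.image fun v : T => (Ideal.absNorm v.1.asIdeal : ℝ)).bddAbove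
  have hm' (v : T) (hv : v ∈ t) : (Ideal.absNorm v.1.asIdeal : ℝ) ≤ m :=
    hm (Finset.mem_coe.2 (Finset.mem_image_of_mem _ hv))
  -- Large enough for the upper bound in L to hold at x and for the lower bound in F to hold at
  -- x/N(v) for every v in t.
  set x := max (max Y 1) (X * m) with hx
  have hx0 : 0 < x := one_pos.trans_le ((le_max_right _ _).trans (le_max_left _ _))
  have hpos (v : T) : (0 : ℝ) < Ideal.absNorm v.1.asIdeal :=
    two_pos.trans_le (two_le_absNorm v.1)
  -- The pairs (v, I) with N(I) ≤ x/N(v) inject into the ideals of L of norm at most x by (v, I) ↦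
  -- w(I)w'(v).
  have hcount : ∑ v ∈ t, normCount F (x / Ideal.absNorm v.1.asIdeal) ≤ normCount L x := by
    simp only [← card_coprimeIdeals_empty]
    rw [← Finset.card_sigma]
    have hnz (p : Sigma fun _ : T => (Ideal (𝓞 F))⁰) :
        idealMap w (p.2 : Ideal (𝓞 F)) * (w' p.1).asIdeal ≠ 0 := by
      intro h0
      have h1 := congrArg Ideal.absNorm h0
      rw [map_mul, absNorm_idealMap hw (nonZeroDivisors.coe_ne_zero p.2), map_zero] at h1
      exact mul_ne_zero (Ideal.absNorm_ne_zero_of_nonZeroDivisors p.2)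
        (Ideal.absNorm_ne_zero_of_nonZeroDivisors (primeNZ (w' p.1))) h1
    refine Finset.card_le_card_of_injOn (fun p => ⟨idealMap w (p.2 : Ideal (𝓞 F)) *
      (w' p.1).asIdeal, mem_nonZeroDivisors_of_ne_zero (hnz p)⟩) (fun p hp => ?_) ?_
    · obtain ⟨hp1, hp2⟩ := Finset.mem_sigma.1 hp
      have h1 := (mem_coprimeIdeals.1 hp2).1
      rw [le_div_iff₀ (hpos _)] at h1
      refine mem_coprimeIdeals.2 ⟨?_, by simp⟩
      rw [map_mul, absNorm_idealMap hw (nonZeroDivisors.coe_ne_zero p.2), hw', Nat.cast_mul]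
      exact h1
    · intro p _ q _ hpq
      obtain ⟨v, I⟩ := p
      obtain ⟨v', J⟩ := q
      have h1 := eq_of_idealMap_mul_eq hu (nonZeroDivisors.coe_ne_zero I)
        (nonZeroDivisors.coe_ne_zero J) (by rw [hu']; exact hne v) (congrArg Subtype.val hpq)
      have h2 : v = v' := Subtype.ext (by rw [← hu' v, ← hu' v', h1.1])
      subst h2
      rw [Subtype.ext h1.2]
  have h1 : ∑ v ∈ t, a * (x / Ideal.absNorm v.1.asIdeal) ≤ b * x := by
    calc _ ≤ ∑ v ∈ t, (normCount F (x / Ideal.absNorm v.1.asIdeal) : ℝ) := by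
          refine Finset.sum_le_sum fun v hv => (hF _ ?_).1
          rw [le_div_iff₀ (hpos v)]
          exact (mul_le_mul_of_nonneg_left (hm' v hv) hX.le).trans (le_max_right _ _)
      _ ≤ normCount L x := by exact_mod_cast hcount
      _ ≤ b * x := (hL x ((le_max_left _ _).trans (le_max_left _ _))).2
  rw [le_div_iff₀ ha, mul_comm]
  refine le_of_mul_le_mul_right ?_ hx0
  refine le_trans (le_of_eq ?_) h1
  rw [Finset.mul_sum, Finset.sum_mul]
  exact Finset.sum_congr rfl fun v _ => by rw [div_eq_mul_inv]; ring

/-- Each g y is used at most n times, so partial sums of f are at most n times the sum of g. This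
carries convergence from the primes below to the primes above. -/
theorem summable_of_card_fiber_le {X Y : Type*} (π : X → Y) (n : ℕ)
    (hπ : ∀ (y : Y) (t : Finset X), (∀ x ∈ t, π x = y) → t.card ≤ n) {f : X → ℝ} {g : Y → ℝ}
    (hf : ∀ x, 0 ≤ f x) (hg : ∀ y, 0 ≤ g y) (hs : Summable g) (hfg : ∀ x, f x ≤ g (π x)) :
    Summable f := by
  classical
  refine summable_of_sum_le (c := n * ∑' y, g y) hf fun t => ?_
  calc ∑ x ∈ t, f x ≤ ∑ x ∈ t, g (π x) := Finset.sum_le_sum fun x _ => hfg x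
    _ = ∑ y ∈ t.image π, (t.filter (π · = y)).card • g y := Finset.sum_comp g π
    _ ≤ ∑ y ∈ t.image π, n * g y := by
      refine Finset.sum_le_sum fun y _ => ?_
      rw [nsmul_eq_mul]
      refine mul_le_mul_of_nonneg_right ?_ (hg y)
      exact_mod_cast hπ y _ fun x hx => (Finset.mem_filter.1 hx).2
    _ ≤ _ := by
      rw [← Finset.mul_sum]
      exact mul_le_mul_of_nonneg_left (hs.sum_le_tsum _ fun y _ => hg y) (by positivity)

/-- In the identity Σ e f = [S : R] every prime above v contributes at least 1. -/
theorem card_le_finrank_of_under_eq {R S : Type*} [CommRing R] [IsDedekindDomain R] [CommRing S]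
    [IsDedekindDomain S] [Algebra R S] [Module.Finite R S] [Module.IsTorsionFree R S]
    (v : HeightOneSpectrum R) (t : Finset (HeightOneSpectrum S)) (ht : ∀ W ∈ t, W.under R = v) :
    t.card ≤ Module.finrank R S := by
  classical
  have : Fintype (v.asIdeal.primesOver S) :=
    (Algebra.QuasiFinite.finite_primesOver v.asIdeal).fintype
  rw [← Ideal.sum_ramification_inertia_eq_finrank v.asIdeal S]
  have hcard : t.card ≤ Fintype.card (v.asIdeal.primesOver S) := by
    rw [← Fintype.card_coe]
    refine Fintype.card_le_of_injective (fun W => ⟨W.1.asIdeal, W.1.isPrime,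
      ⟨by rw [← ht W.1 W.2]; rfl⟩⟩) fun W W' h => ?_
    exact Subtype.ext (HeightOneSpectrum.ext (congrArg Subtype.val h))
  refine hcard.trans ?_
  rw [← Finset.card_univ, Finset.card_eq_sum_ones]
  refine Finset.sum_le_sum fun q _ => ?_
  have := q.2.1
  exact Nat.succ_le_of_lt (Nat.mul_pos (q.1.ramificationIdx_pos R) (q.1.inertiaDeg_pos R))

end Transfer

/-! ### Number fields with a lift of equal norm above every place -/

section Split

variable {F L N : Type*} [Field F] [Field L] [Field N] [NumberField F] [NumberField L]
  [NumberField N] [Algebra F L] [Algebra L N] [Algebra F N] [IsScalarTower F L N]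

theorem liesOver_under (W : HeightOneSpectrum (𝓞 N)) :
    W.asIdeal.LiesOver (W.under (𝓞 F)).asIdeal := ⟨rfl⟩

/-- Such a prime has norm at least p², where p generates the rational prime below it, and at most [N
: ℚ] primes lie above each p; the sum of 1/p² converges. -/
theorem summable_of_two_le_inertiaDeg :
    Summable fun W : {W : HeightOneSpectrum (𝓞 N) // 2 ≤ W.asIdeal.inertiaDeg (𝓞 F)} =>
      (Ideal.absNorm W.1.asIdeal : ℝ)⁻¹ := by
  have hs : Summable fun p : HeightOneSpectrum ℤ => ((Ideal.absNorm p.asIdeal : ℝ) ^ 2)⁻¹ := by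
    refine (Real.summable_nat_pow_inv.2 one_lt_two).comp_injective
      (i := fun p : HeightOneSpectrum ℤ => Ideal.absNorm p.asIdeal) fun p q h => ?_
    refine HeightOneSpectrum.ext ?_
    rw [← Int.ideal_span_absNorm_eq_self p.asIdeal, ← Int.ideal_span_absNorm_eq_self q.asIdeal]
    simp only at h
    rw [h]
  refine summable_of_card_fiber_le (fun W => W.1.under ℤ) (Module.finrank ℤ (𝓞 N)) ?_
    (fun _ => by positivity) (fun _ => by positivity) hs fun W => ?_
  · intro p t ht
    classical
    rw [← Finset.card_image_of_injective t Subtype.val_injective]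
    refine card_le_finrank_of_under_eq p _ fun W hW => ?_
    obtain ⟨W, hWt, rfl⟩ := Finset.mem_image.1 hW
    exact ht W hWt
  · have : W.1.asIdeal.LiesOver (W.1.under ℤ).asIdeal := ⟨rfl⟩
    have := liesOver_under (F := F) W.1
    have h1 := Ideal.absNorm_pow_inertiaDeg (W.1.under ℤ).asIdeal W.1.asIdeal
    have h2 := Ideal.inertiaDeg_tower (R := ℤ) (W.1.under (𝓞 F)).asIdeal W.1.asIdeal
    have h3 := (W.1.under (𝓞 F)).asIdeal.inertiaDeg_pos ℤ
    have h4 := W.2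
    have h5 : 1 ≤ Ideal.absNorm (W.1.under ℤ).asIdeal := by
      rw [Nat.one_le_iff_ne_zero, Ne, Ideal.absNorm_eq_zero_iff]
      exact (W.1.under ℤ).ne_bot
    have h6 : 2 ≤ W.1.asIdeal.inertiaDeg ℤ := by rw [h2]; nlinarith
    have h7 : Ideal.absNorm (W.1.under ℤ).asIdeal ^ 2 ≤ Ideal.absNorm W.1.asIdeal := by
      rw [← h1]; exact Nat.pow_le_pow_right h5 h6
    refine inv_anti₀ (by positivity) ?_
    exact_mod_cast h7

/-- Primes with ramification index different from 1 divide the different, which is not zero. -/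
theorem finite_ramificationIdx_ne_one :
    {W : HeightOneSpectrum (𝓞 N) | W.asIdeal.ramificationIdx (𝓞 F) ≠ 1}.Finite := by
  let := FractionRing.liftAlgebra (𝓞 F) (FractionRing (𝓞 N))
  have : CharZero (FractionRing (𝓞 F)) := inferInstance
  refine (Ideal.finite_factors (I := differentIdeal (𝓞 F) (𝓞 N)) ?_).subset fun W hW => ?_
  · exact differentIdeal_ne_bot
  · by_contra h
    have : Algebra.IsUnramifiedAt (𝓞 F) W.asIdeal := not_dvd_differentIdeal_iff.1 h
    exact hW (Ideal.ramificationIdx_eq_one W.asIdeal (𝓞 F))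

/-- A number field extension `L / F` in which every prime of `F` has a lift of the same norm is
trivial. -/
theorem finrank_eq_one_of_lifts [IsGalois F N]
    (h : ∀ v : HeightOneSpectrum (𝓞 F), ∃ w : HeightOneSpectrum (𝓞 L), w.under (𝓞 F) = v ∧
      Ideal.absNorm w.asIdeal = Ideal.absNorm v.asIdeal) : Module.finrank F L = 1 := by
  classical
  by_contra hL
  have hfin : Module.finrank (𝓞 F) (𝓞 L) = Module.finrank F L :=
    (IsFractionRing.finrank_eq (𝓞 F) F (𝓞 L) L).symm
  have hL2 : 2 ≤ Module.finrank (𝓞 F) (𝓞 L) := by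
    have := Module.finrank_pos (R := F) (M := L)
    omega
  choose w hwu hwN using h
  -- As N/F is Galois, one unramified prime of degree one above v forces v to split completely in N,
  -- hence in L.
  set T : Set (HeightOneSpectrum (𝓞 F)) := {v | ∃ W : HeightOneSpectrum (𝓞 N), W.under (𝓞 F) = v ∧
    W.asIdeal.ramificationIdx (𝓞 F) = 1 ∧ W.asIdeal.inertiaDeg (𝓞 F) = 1} with hT
  have hex (v : T) : ∃ w' : HeightOneSpectrum (𝓞 L), w'.under (𝓞 F) = v ∧ w' ≠ w v ∧
      Ideal.absNorm w'.asIdeal = Ideal.absNorm v.1.asIdeal := by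
    obtain ⟨v, W, rfl, he, hf⟩ := v
    set v := W.under (𝓞 F)
    have hWv : W.asIdeal.LiesOver v.asIdeal := ⟨rfl⟩
    -- All primes of N above v share the values e = f = 1 of W, and both invariants are
    -- multiplicative in the tower N/L/F. So v has [L : F] ≥ 2 primes in L, all of the same norm as
    -- v, and one of them differs from `w v`.
    have key (q : v.asIdeal.primesOver (𝓞 L)) :
        q.1.ramificationIdx (𝓞 F) = 1 ∧ q.1.inertiaDeg (𝓞 F) = 1 := by
      have := q.2.1
      have := q.2.2
      obtain ⟨Q, hQ, hQq⟩ := Ideal.exists_maximal_ideal_liesOver_of_isIntegral (S := 𝓞 N) q.1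
      have hQv : Q.LiesOver v.asIdeal := Ideal.LiesOver.trans Q q.1 v.asIdeal
      have h1 := Ideal.inertiaDeg_eq_of_isGaloisGroup v.asIdeal Q W.asIdeal Gal(N/F)
      have h2 := Ideal.ramificationIdx_eq_of_isGaloisGroup v.asIdeal Q W.asIdeal Gal(N/F)
      rw [hf, Ideal.inertiaDeg_tower q.1 Q] at h1
      rw [he, Ideal.ramificationIdx_tower q.1 Q] at h2
      exact ⟨Nat.eq_one_of_mul_eq_one_right h2, Nat.eq_one_of_mul_eq_one_right h1⟩
    have : Fintype (v.asIdeal.primesOver (𝓞 L)) :=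
      (Algebra.QuasiFinite.finite_primesOver v.asIdeal).fintype
    have hcard := Ideal.sum_ramification_inertia_eq_finrank v.asIdeal (𝓞 L)
    rw [Finset.sum_congr rfl fun q _ => by rw [(key q).1, (key q).2, one_mul],
      ← Finset.card_eq_sum_ones, Finset.card_univ] at hcard
    have hnt : 1 < Fintype.card (v.asIdeal.primesOver (𝓞 L)) := by omega
    obtain ⟨q, hq⟩ := Fintype.exists_ne_of_one_lt_card hnt ⟨(w v).asIdeal, (w v).isPrime,
      ⟨by nth_rewrite 1 [← hwu v]; rfl⟩⟩
    have := q.2.1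
    have := q.2.2
    refine ⟨⟨q.1, q.2.1, Ideal.ne_bot_of_liesOver_of_ne_bot v.ne_bot q.1⟩,
      HeightOneSpectrum.ext q.2.2.over.symm, fun h => hq ?_, ?_⟩
    · exact Subtype.ext (congrArg HeightOneSpectrum.asIdeal h)
    · have := Ideal.absNorm_pow_inertiaDeg v.asIdeal q.1
      rw [(key q).2, pow_one] at this
      exact this.symm
  choose w' hw'u hw'ne hw'N using hex
  have hsT := summable_of_two_lifts (w := w) (fun W => W.under (𝓞 F)) hwu hwN T w' hw'u hw'ne hw'N
  have hs1 : Summable fun W : {W : HeightOneSpectrum (𝓞 N) //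
      W.asIdeal.ramificationIdx (𝓞 F) = 1 ∧ W.asIdeal.inertiaDeg (𝓞 F) = 1} =>
      (Ideal.absNorm W.1.asIdeal : ℝ)⁻¹ := by
    refine summable_of_card_fiber_le (fun W => (⟨W.1.under (𝓞 F), W.1, rfl, W.2⟩ : T))
      (Module.finrank (𝓞 F) (𝓞 N)) ?_ (fun _ => by positivity) (fun _ => by positivity) hsT
      fun W => ?_
    · intro p t ht
      rw [← Finset.card_image_of_injective t Subtype.val_injective]
      refine card_le_finrank_of_under_eq p.1 _ fun W hW => ?_
      obtain ⟨W, hWt, rfl⟩ := Finset.mem_image.1 hW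
      exact congrArg Subtype.val (ht W hWt)
    · have := liesOver_under (F := F) W.1
      have := Ideal.absNorm_pow_inertiaDeg (W.1.under (𝓞 F)).asIdeal W.1.asIdeal
      rw [W.2.2, pow_one] at this
      rw [this]
  have hs2 := summable_of_two_le_inertiaDeg (F := F) (N := N)
  have hs3 := finite_ramificationIdx_ne_one (F := F) (N := N)
  refine not_summable_inv_absNorm_prime N ?_
  set f := fun W : HeightOneSpectrum (𝓞 N) => (Ideal.absNorm W.asIdeal : ℝ)⁻¹ with hf
  -- Every prime of N has e = f = 1, or f ≥ 2, or e ≠ 1. Each of the three families has a convergent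
  -- sum, against the divergence over all primes of N.
  set A := {W : HeightOneSpectrum (𝓞 N) |
      W.asIdeal.ramificationIdx (𝓞 F) = 1 ∧ W.asIdeal.inertiaDeg (𝓞 F) = 1}
  set B := {W : HeightOneSpectrum (𝓞 N) | 2 ≤ W.asIdeal.inertiaDeg (𝓞 F)}
  set C := {W : HeightOneSpectrum (𝓞 N) | W.asIdeal.ramificationIdx (𝓞 F) ≠ 1}
  have hA : Summable (A.indicator f) := summable_subtype_iff_indicator.1 hs1
  have hB : Summable (B.indicator f) := summable_subtype_iff_indicator.1 hs2
  have hC : Summable (C.indicator f) := by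
    refine summable_of_hasFiniteSupport (hs3.subset ?_)
    exact Set.support_indicator_subset
  refine Summable.of_nonneg_of_le (fun _ => by positivity) (fun W => ?_) ((hA.add hB).add hC)
  have h0 : 0 ≤ f W := by positivity
  have hAW : 0 ≤ A.indicator f W := Set.indicator_nonneg (fun _ _ => by positivity) _
  have hBW : 0 ≤ B.indicator f W := Set.indicator_nonneg (fun _ _ => by positivity) _
  have hCW : 0 ≤ C.indicator f W := Set.indicator_nonneg (fun _ _ => by positivity) _
  by_cases h1 : W ∈ C
  · have := Set.indicator_of_mem h1 f
    linarith
  · by_cases h2 : W ∈ B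
    · have := Set.indicator_of_mem h2 f
      linarith
    · have h3 := W.asIdeal.inertiaDeg_pos (𝓞 F)
      have h4 : W ∈ A := ⟨not_not.1 h1, by
        have : ¬ 2 ≤ W.asIdeal.inertiaDeg (𝓞 F) := h2
        omega⟩
      have := Set.indicator_of_mem h4 f
      linarith

end Split

end IdealCount

/-! ### Restriction of automorphisms and its continuity -/

namespace GaloisAlg

section Restriction

variable {K C K' C' : Type*} [Field K] [Field C] [Field K'] [Field C'] [Algebra K C]
  [Algebra K' C'] [Algebra K K'] [Algebra K C'] [IsScalarTower K K' C'] [Normal K C]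

/-- Restriction of automorphisms along an embedding `i : C → C'` over `K`. -/
def resGal (K' : Type*) [Field K'] [Algebra K' C'] [Algebra K K'] [IsScalarTower K K' C']
    (i : C →ₐ[K] C') : Gal(C'/K') →* Gal(C/K) :=
  letI := i.toRingHom.toAlgebra
  haveI : IsScalarTower K C C' := IsScalarTower.of_algebraMap_eq fun x => (i.commutes x).symm
  (AlgEquiv.restrictNormalHom C).comp (AlgEquiv.restrictScalarsHom K)

theorem resGal_commutes (i : C →ₐ[K] C') (ω : Gal(C'/K')) (x : C) :
    i (resGal K' i ω x) = ω (i x) := by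
  let := i.toRingHom.toAlgebra
  have : IsScalarTower K C C' := IsScalarTower.of_algebraMap_eq fun x => (i.commutes x).symm
  exact AlgEquiv.restrictNormal_commutes (AlgEquiv.restrictScalarsHom K ω) C x

/-- U contains the fixer of some K(s) with s finite, and an automorphism that fixes K'(i(s))
restricts into it. That field is finite over K' because the elements of i(s) are algebraic. -/
theorem isOpen_comap_resGal (i : C →ₐ[K] C') (U : Subgroup Gal(C/K))
    (hU : IsOpen (U : Set Gal(C/K))) : IsOpen (U.comap (resGal K' i) : Set Gal(C'/K')) := by
  have h1 : (U : Set Gal(C/K)) ∈ nhds 1 := hU.mem_nhds U.one_mem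
  obtain ⟨E, hE, hEU⟩ := (krullTopology_mem_nhds_one_iff K C _).1 h1
  obtain ⟨s, rfl⟩ := E.fg_of_fg_toSubalgebra
    (Subalgebra.fg_of_fg_toSubmodule (Module.Finite.iff_fg.1 hE))
  have halg (x : C') (hx : x ∈ i '' (s : Set C)) : IsIntegral K' x := by
    obtain ⟨y, -, rfl⟩ := hx
    exact ((Normal.isIntegral (F := K) inferInstance y).map i).tower_top
  let E' := IntermediateField.adjoin K' (i '' (s : Set C))
  have : Finite (i '' (s : Set C)) := (s.finite_toSet.image i).to_subtype
  have hfin : FiniteDimensional K' E' := IntermediateField.finiteDimensional_adjoin halg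
  refine Subgroup.isOpen_of_mem_nhds _ (g := 1) ?_
  refine (krullTopology_mem_nhds_one_iff K' C' _).2 ⟨E', hfin, fun ω hω => hEU ?_⟩
  rw [SetLike.mem_coe, IntermediateField.mem_fixingSubgroup_iff] at hω ⊢
  intro x hx
  change x ∈ IntermediateField.adjoin K (s : Set C) at hx
  induction hx using IntermediateField.adjoin_induction with
  | mem x hx =>
    apply i.injective
    change i (resGal K' i ω x) = i x
    rw [resGal_commutes]
    exact hω _ (IntermediateField.subset_adjoin _ _ ⟨x, hx, rfl⟩)
  | algebraMap x => exact (resGal K' i ω).commutes x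
  | add x y _ _ hx hy => rw [map_add, hx, hy]
  | inv x _ hx => rw [map_inv₀, hx]
  | mul x y _ _ hx hy => rw [map_mul, hx, hy]

end Restriction

end GaloisAlg

/-! ### One decomposition group per finite place -/

namespace RelativeK

open IsDedekindDomain NumberField GaloisAlg

section Decomposition

variable {F : Type u} [Field F] [NumberField F]

/-- Pulling the maximal ideal of O_{F_v} back along φ gives a prime P of L above v. Every element of
O_{F_v} is congruent to an element of O_F, so the residue field of v already surjects onto that of
P. -/
theorem under_comap_eq_and_absNorm_eq {L : Type*} [Field L] [NumberField L] [Algebra F L]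
    (v : HeightOneSpectrum (𝓞 F)) (φ : L →ₐ[F] v.adicCompletion F) :
    ∃ w : HeightOneSpectrum (𝓞 L), w.under (𝓞 F) = v ∧
      Ideal.absNorm w.asIdeal = Ideal.absNorm v.asIdeal := by
  have hint (y : 𝓞 L) : φ y ∈ v.adicCompletionIntegers F := by
    have h1 : IsIntegral (𝓞 F) (y : L) := (RingOfIntegers.isIntegral_coe y).tower_top
    have : IsScalarTower (𝓞 F) (v.adicCompletionIntegers F) (v.adicCompletion F) :=
      IsScalarTower.of_algebraMap_eq fun _ => rfl
    have h2 : IsIntegral (v.adicCompletionIntegers F) (φ y) :=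
      (h1.map (φ.restrictScalars (𝓞 F))).tower_top
    obtain ⟨z, hz⟩ := IsIntegrallyClosed.isIntegral_iff.1 h2
    rw [← hz]
    exact z.2
  let ψ : 𝓞 L →+* v.adicCompletionIntegers F :=
    ((φ : L →+* v.adicCompletion F).comp (algebraMap (𝓞 L) L)).codRestrict _ hint
  let P : Ideal (𝓞 L) := (IsLocalRing.maximalIdeal (v.adicCompletionIntegers F)).comap ψ
  have hmem (y : 𝓞 L) : y ∈ P ↔ Valued.v (φ y) < 1 := by
    rw [Ideal.mem_comap, IsLocalRing.mem_maximalIdeal, mem_nonunits_iff,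
      HeightOneSpectrum.adicCompletionIntegers.isUnit_iff_valued_eq_one]
    exact ⟨fun h => lt_of_le_of_ne (hint y) h, fun h => h.ne⟩
  have hφ (a : 𝓞 F) : φ (algebraMap (𝓞 F) (𝓞 L) a : 𝓞 L) =
      algebraMap F (v.adicCompletion F) (a : F) := φ.commutes (a : F)
  have hover : P.LiesOver v.asIdeal := by
    refine ⟨Ideal.ext fun a => ?_⟩
    rw [Ideal.under_def, Ideal.mem_comap, hmem, hφ, ← v.valuation_lt_one_iff_mem (K := F),
      ← HeightOneSpectrum.valuedAdicCompletion_eq_valuation']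
    rfl
  have hP : P.IsPrime := inferInstance
  have hP0 : P ≠ ⊥ := Ideal.ne_bot_of_liesOver_of_ne_bot v.ne_bot P
  refine ⟨⟨P, hP, hP0⟩, HeightOneSpectrum.ext hover.over.symm, ?_⟩
  have h1 := Ideal.absNorm_pow_inertiaDeg v.asIdeal P
  have h2 := P.inertiaDeg_pos (𝓞 F)
  have h3 : 1 ≤ Ideal.absNorm v.asIdeal := by
    rw [Nat.one_le_iff_ne_zero, Ne, Ideal.absNorm_eq_zero_iff]
    exact v.ne_bot
  refine le_antisymm ?_ ?_
  · have := finite_quotient_ringOfIntegers F v.asIdeal v.isMaximal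
    have hsurj : Function.Surjective (algebraMap (𝓞 F ⧸ v.asIdeal) (𝓞 L ⧸ P)) := by
      intro y
      obtain ⟨y, rfl⟩ := Ideal.Quotient.mk_surjective y
      obtain ⟨a, ha⟩ := exists_sub_lt_one F v (φ y) (hint y)
      refine ⟨Ideal.Quotient.mk _ a, (Ideal.Quotient.eq.2 ((hmem _).2 ?_)).symm⟩
      have h4 : φ ((y - algebraMap (𝓞 F) (𝓞 L) a : 𝓞 L) : L) =
          φ y - algebraMap F (v.adicCompletion F) a := by
        rw [← hφ, ← map_sub]
        rfl
      rw [h4]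
      exact ha
    simp only [Ideal.absNorm_apply, Submodule.cardQuot_apply]
    exact Nat.card_le_card_of_surjective _ hsurj
  · change _ ≤ Ideal.absNorm P
    rw [← h1]
    exact le_self_pow₀ h3 h2.ne'

/-- By hypothesis L embeds over F into every completion F_v, so each v has a lift to L of the same
norm, and the counting theorem gives [L : F] = 1. -/
theorem eq_bot_of_forall_mem_range (i : ∀ v : HeightOneSpectrum (𝓞 F),
      AlgebraicClosure F →ₐ[F] AlgebraicClosure (v.adicCompletion F))
    (L : IntermediateField F (AlgebraicClosure F)) [FiniteDimensional F L]
    (h : ∀ v, ∀ x ∈ L, i v x ∈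
      Set.range (algebraMap (v.adicCompletion F) (AlgebraicClosure (v.adicCompletion F)))) :
    L = ⊥ := by
  have : NumberField L := NumberField.of_module_finite F L
  -- The counting theorem needs some Galois extension of F above L.
  let N := IntermediateField.normalClosure F L (AlgebraicClosure F)
  have : NumberField N := NumberField.of_module_finite F N
  rw [← IntermediateField.finrank_eq_one_iff]
  refine IdealCount.finrank_eq_one_of_lifts (N := N) fun v => ?_
  let j := IsScalarTower.toAlgHom F (v.adicCompletion F) (AlgebraicClosure (v.adicCompletion F))
  let e := AlgEquiv.ofInjective j j.injective
  let φ : L →ₐ[F] v.adicCompletion F :=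
    e.symm.toAlgHom.comp (((i v).comp L.val).codRestrict j.range fun x => h v x x.2)
  exact under_comap_eq_and_absNorm_eq v φ

/-- An open subgroup of the absolute Galois group of a number field that contains one decomposition
group for each finite place is the whole group. -/
theorem eq_top_of_forall_resGal_mem (i : ∀ v : HeightOneSpectrum (𝓞 F),
      AlgebraicClosure F →ₐ[F] AlgebraicClosure (v.adicCompletion F))
    (H : Subgroup Gal(AlgebraicClosure F/F)) (hH : IsOpen (H : Set Gal(AlgebraicClosure F/F)))
    (h : ∀ (v : HeightOneSpectrum (𝓞 F))
      (ω : Gal(AlgebraicClosure (v.adicCompletion F)/v.adicCompletion F)),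
      resGal (v.adicCompletion F) (i v) ω ∈ H) : H = ⊤ := by
  let L := IntermediateField.fixedField H
  have hL : L.fixingSubgroup = H :=
    InfiniteGalois.fixingSubgroup_fixedField ⟨H, Subgroup.isClosed_of_isOpen _ hH⟩
  have : FiniteDimensional F L := by
    rw [← InfiniteGalois.isOpen_iff_finite, hL]
    exact hH
  rw [← hL, eq_bot_of_forall_mem_range i L, IntermediateField.fixingSubgroup_bot]
  intro v x hx
  -- Elements of L are fixed by the decomposition group at v, which lies in H, so their images are
  -- fixed by Ω_{F_v} and lie in F_v.
  rw [InfiniteGalois.mem_range_algebraMap_iff_fixed]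
  intro ω
  rw [← resGal_commutes]
  exact congrArg (i v) (hx ⟨_, h v ω⟩)

end Decomposition

end RelativeK

/-! ### The lattice of resolvends; tameness and ramification read off from it -/

namespace GaloisAlg

open scoped AlgebraMonoidAlgebra
open MonoidAlgebra (single)

section Restriction

variable {K C K' C' G : Type u} [Field K] [Field C] [Field K'] [Field C'] [Algebra K C]
  [Algebra K' C'] [Algebra K K'] [Algebra K C'] [IsScalarTower K K' C'] [Normal K C] [CommGroup G]

/-- The restriction of a class along an embedding of algebraically closed fields. -/
def H1.res (π : H1 K C G) (K' : Type u) [Field K'] [Algebra K' C'] [Algebra K K']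
    [IsScalarTower K K' C'] (i : C →ₐ[K] C') : H1 K' C' G where
  toHom := π.toHom.comp (resGal K' i)
  isOpen_ker := by
    rw [← MonoidHom.comap_ker]
    exact isOpen_comap_resGal i _ π.isOpen_ker

end Restriction

section Resolvend

variable (R : Type u) {K C G : Type u} [CommRing R] [Field K] [Field C] [Algebra R K] [Algebra K C]
  [Algebra R C] [IsScalarTower R K C] [CommGroup G] [Fintype G]

/-- The lattice r_G(O_π) is cut out by an equivariance condition and an integrality condition. All
later comparisons of global and local lattices go through this description. -/
theorem H1.mem_range_resolvend (π : H1 K C G) (x : MonoidAlgebra C G) :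
    x ∈ LinearMap.range (π.resolvend R) ↔
      (∀ ω : Gal(C/K), MonoidAlgebra.mapRingHom G (ω : C →+* C) x = single (π.toHom ω) 1 * x) ∧
        ∀ t, IsIntegral R (x.coeff t) := by
  constructor
  · rintro ⟨a, rfl⟩
    refine ⟨H1.map_resolvend R π a, fun t => ?_⟩
    rw [H1.resolvend_apply, coeff_resolvend]
    exact π.isIntegral_toFun a t⁻¹
  · rintro ⟨h, hint⟩
    refine ⟨π.mkInt R (fun γ => x.coeff γ⁻¹) (fun ω γ => ?_) fun γ => hint _, ?_⟩
    · have := congrArg (fun x => MonoidAlgebra.coeff x γ⁻¹) (h ω)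
      simp only [MonoidAlgebra.coeff_mapRingHom] at this
      change ω (x.coeff γ⁻¹) = x.coeff (γ * π.toHom ω)⁻¹
      rw [mul_inv]
      simpa [mul_comm] using this
    · rw [H1.resolvend_apply]
      ext t
      rw [coeff_resolvend]
      change x.coeff t⁻¹⁻¹ = _
      rw [inv_inv]

theorem H1.toFun_mul (π : H1 K C G) (a : π.Integers R) (ω : Gal(C/K)) (γ : G) :
    ω (π.toFun R a γ) = π.toFun R a (γ * π.toHom ω) := (π.integersEquiv R a).1.2 ω γ

theorem H1.toFun_bar [IsGalois K C] (π : H1 K C G) (a : π.Integers R) (σ : Gal(π.field/K)) (γ : G) :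
    ((σ ⟨π.toFun R a γ, π.toFun_mem_field a γ⟩ : π.field) : C) = π.toFun R a (γ * π.bar σ) := by
  obtain ⟨ω, rfl⟩ := AlgEquiv.restrictNormalHom_surjective (F := K) (K₁ := π.field) C σ
  rw [π.bar_restrict, ← π.toFun_mul R]
  exact AlgEquiv.restrictNormal_commutes ω π.field _

end Resolvend

section Tame

variable (R : Type u) {K C G : Type u} [CommRing R] [Field K] [Field C] [Algebra R K] [Algebra K C]
  [Algebra R C] [IsScalarTower R K C] [CommGroup G] [Fintype G]
  [IsGalois K C] [IsDedekindDomain R] [IsFractionRing R K]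

/-- The value of an element of `O_π`, as an element of the ring of integers of `K^π`. -/
def H1.val (π : H1 K C G) (a : π.Integers R) (γ : G) : integralClosure R π.field :=
  ⟨⟨π.toFun R a γ, π.toFun_mem_field a γ⟩,
    (isIntegral_algHom_iff (π.field.val.restrictScalars R) Subtype.val_injective).1
      (π.isIntegral_toFun a γ)⟩

theorem H1.smul_val (π : H1 K C G) (a : π.Integers R) (σ : Gal(π.field/K)) (γ : G) :
    σ • π.val R a γ = π.val R a (γ * π.bar σ) :=
  Subtype.ext (Subtype.ext (π.toFun_bar R a σ γ))

/-- A sum over a finite group of a function that is invariant under a subgroup is a multiple of the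
order of the subgroup. -/
theorem exists_sum_eq_card_nsmul {G A : Type*} [Group G] [Fintype G] [AddCommMonoid A]
    (H : Subgroup G) (f : G → A) (hf : ∀ γ, ∀ h ∈ H, f (γ * h) = f γ) :
    ∃ a, ∑ γ, f γ = Nat.card H • a := by
  classical
  let e : G ≃ (G ⧸ H) × H :=
    { toFun γ := (γ, ⟨(γ : G ⧸ H).out⁻¹ * γ, QuotientGroup.eq.1 (QuotientGroup.out_eq' _)⟩)
      invFun p := p.1.out * p.2
      left_inv γ := mul_inv_cancel_left _ _
      right_inv p := by
        have h : ((p.1.out * p.2 : G) : G ⧸ H) = p.1 := by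
          rw [QuotientGroup.mk_mul_of_mem _ p.2.2, QuotientGroup.out_eq']
        exact Prod.ext h (Subtype.ext (by simp [h])) }
  refine ⟨∑ q : G ⧸ H, f q.out, ?_⟩
  rw [← e.symm.sum_comp, Fintype.sum_prod_type, Finset.smul_sum]
  refine Finset.sum_congr rfl fun q _ => ?_
  rw [Finset.sum_congr rfl (g := fun _ => f q.out), Finset.sum_const, Finset.card_univ,
    Nat.card_eq_fintype_card]
  exact fun h _ => hf _ _ h.2

/-- Modulo P the values of z are invariant under the image of inertia in G, so their sum is a
multiple of the inertia order e. As the sum is 1, e is not zero in the residue field. -/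
theorem H1.isTame_of_sum_eq_one (hR : ∀ p : Ideal R, p.IsMaximal → Finite (R ⧸ p)) (π : H1 K C G)
    (z : π.Integers R) (hz : ∑ γ, π.toFun R z γ = 1) : π.IsTame R := by
  intro P hP h0
  have hs : ∑ γ, π.val R z γ = 1 := by
    apply Subtype.ext; apply Subtype.ext
    refine Eq.trans ?_ hz
    simp [H1.val]
  rw [← π.card_inertia R hR P] at h0
  obtain ⟨a, ha⟩ := exists_sum_eq_card_nsmul ((P.inertia Gal(π.field/K)).map π.bar)
    (fun γ => Ideal.Quotient.mk P (π.val R z γ)) (by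
      rintro γ _ ⟨σ, hσ, rfl⟩
      rw [← π.smul_val R, Ideal.Quotient.eq]
      exact hσ _)
  rw [← map_sum, hs, Subgroup.card_map_of_injective π.bar_injective, nsmul_eq_mul, h0, zero_mul,
    map_one] at ha
  have := Ideal.Quotient.nontrivial_iff.2 hP.ne_top
  exact one_ne_zero ha

/-- The trace criterion turns tameness into a property of the lattice of resolvends, namely that its
augmentation takes the value 1; in this form it can be moved between F and F_v. -/
theorem H1.isTame_iff (hR : ∀ p : Ideal R, p.IsMaximal → Finite (R ⧸ p)) (π : H1 K C G) :
    π.IsTame R ↔ ∃ z : π.Integers R, ∑ γ, π.toFun R z γ = 1 := by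
  refine ⟨fun h => ?_, fun ⟨z, hz⟩ => π.isTame_of_sum_eq_one R hR z hz⟩
  obtain ⟨y, hy⟩ := h.exists_trace_eq_one R hR
  refine ⟨π.mkInt R (π.spread y) (π.spread_mem y) (π.isIntegral_spread R y y.2), ?_⟩
  change ∑ γ, π.spread (y : π.field) γ = 1
  rw [H1.sum_spread]
  have := congrArg (fun x : integralClosure R π.field => ((x : π.field) : C)) hy
  simpa using this

/-- If some resolvend is a unit with integral inverse, then the class is unramified. -/
theorem H1.isUnramified_of_mul_eq_one (hR : ∀ p : Ideal R, p.IsMaximal → Finite (R ⧸ p))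
    (π : H1 K C G) (a : π.Integers R) (c : MonoidAlgebra C G) (hc : ∀ t, IsIntegral R (c.coeff t))
    (h : π.resolvend R a * c = 1) : π.IsUnramified R := by
  intro P hP
  rw [← π.card_inertia R hR P, Subgroup.card_eq_one, eq_bot_iff]
  intro σ hσ
  -- Such an ω fixes the resolvend and therefore its inverse c. Hence c has coefficients in the ring
  -- of integers of K^π and can be reduced modulo P.
  have hfix (ω : Gal(C/K)) (hω : π.toHom ω = 1) : MonoidAlgebra.mapRingHom G (ω : C →+* C) c = c := by
    have h1 := congrArg (MonoidAlgebra.mapRingHom G (ω : C →+* C)) h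
    rw [map_mul, H1.map_resolvend, hω, map_one, ← MonoidAlgebra.one_def, one_mul] at h1
    exact (IsUnit.of_mul_eq_one _ h).mul_left_cancel (h1.trans h.symm)
  have hmem (t : G) : c.coeff t ∈ π.field := by
    rintro ⟨ω, hω⟩
    have := congrArg (fun x => MonoidAlgebra.coeff x t) (hfix ω hω)
    simpa [MonoidAlgebra.coeff_mapRingHom] using this
  let S := integralClosure R π.field
  let c' : MonoidAlgebra S G := ∑ t, single t ⟨⟨c.coeff t, hmem t⟩,
    (isIntegral_algHom_iff (π.field.val.restrictScalars R) Subtype.val_injective).1 (hc t)⟩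
  let a' : MonoidAlgebra S G := ∑ s, single s⁻¹ (π.val R a s)
  let ι : S →+* C := (algebraMap π.field C).comp (algebraMap S π.field)
  have hι : Function.Injective ι := (Subtype.val_injective.comp Subtype.val_injective)
  have hc' : MonoidAlgebra.mapRingHom G ι c' = c := by
    classical
    ext t
    simp [c', Finsupp.single_apply]
    rfl
  have ha' : MonoidAlgebra.mapRingHom G ι a' = π.resolvend R a := by
    rw [H1.resolvend_apply, GaloisAlg.resolvend]
    simp [a']
    rfl
  have hac : a' * c' = 1 := by
    have h2 : MonoidAlgebra.mapRingHom G ι (a' * c') = MonoidAlgebra.mapRingHom G ι 1 := by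
      rw [map_mul, hc', ha', h, map_one]
    ext t
    have := congrArg (fun x => MonoidAlgebra.coeff x t) h2
    simp only [MonoidAlgebra.coeff_mapRingHom] at this
    exact congrArg (fun x : S => ((x : π.field) : C)) (hι this)
  let q : MonoidAlgebra S G →+* MonoidAlgebra (S ⧸ P) G :=
    MonoidAlgebra.mapRingHom G (Ideal.Quotient.mk P)
  -- Multiplication by the group element only applies σ to the coefficients, and inertia acts
  -- trivially modulo P. As q a' is a unit, the group element is 1 in (S/P)G.
  have hq : single (π.bar σ) 1 * q a' = q a' := by
    simp only [q, a', map_sum, MonoidAlgebra.mapRingHom_single, Finset.mul_sum,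
      MonoidAlgebra.single_mul_single, one_mul]
    refine Fintype.sum_equiv (Equiv.mulRight (π.bar σ)⁻¹) _ _ fun s => ?_
    rw [Equiv.coe_mulRight, mul_inv_rev, inv_inv]
    congr 1
    rw [← (inv_mul_cancel_right s (π.bar σ))]
    rw [← π.smul_val R, inv_mul_cancel_right, Ideal.Quotient.eq]
    exact hσ _
  have h3 : (single (π.bar σ) 1 : MonoidAlgebra (S ⧸ P) G) = 1 := by
    have h4 : q a' * q c' = 1 := by rw [← map_mul, hac, map_one]
    have := congrArg (· * q c') hq
    simpa [mul_assoc, h4] using this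
  have := Ideal.Quotient.nontrivial_iff.2 hP.ne_top
  rw [Subgroup.mem_bot]
  apply π.bar_injective
  rw [map_one]
  rw [MonoidAlgebra.one_def] at h3
  exact (Finsupp.single_left_inj one_ne_zero).1 (congrArg MonoidAlgebra.coeff h3)

end Tame

end GaloisAlg

/-! ### Comparing global and local lattices of resolvends -/

namespace RelativeK

open scoped AlgebraMonoidAlgebra
open MonoidAlgebra (single)
open IsDedekindDomain NumberField GaloisAlg

section LocalIntegers

variable {F : Type u} [Field F] [NumberField F] (v : HeightOneSpectrum (𝓞 F))

theorem exists_sub_mem_adicCompletionIntegers (x : v.adicCompletion F) :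
    ∃ k : F, x - algebraMap F (v.adicCompletion F) k ∈ v.adicCompletionIntegers F := by
  have hn : {y : v.adicCompletion F | Valued.v.restrict (y - x) < 1} ∈ nhds x :=
    Valued.mem_nhds.2 ⟨1, fun _ h => h⟩
  obtain ⟨k, hk⟩ := (HeightOneSpectrum.denseRange_algebraMap F v).mem_nhds hn
  refine ⟨k, ?_⟩
  have hk1 : Valued.v (algebraMap F (v.adicCompletion F) k - x) < 1 :=
    (Valuation.restrict_lt_one_iff _).1 hk
  rw [HeightOneSpectrum.mem_adicCompletionIntegers, Valuation.map_sub_swap]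
  exact hk1.le

theorem isUnit_algebraMap_adicCompletionIntegers {s : 𝓞 F} (hs : s ∉ v.asIdeal) :
    IsUnit (algebraMap (𝓞 F) (v.adicCompletionIntegers F) s) := by
  rw [HeightOneSpectrum.adicCompletionIntegers.isUnit_iff_valued_eq_one]
  exact (HeightOneSpectrum.valuedAdicCompletion_eq_valuation' v (s : F)).trans
    (HeightOneSpectrum.valuation_eq_one_iff_notMem v |>.2 hs)

variable (i : AlgebraicClosure F →ₐ[F] AlgebraicClosure (v.adicCompletion F))

theorem mem_adicCompletionIntegers_of_isIntegral (x : v.adicCompletion F)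
    (h : IsIntegral (v.adicCompletionIntegers F)
      (algebraMap _ (AlgebraicClosure (v.adicCompletion F)) x)) :
    x ∈ v.adicCompletionIntegers F := by
  have h1 : IsIntegral (v.adicCompletionIntegers F) x :=
    (isIntegral_algHom_iff (IsScalarTower.toAlgHom (v.adicCompletionIntegers F)
      (v.adicCompletion F) (AlgebraicClosure (v.adicCompletion F)))
      (algebraMap (v.adicCompletion F) (AlgebraicClosure (v.adicCompletion F))).injective).1 h
  obtain ⟨z, hz⟩ := IsIntegrallyClosed.isIntegral_iff.1 h1
  rw [← hz]
  exact z.2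

/-- An algebraic number all of whose conjugates are integral at `v` is a quotient of an algebraic
integer by an integer prime to `v`. -/
theorem exists_smul_isIntegral (y : AlgebraicClosure F)
    (h : ∀ ω : Gal(AlgebraicClosure F/F), IsIntegral (v.adicCompletionIntegers F) (i (ω y))) :
    ∃ s : 𝓞 F, s ∉ v.asIdeal ∧ IsIntegral (𝓞 F) (algebraMap (𝓞 F) _ s * y) := by
  have hy : IsIntegral F y := Algebra.IsIntegral.isIntegral y
  let p := minpoly F y
  have hp : p.Monic := minpoly.monic hy
  -- The roots of the minimal polynomial are the conjugates ω y, all integral at v by hypothesis, so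
  -- the coefficients are integral at v; they lie in F.
  have hcoeff (n : ℕ) : v.valuation F (p.coeff n) ≤ 1 := by
    rw [← HeightOneSpectrum.valuedAdicCompletion_eq_valuation']
    change _ ∈ v.adicCompletionIntegers F
    apply mem_adicCompletionIntegers_of_isIntegral
    have hs : (p.map (algebraMap F (AlgebraicClosure F))).Splits :=
      IsAlgClosed.splits _
    have h2 := Polynomial.isIntegral_coeff_of_factors (R := v.adicCompletionIntegers F)
      ((p.map (algebraMap F (AlgebraicClosure F))).map (i : AlgebraicClosure F →+* AlgebraicClosure (v.adicCompletion F)))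
      (by rw [((hp.map _).map _).leadingCoeff]; exact isIntegral_one) (hs.map _) (fun x hx => by
        have hx' : x ∈ ((p.map (algebraMap F (AlgebraicClosure F))).map
            (i : AlgebraicClosure F →+* AlgebraicClosure (v.adicCompletion F))).roots :=
          (Polynomial.mem_roots ((hp.map _).map _).ne_zero).2 hx
        rw [hs.roots_map] at hx'
        obtain ⟨r, hr, rfl⟩ := Multiset.mem_map.1 hx'
        have hr' : Polynomial.aeval r p = 0 := by
          have := (Polynomial.mem_roots (hp.map _).ne_zero).1 hr
          rwa [Polynomial.IsRoot, Polynomial.eval_map_algebraMap] at this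
        obtain ⟨ω, rfl⟩ := minpoly.exists_algEquiv_of_root' hy.isAlgebraic hr'
        exact h ω) n
    rw [Polynomial.coeff_map, Polynomial.coeff_map] at h2
    have h3 : (i : AlgebraicClosure F →+* AlgebraicClosure (v.adicCompletion F))
        (algebraMap F (AlgebraicClosure F) (p.coeff n)) = algebraMap (v.adicCompletion F) _
          (algebraMap F (v.adicCompletion F) (p.coeff n)) := i.commutes _
    rw [h3] at h2
    exact h2
  -- V is the localisation of O_F at v; clearing denominators in an integral equation over V yields
  -- the factor s.
  let V := HeightOneSpectrum.valuationSubringAtPrime F v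
  have hV : IsIntegral V y := by
    obtain ⟨q, hq, -, hqm⟩ := Polynomial.lifts_and_degree_eq_and_monic (f := algebraMap V F) (p := p)
      ((Polynomial.lifts_iff_coeff_lifts _).2 fun n => ⟨⟨p.coeff n, by
        change _ ∈ HeightOneSpectrum.valuationSubringAtPrime F v
        rw [HeightOneSpectrum.valuationSubringAtPrime_eq_valuationSubring]
        exact hcoeff n⟩, rfl⟩) hp
    refine ⟨q, hqm, ?_⟩
    have : Polynomial.aeval y p = 0 := minpoly.aeval F y
    rw [← hq, Polynomial.aeval_map_algebraMap] at this
    exact this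
  have : @IsScalarTower (𝓞 F) V (AlgebraicClosure F) Algebra.toSMul Algebra.toSMul Algebra.toSMul :=
    IsScalarTower.of_algebraMap_eq fun _ => rfl
  obtain ⟨s, hs⟩ := IsIntegral.exists_multiple_integral_of_isLocalization v.asIdeal.primeCompl y hV
  refine ⟨s, s.2, ?_⟩
  rw [Submonoid.smul_def, Algebra.smul_def] at hs
  exact hs

variable {G : Type u} [CommGroup G]

theorem mapRingHom_resGal (ω : Gal(AlgebraicClosure (v.adicCompletion F)/v.adicCompletion F))
    (x : MonoidAlgebra (AlgebraicClosure F) G) :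
    MonoidAlgebra.mapRingHom G (ω : AlgebraicClosure (v.adicCompletion F) →+*
      AlgebraicClosure (v.adicCompletion F))
      (MonoidAlgebra.mapRingHom G
        (i : AlgebraicClosure F →+* AlgebraicClosure (v.adicCompletion F)) x) =
    MonoidAlgebra.mapRingHom G (i : AlgebraicClosure F →+* AlgebraicClosure (v.adicCompletion F))
      (MonoidAlgebra.mapRingHom G ((resGal (v.adicCompletion F) i ω : Gal(AlgebraicClosure F/F)) :
        AlgebraicClosure F →+* AlgebraicClosure F) x) := by
  ext t
  simp only [MonoidAlgebra.coeff_mapRingHom]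
  exact (resGal_commutes i ω _).symm

theorem exists_mapRingHom_eq_of_fixed {K C : Type u} [Field K] [Field C] [Algebra K C]
    [IsGalois K C] [Fintype G] (β : MonoidAlgebra C G)
    (h : ∀ ω : Gal(C/K), MonoidAlgebra.mapRingHom G (ω : C →+* C) β = β) :
    ∃ α : MonoidAlgebra K G, algebraMap _ _ α = β := by
  refine mem_range_algebraMap_monoidAlgebra β fun t => ?_
  rw [InfiniteGalois.mem_range_algebraMap_iff_fixed]
  intro ω
  have := congrArg (fun x => MonoidAlgebra.coeff x t) (h ω)
  simpa [MonoidAlgebra.coeff_mapRingHom] using this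

theorem mapRingHom_algebraMap {K C : Type u} [Field K] [Field C] [Algebra K C]
    (ω : Gal(C/K)) (α : MonoidAlgebra K G) :
    MonoidAlgebra.mapRingHom G (ω : C →+* C) (algebraMap _ _ α) = algebraMap _ _ α := by
  ext t
  simp [MonoidAlgebra.algebraMap_def, MonoidAlgebra.coeff_mapRingHom]

variable [Fintype G] (π : H1 F (AlgebraicClosure F) G)

/-- Automorphisms over F_v act on the image of i through `resGal`, which also defines the
restriction of π, so both conditions of `H1.mem_range_resolvend` carry over. -/
theorem map_resolvend_mem_range (a : π.Integers (𝓞 F)) :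
    MonoidAlgebra.mapRingHom G (i : AlgebraicClosure F →+* AlgebraicClosure (v.adicCompletion F))
      (π.resolvend (𝓞 F) a) ∈
      LinearMap.range ((π.res (v.adicCompletion F) i).resolvend (v.adicCompletionIntegers F)) := by
  rw [H1.mem_range_resolvend]
  obtain ⟨h1, h2⟩ := (H1.mem_range_resolvend (𝓞 F) π _).1 ⟨a, rfl⟩
  refine ⟨fun ω => ?_, fun t => ?_⟩
  · rw [mapRingHom_resGal, h1, map_mul, MonoidAlgebra.mapRingHom_single, map_one]
    rfl
  · rw [MonoidAlgebra.coeff_mapRingHom]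
    have h3 : IsIntegral (𝓞 F) (i ((π.resolvend (𝓞 F) a).coeff t)) :=
      (h2 t).map (i.restrictScalars (𝓞 F))
    exact h3.tower_top

/-- An equivariant element that is integral at `v` lies in the lattice of resolvends up to a factor
prime to `v`. -/
theorem exists_mul_mem_range_resolvend (z : MonoidAlgebra (AlgebraicClosure F) G)
    (hzω : ∀ ω : Gal(AlgebraicClosure F/F), MonoidAlgebra.mapRingHom G
      (ω : AlgebraicClosure F →+* AlgebraicClosure F) z = single (π.toHom ω) 1 * z)
    (hzint : ∀ t, IsIntegral (v.adicCompletionIntegers F) (i (z.coeff t))) :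
    ∃ S : 𝓞 F, S ∉ v.asIdeal ∧
      single 1 (algebraMap (𝓞 F) _ S) * z ∈ LinearMap.range (π.resolvend (𝓞 F)) := by
  have hconj (ω : Gal(AlgebraicClosure F/F)) (t : G) :
      ω (z.coeff t) = z.coeff ((π.toHom ω)⁻¹ * t) := by
    have := congrArg (fun x => MonoidAlgebra.coeff x t) (hzω ω)
    simpa [MonoidAlgebra.coeff_mapRingHom] using this
  choose s hs hsz using fun t => exists_smul_isIntegral v i (z.coeff t) fun ω => by
    rw [hconj]
    exact hzint _
  let S := ∏ t, s t
  have hS : S ∉ v.asIdeal := fun h => by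
    obtain ⟨t, -, ht⟩ := (Ideal.IsPrime.prod_mem_iff (p := v.asIdeal)).1 h
    exact hs t ht
  let c : MonoidAlgebra (AlgebraicClosure F) G := single 1 (algebraMap (𝓞 F) _ S)
  have hSz : c * z ∈ LinearMap.range (π.resolvend (𝓞 F)) := by
    rw [H1.mem_range_resolvend]
    refine ⟨fun ω => ?_, fun t => ?_⟩
    · rw [map_mul, hzω, mul_left_comm, MonoidAlgebra.mapRingHom_single]
      congr 3
      exact ω.commutes (S : F)
    · have h1 : (c * z).coeff t = algebraMap (𝓞 F) _ S * z.coeff t := by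
        simp [c]
      classical
      rw [h1, show S = (∏ t' ∈ Finset.univ.erase t, s t') * s t from
        (Finset.prod_erase_mul _ _ (Finset.mem_univ t)).symm, map_mul, mul_assoc]
      exact isIntegral_algebraMap.mul (hsz t)
  exact ⟨S, hS, hSz⟩

/-- The ring of integers of the localisation of a Galois algebra is generated by the ring of
integers of the algebra. -/
theorem span_map_resolvend :
    Submodule.span (MonoidAlgebra (v.adicCompletionIntegers F) G)
      (MonoidAlgebra.mapRingHom G (i : AlgebraicClosure F →+* AlgebraicClosure (v.adicCompletion F)) ''
        Set.range (π.resolvend (𝓞 F))) =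
      LinearMap.range ((π.res (v.adicCompletion F) i).resolvend (v.adicCompletionIntegers F)) := by
  let ι := MonoidAlgebra.mapRingHom G
    (i : AlgebraicClosure F →+* AlgebraicClosure (v.adicCompletion F))
  apply le_antisymm
  · rw [Submodule.span_le]
    rintro _ ⟨_, ⟨a, rfl⟩, rfl⟩
    exact map_resolvend_mem_range v i π a
  intro y hy
  -- A global resolvend that is a unit trivialises the Galois action: the quotient of y by its image
  -- is fixed by Ω_{F_v}, hence has coefficients in F_v.
  obtain ⟨a, u, hu⟩ := π.exists_isUnit_resolvend (𝓞 F)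
  obtain ⟨hy1, hy2⟩ := (H1.mem_range_resolvend _ _ _).1 hy
  obtain ⟨hu1, hu2⟩ := (H1.mem_range_resolvend _ _ _).1 (map_resolvend_mem_range v i π a)
  change ∀ ω, MonoidAlgebra.mapRingHom G _ (ι _) = _ * (ι _) at hu1
  change ∀ t, IsIntegral _ ((ι _).coeff t) at hu2
  rw [← hu] at hu1 hu2
  obtain ⟨β, hβ⟩ : ∃ β, β * ι u = y := ⟨y * ι (u⁻¹ : (MonoidAlgebra (AlgebraicClosure F) G)ˣ), by
    rw [mul_assoc, ← map_mul, Units.inv_mul, map_one, mul_one]⟩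
  obtain ⟨α, rfl⟩ := exists_mapRingHom_eq_of_fixed (K := v.adicCompletion F) β fun ω => by
    have h := congrArg (MonoidAlgebra.mapRingHom G (ω : AlgebraicClosure (v.adicCompletion F) →+*
      AlgebraicClosure (v.adicCompletion F))) hβ
    rw [map_mul, hu1, hy1, ← hβ, mul_left_comm] at h
    have hs : IsUnit (single ((π.res (v.adicCompletion F) i).toHom ω) 1 :
        MonoidAlgebra (AlgebraicClosure (v.adicCompletion F)) G) :=
      IsUnit.of_mul_eq_one (single ((π.res (v.adicCompletion F) i).toHom ω)⁻¹ 1) (by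
        rw [MonoidAlgebra.single_mul_single, mul_inv_cancel, one_mul, MonoidAlgebra.one_def])
    exact (u.isUnit.map ι).mul_right_cancel (hs.mul_left_cancel h)
  -- Since F is dense in F_v, α = α₀ + δ with α₀ over F and δ over O_{F_v}. The δ part lies in the
  -- span of the image of u; the remainder z = α₀u is global, equivariant and integral at v.
  choose k hk using fun t => exists_sub_mem_adicCompletionIntegers v (α.coeff t)
  let α₀ : MonoidAlgebra F G := ∑ t, single t (k t)
  let δ : MonoidAlgebra (v.adicCompletionIntegers F) G := ∑ t, single t ⟨_, hk t⟩
  let z := algebraMap (MonoidAlgebra F G) (MonoidAlgebra (AlgebraicClosure F) G) α₀ * u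
  have hz : y = δ • ι u + ι z := by
    rw [← hβ, Algebra.smul_def, map_mul, ← add_mul]
    congr 1
    classical
    ext t
    simp [δ, α₀, ι, MonoidAlgebra.algebraMap_def, Finsupp.single_apply]
    exact (sub_add_cancel (algebraMap (v.adicCompletion F)
      (AlgebraicClosure (v.adicCompletion F)) (α.coeff t)) _).symm.trans
      (congrArg₂ (· + ·) (map_sub _ _ _).symm rfl)
  have huS : ι u ∈ Submodule.span (MonoidAlgebra (v.adicCompletionIntegers F) G)
      (ι '' Set.range (π.resolvend (𝓞 F))) :=
    Submodule.subset_span ⟨_, ⟨a, rfl⟩, by rw [hu]⟩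
  rw [hz]
  refine add_mem (Submodule.smul_mem _ _ huS) ?_
  have hzint (t : G) : IsIntegral (v.adicCompletionIntegers F) (i (z.coeff t)) := by
    have h1 : ι z ∈ LinearMap.range
        ((π.res (v.adicCompletion F) i).resolvend (v.adicCompletionIntegers F)) := by
      rw [← sub_eq_iff_eq_add'.2 hz]
      refine sub_mem hy (Submodule.smul_mem _ _ ?_)
      rw [hu]
      exact map_resolvend_mem_range v i π a
    have := ((H1.mem_range_resolvend _ _ _).1 h1).2 t
    rwa [MonoidAlgebra.coeff_mapRingHom] at this
  have hzω (ω : Gal(AlgebraicClosure F/F)) : MonoidAlgebra.mapRingHom G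
      (ω : AlgebraicClosure F →+* AlgebraicClosure F) z = single (π.toHom ω) 1 * z := by
    rw [map_mul, mapRingHom_algebraMap, hu, H1.map_resolvend, mul_left_comm]
    rw [← hu]
  -- S moves z into the global lattice at all other places, and it is harmless at v because it is a
  -- unit of O_{F_v}.
  obtain ⟨S, hS, hSz⟩ := exists_mul_mem_range_resolvend v i π z hzω hzint
  let c : MonoidAlgebra (AlgebraicClosure F) G := single 1 (algebraMap (𝓞 F) _ S)
  obtain ⟨w, hw⟩ := isUnit_algebraMap_adicCompletionIntegers v hS
  obtain ⟨b, hb⟩ := hSz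
  have hfin : ι z = (single 1 (w⁻¹ : (v.adicCompletionIntegers F)ˣ).1 :
      MonoidAlgebra (v.adicCompletionIntegers F) G) • ι (c * z) := by
    have h1 : ι c = algebraMap (MonoidAlgebra (v.adicCompletionIntegers F) G) _ (single 1 w.1) := by
      rw [MonoidAlgebra.algebraMap_def, MonoidAlgebra.mapRingHom_single,
        MonoidAlgebra.mapRingHom_single, hw]
      congr 1
      exact i.commutes (S : F)
    rw [map_mul ι c z, h1, Algebra.smul_def, ← mul_assoc, ← map_mul, MonoidAlgebra.single_mul_single,
      Units.inv_mul, one_mul, ← MonoidAlgebra.one_def, map_one, one_mul]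
  rw [hfin]
  exact Submodule.smul_mem _ _ (Submodule.subset_span ⟨_, ⟨b, rfl⟩, by rw [hb]⟩)

end LocalIntegers

end RelativeK

/-! ### Augmentation, and the local nature of tameness -/

namespace GaloisAlg

open scoped AlgebraMonoidAlgebra
open MonoidAlgebra (single)

section Augmentation

variable {R S G : Type u} [CommRing R] [CommRing S] [CommGroup G]

/-- The augmentation of a group ring. -/
def aug (R G : Type u) [CommRing R] [CommGroup G] : MonoidAlgebra R G →+* R :=
  (MonoidAlgebra.lift R R G (1 : G →* R) : MonoidAlgebra R G →ₐ[R] R)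

theorem aug_apply [Fintype G] (x : MonoidAlgebra R G) : aug R G x = ∑ t, x.coeff t := by
  simp [aug, MonoidAlgebra.lift_apply, Finsupp.sum_fintype]

theorem aug_mapRingHom [Fintype G] (f : R →+* S) (x : MonoidAlgebra R G) :
    aug S G (MonoidAlgebra.mapRingHom G f x) = f (aug R G x) := by
  simp [aug_apply, MonoidAlgebra.coeff_mapRingHom]

theorem H1.sum_toFun (R : Type u) {K C G : Type u} [CommRing R] [Field K] [Field C] [Algebra R K]
    [Algebra K C] [Algebra R C] [IsScalarTower R K C] [CommGroup G] [Fintype G] (π : H1 K C G)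
    (a : π.Integers R) : ∑ γ, π.toFun R a γ = aug C G (π.resolvend R a) := by
  rw [aug_apply, H1.resolvend_apply]
  simp only [coeff_resolvend]
  exact (Equiv.sum_comp (Equiv.inv G) _).symm

end Augmentation

end GaloisAlg

namespace RelativeK

open scoped AlgebraMonoidAlgebra
open MonoidAlgebra (single)
open IsDedekindDomain NumberField GaloisAlg

section Tame

variable {F : Type u} [Field F] [NumberField F] {G : Type u} [CommGroup G] [Fintype G]
  (π : H1 F (AlgebraicClosure F) G)

theorem isTame_res (h : π.IsTame (𝓞 F)) (v : HeightOneSpectrum (𝓞 F))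
    (i : AlgebraicClosure F →ₐ[F] AlgebraicClosure (v.adicCompletion F)) :
    (π.res (v.adicCompletion F) i).IsTame (v.adicCompletionIntegers F) := by
  rw [H1.isTame_iff _ (finite_quotient_ringOfIntegers F)] at h
  rw [H1.isTame_iff _ (finite_quotient_adicCompletionIntegers F v)]
  obtain ⟨z, hz⟩ := h
  obtain ⟨z', hz'⟩ := map_resolvend_mem_range v i π z
  refine ⟨z', ?_⟩
  rw [H1.sum_toFun] at hz ⊢
  rw [hz', aug_mapRingHom, hz, map_one]

/-- The traces of elements of O_π form an ideal of O_F. Were it contained in the prime of v, all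
local traces would lie in the maximal ideal of O_{F_v}, since global resolvends span the local ones;
but some local trace is 1. -/
theorem isTame_of_forall_res (i : ∀ v : HeightOneSpectrum (𝓞 F),
      AlgebraicClosure F →ₐ[F] AlgebraicClosure (v.adicCompletion F))
    (h : ∀ v, (π.res (v.adicCompletion F) (i v)).IsTame (v.adicCompletionIntegers F)) :
    π.IsTame (𝓞 F) := by
  rw [H1.isTame_iff _ (finite_quotient_ringOfIntegers F)]
  let T : π.Integers (𝓞 F) →ₗ[𝓞 F] AlgebraicClosure F :=
    { toFun a := ∑ γ, π.toFun (𝓞 F) a γ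
      map_add' a b := by simp [H1.toFun_add, Finset.sum_add_distrib]
      map_smul' r a := by simp [H1.toFun_smul, Finset.smul_sum] }
  let I : Ideal (𝓞 F) := (LinearMap.range T).comap (Algebra.linearMap (𝓞 F) (AlgebraicClosure F))
  have hI (a : π.Integers (𝓞 F)) : ∃ r ∈ I, algebraMap (𝓞 F) _ r = T a := by
    have h1 : T a ∈ Set.range (algebraMap F (AlgebraicClosure F)) := by
      rw [InfiniteGalois.mem_range_algebraMap_iff_fixed]
      intro ω
      change ω (∑ γ, π.toFun (𝓞 F) a γ) = ∑ γ, π.toFun (𝓞 F) a γ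
      rw [map_sum]
      simp only [π.toFun_mul (𝓞 F)]
      exact Equiv.sum_comp (Equiv.mulRight (π.toHom ω)) (π.toFun (𝓞 F) a)
    obtain ⟨k, hk⟩ := h1
    have h2 : IsIntegral (𝓞 F) (T a) := IsIntegral.sum _ fun γ _ => π.isIntegral_toFun a γ
    rw [← hk] at h2
    have h3 : IsIntegral (𝓞 F) k := (isIntegral_algHom_iff
      (IsScalarTower.toAlgHom (𝓞 F) F (AlgebraicClosure F))
      (algebraMap F (AlgebraicClosure F)).injective).1 h2
    obtain ⟨r, hr⟩ := IsIntegrallyClosed.isIntegral_iff.1 h3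
    have h4 : algebraMap (𝓞 F) (AlgebraicClosure F) r = T a := by
      rw [← hk, ← hr]; rfl
    exact ⟨r, ⟨a, h4.symm⟩, h4⟩
  suffices hI : I = ⊤ by
    have : (1 : 𝓞 F) ∈ I := hI ▸ Submodule.mem_top
    obtain ⟨y, hy⟩ := this
    exact ⟨y, by rw [Algebra.linearMap_apply, map_one] at hy; exact hy⟩
  by_contra hne
  obtain ⟨p, hp, hle⟩ := Ideal.exists_le_maximal I hne
  let v : HeightOneSpectrum (𝓞 F) := ⟨p, hp.isPrime,
    Ring.ne_bot_of_isMaximal_of_not_isField hp (RingOfIntegers.not_isField F)⟩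
  obtain ⟨z, hz⟩ := (H1.isTame_iff _ (finite_quotient_adicCompletionIntegers F v) _).1 (h v)
  rw [H1.sum_toFun] at hz
  have hmem : ∃ m ∈ IsLocalRing.maximalIdeal (v.adicCompletionIntegers F),
      algebraMap _ _ m = aug _ G ((π.res (v.adicCompletion F) (i v)).resolvend
        (v.adicCompletionIntegers F) z) := by
    have := LinearMap.mem_range_self ((π.res (v.adicCompletion F) (i v)).resolvend
        (v.adicCompletionIntegers F)) z
    rw [← span_map_resolvend] at this
    generalize (π.res (v.adicCompletion F) (i v)).resolvend (v.adicCompletionIntegers F) z = x at this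
    induction this using Submodule.span_induction with
    | mem x hx =>
      obtain ⟨_, ⟨a, rfl⟩, rfl⟩ := hx
      obtain ⟨r, hr, hra⟩ := hI a
      refine ⟨algebraMap _ _ r, ?_, ?_⟩
      · rw [IsLocalRing.mem_maximalIdeal, mem_nonunits_iff,
          HeightOneSpectrum.adicCompletionIntegers.isUnit_iff_valued_eq_one]
        have h1 : r ∈ v.asIdeal := hle hr
        rw [← v.valuation_lt_one_iff_mem (K := F),
          ← HeightOneSpectrum.valuedAdicCompletion_eq_valuation'] at h1
        exact h1.ne
      · rw [aug_mapRingHom, ← H1.sum_toFun]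
        refine Eq.trans ?_ (congrArg (i v) hra)
        exact ((i v).commutes (r : F)).symm
    | zero => exact ⟨0, zero_mem _, by simp⟩
    | add x y _ _ hx hy =>
      obtain ⟨m, hm, hmx⟩ := hx
      obtain ⟨n, hn, hny⟩ := hy
      exact ⟨m + n, add_mem hm hn, by rw [map_add, map_add, hmx, hny]⟩
    | smul d x _ hx =>
      obtain ⟨m, hm, hmx⟩ := hx
      refine ⟨aug _ G d * m, Ideal.mul_mem_left _ _ hm, ?_⟩
      rw [Algebra.smul_def, map_mul, map_mul, hmx, MonoidAlgebra.algebraMap_def, aug_mapRingHom]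
  obtain ⟨m, hm, hm1⟩ := hmem
  rw [hz] at hm1
  have : m = 1 := Subtype.val_injective ((algebraMap (v.adicCompletion F)
    (AlgebraicClosure (v.adicCompletion F))).injective (hm1.trans (map_one _).symm))
  rw [this] at hm
  exact (Ideal.ne_top_iff_one _).1 (IsLocalRing.maximalIdeal.isMaximal _).ne_top hm

/-- Take a global resolvend u that is a unit. The finitely many coefficients of its inverse are
integral at almost all places, and there `H1.isUnramified_of_mul_eq_one` applies. -/
theorem eventually_isUnramified_res (i : ∀ v : HeightOneSpectrum (𝓞 F),
      AlgebraicClosure F →ₐ[F] AlgebraicClosure (v.adicCompletion F)) :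
    ∀ᶠ v in Filter.cofinite,
      (π.res (v.adicCompletion F) (i v)).IsUnramified (v.adicCompletionIntegers F) := by
  obtain ⟨a, u, hu⟩ := π.exists_isUnit_resolvend (𝓞 F)
  have := Filter.eventually_all.2 fun t => eventually_isIntegral i ((u⁻¹).1.coeff t)
  filter_upwards [this] with v hv
  obtain ⟨b, hb⟩ := map_resolvend_mem_range v (i v) π a
  refine H1.isUnramified_of_mul_eq_one _ (finite_quotient_adicCompletionIntegers F v) _ b
    (MonoidAlgebra.mapRingHom G
      (i v : AlgebraicClosure F →+* AlgebraicClosure (v.adicCompletion F)) (u⁻¹).1) (fun t => ?_) ?_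
  · rw [MonoidAlgebra.coeff_mapRingHom]
    exact hv t
  · rw [hb, ← hu, ← map_mul, Units.mul_inv, map_one]

end Tame

end RelativeK

/-! ### Relative K-groups: isomorphisms, direct sums and rank one classes -/

namespace RelativeK

section Basic

open TensorProduct.AlgebraTensorModule

variable {A B : Type u} [CommRing A] [CommRing B] [Algebra A B]

variable (A B) in
/-- The zero twisted form. -/
def zeroForm : TwistedForm A B := ⟨PUnit, PUnit, LinearEquiv.refl B _⟩

theorem subsingleton_tensor_punit : Subsingleton (B ⊗[A] PUnit.{u + 1}) :=
  ⟨fun x y => by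
    have h (x : B ⊗[A] PUnit.{u + 1}) : x = 0 := by
      induction x using TensorProduct.induction_on with
      | zero => rfl
      | add x y hx hy => rw [hx, hy, add_zero]
      | tmul b y => rw [Subsingleton.elim y 0, TensorProduct.tmul_zero]
    rw [h x, h y]⟩

/-- The zero form is an extension of itself by itself, so its class equals its own double. -/
theorem zeroForm_cls : (zeroForm A B).cls = 0 := by
  have hs : Subsingleton (B ⊗[A] (zeroForm A B).N) := subsingleton_tensor_punit
  have h0 : Subsingleton (zeroForm A B).M := inferInstanceAs (Subsingleton PUnit)
  have h1 : Subsingleton (zeroForm A B).N := inferInstanceAs (Subsingleton PUnit)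
  have h : (zeroForm A B).ShortExact (zeroForm A B) (zeroForm A B) :=
    { f := 0, g := 0, f' := 0, g' := 0
      f_injective := fun _ _ _ => Subsingleton.elim _ _
      exact := fun x => ⟨fun _ => ⟨x, Subsingleton.elim _ _⟩, fun _ => Subsingleton.elim _ _⟩
      g_surjective := fun x => ⟨x, Subsingleton.elim _ _⟩
      f'_injective := fun _ _ _ => Subsingleton.elim _ _
      exact' := fun x => ⟨fun _ => ⟨x, Subsingleton.elim _ _⟩, fun _ => Subsingleton.elim _ _⟩
      g'_surjective := fun x => ⟨x, Subsingleton.elim _ _⟩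
      comm_left := fun _ => Subsingleton.elim _ _
      comm_right := fun _ => Subsingleton.elim _ _ }
  exact left_eq_add.1 (TwistedForm.cls_exact h)

theorem eq_of_eq_one_tmul {M P : Type u} [AddCommGroup M] [Module A M] [AddCommGroup P] [Module B P]
    [Module A P] [IsScalarTower A B P] (f g : B ⊗[A] M →ₗ[B] P) (h : ∀ m, f (1 ⊗ₜ m) = g (1 ⊗ₜ m)) : f = g := by
  apply TensorProduct.AlgebraTensorModule.curry_injective
  exact LinearMap.ext_ring (LinearMap.ext h)

/-- Isomorphic twisted forms have the same class. -/
theorem cls_congr (X Y : TwistedForm A B) (e : X.M ≃ₗ[A] Y.M) (e' : X.N ≃ₗ[A] Y.N)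
    (h : ∀ m, Y.ξ (1 ⊗ₜ e m) = e'.toLinearMap.baseChange B (X.ξ (1 ⊗ₜ m))) : X.cls = Y.cls := by
  have hs : Subsingleton (B ⊗[A] (zeroForm A B).N) := subsingleton_tensor_punit
  have h0 : Subsingleton (zeroForm A B).M := inferInstanceAs (Subsingleton PUnit)
  have h1 : Subsingleton (zeroForm A B).N := inferInstanceAs (Subsingleton PUnit)
  -- An isomorphism is a short exact sequence with zero cokernel.
  have hX : X.ShortExact Y (zeroForm A B) :=
    { f := e, g := 0, f' := e', g' := 0
      f_injective := e.injective
      exact := fun x => ⟨fun _ => e.surjective x, fun _ => Subsingleton.elim _ _⟩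
      g_surjective := fun x => ⟨0, Subsingleton.elim _ _⟩
      f'_injective := e'.injective
      exact' := fun x => ⟨fun _ => e'.surjective x, fun _ => Subsingleton.elim _ _⟩
      g'_surjective := fun x => ⟨0, Subsingleton.elim _ _⟩
      comm_left := fun x => by
        have := eq_of_eq_one_tmul (Y.ξ.toLinearMap ∘ₗ e.toLinearMap.baseChange B)
          (e'.toLinearMap.baseChange B ∘ₗ X.ξ.toLinearMap) (fun m => by simpa using h m)
        exact LinearMap.congr_fun this x
      comm_right := fun _ => Subsingleton.elim _ _ }
  rw [TwistedForm.cls_exact hX, zeroForm_cls, add_zero]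

/-- The direct sum of two isomorphisms over `B`. -/
def prodIso {M N M' N' : Type u} [AddCommGroup M] [AddCommGroup N] [AddCommGroup M']
    [AddCommGroup N'] [Module A M] [Module A N] [Module A M'] [Module A N']
    (ξ : B ⊗[A] M ≃ₗ[B] B ⊗[A] N) (η : B ⊗[A] M' ≃ₗ[B] B ⊗[A] N') :
    B ⊗[A] (M × M') ≃ₗ[B] B ⊗[A] (N × N') :=
  TensorProduct.prodRight A B B M M' ≪≫ₗ ξ.prodCongr η ≪≫ₗ (TensorProduct.prodRight A B B N N').symm

theorem prodRight_inl {N N' : Type u} [AddCommGroup N] [AddCommGroup N'] [Module A N]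
    [Module A N'] (x : B ⊗[A] N) :
    TensorProduct.prodRight A B B N N' ((LinearMap.inl A N N').baseChange B x) = (x, 0) :=
  LinearMap.congr_fun (eq_of_eq_one_tmul ((TensorProduct.prodRight A B B N N').toLinearMap ∘ₗ
    (LinearMap.inl A N N').baseChange B) (LinearMap.inl B _ _) fun m => by simp) x

theorem prodRight_inr {N N' : Type u} [AddCommGroup N] [AddCommGroup N'] [Module A N]
    [Module A N'] (x : B ⊗[A] N') :
    TensorProduct.prodRight A B B N N' ((LinearMap.inr A N N').baseChange B x) = (0, x) :=
  LinearMap.congr_fun (eq_of_eq_one_tmul ((TensorProduct.prodRight A B B N N').toLinearMap ∘ₗ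
    (LinearMap.inr A N N').baseChange B) (LinearMap.inr B _ _) fun m => by simp) x

theorem prodRight_snd {N N' : Type u} [AddCommGroup N] [AddCommGroup N'] [Module A N]
    [Module A N'] (x : B ⊗[A] (N × N')) :
    (LinearMap.snd A N N').baseChange B x = (TensorProduct.prodRight A B B N N' x).2 :=
  LinearMap.congr_fun (eq_of_eq_one_tmul ((LinearMap.snd A N N').baseChange B)
    (LinearMap.snd B _ _ ∘ₗ (TensorProduct.prodRight A B B N N').toLinearMap) fun m => by simp) x

theorem prodRight_fst {N N' : Type u} [AddCommGroup N] [AddCommGroup N'] [Module A N]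
    [Module A N'] (x : B ⊗[A] (N × N')) :
    (LinearMap.fst A N N').baseChange B x = (TensorProduct.prodRight A B B N N' x).1 :=
  LinearMap.congr_fun (eq_of_eq_one_tmul ((LinearMap.fst A N N').baseChange B)
    (LinearMap.fst B _ _ ∘ₗ (TensorProduct.prodRight A B B N N').toLinearMap) fun m => by simp) x

theorem prodRight_symm_apply {N N' : Type u} [AddCommGroup N] [AddCommGroup N'] [Module A N]
    [Module A N'] (x : B ⊗[A] N) (y : B ⊗[A] N') :
    (TensorProduct.prodRight A B B N N').symm (x, y) =
      (LinearMap.inl A N N').baseChange B x + (LinearMap.inr A N N').baseChange B y := by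
  rw [LinearEquiv.symm_apply_eq, map_add, prodRight_inl, prodRight_inr]
  simp

section

variable {M N P M' N' P' : Type u} [AddCommGroup M] [AddCommGroup N] [AddCommGroup M']
    [AddCommGroup N'] [AddCommGroup P] [AddCommGroup P'] [Module A M] [Module A N] [Module A M']
    [Module A N'] [Module A P] [Module A P']

theorem prodIso_apply (ξ : B ⊗[A] M ≃ₗ[B] B ⊗[A] N) (η : B ⊗[A] M' ≃ₗ[B] B ⊗[A] N')
    (x : B ⊗[A] (M × M')) : TensorProduct.prodRight A B B N N' (prodIso ξ η x) =
      (ξ (TensorProduct.prodRight A B B M M' x).1, η (TensorProduct.prodRight A B B M M' x).2) := by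
  simp [prodIso]

theorem prodIso_one_tmul (ξ : B ⊗[A] M ≃ₗ[B] B ⊗[A] N) (η : B ⊗[A] M' ≃ₗ[B] B ⊗[A] N')
    (m : M) (m' : M') : prodIso ξ η (1 ⊗ₜ (m, m')) =
      (LinearMap.inl A N N').baseChange B (ξ (1 ⊗ₜ m)) +
        (LinearMap.inr A N N').baseChange B (η (1 ⊗ₜ m')) := by
  rw [← prodRight_symm_apply]
  simp [prodIso]

variable [Module.Finite A M] [Module.Finite A N] [Module.Finite A M'] [Module.Finite A N']
  [Module.Finite A P]
  [Module.Projective A M] [Module.Projective A N] [Module.Projective A M'] [Module.Projective A N']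
  [Module.Projective A P]

theorem cls_prod (ξ : B ⊗[A] M ≃ₗ[B] B ⊗[A] N) (η : B ⊗[A] M' ≃ₗ[B] B ⊗[A] N') :
    TwistedForm.cls ⟨M × M', N × N', prodIso ξ η⟩ =
      TwistedForm.cls ⟨M, N, ξ⟩ + TwistedForm.cls ⟨M', N', η⟩ := by
  refine TwistedForm.cls_exact (X := ⟨M, N, ξ⟩) (Z := ⟨M', N', η⟩)
    { f := LinearMap.inl A M M'
      g := LinearMap.snd A M M'
      f' := LinearMap.inl A N N'
      g' := LinearMap.snd A N N'
      f_injective := LinearMap.inl_injective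
      exact := .inl_snd
      g_surjective := LinearMap.snd_surjective
      f'_injective := LinearMap.inl_injective
      exact' := .inl_snd
      g'_surjective := LinearMap.snd_surjective
      comm_left := fun x => ?_
      comm_right := fun y => ?_ }
  · apply (TensorProduct.prodRight A B B N N').injective
    rw [prodIso_apply, prodRight_inl, prodRight_inl, map_zero]
  · change η _ = _
    rw [prodRight_snd, prodRight_snd, prodIso_apply]

theorem cls_refl : TwistedForm.cls ⟨M, M, LinearEquiv.refl B (B ⊗[A] M)⟩ = 0 :=
  left_eq_add.1 (TwistedForm.cls_comp M M M (LinearEquiv.refl B _) (LinearEquiv.refl B _))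

theorem cls_symm (ξ : B ⊗[A] M ≃ₗ[B] B ⊗[A] N) :
    TwistedForm.cls ⟨N, M, ξ.symm⟩ = -TwistedForm.cls ⟨M, N, ξ⟩ := by
  rw [eq_neg_iff_add_eq_zero, ← TwistedForm.cls_comp, LinearEquiv.symm_trans_self, cls_refl]

theorem cls_baseChange (e : M ≃ₗ[A] N) (ξ : B ⊗[A] M ≃ₗ[B] B ⊗[A] N)
    (h : ∀ m, ξ (1 ⊗ₜ m) = 1 ⊗ₜ e m) : TwistedForm.cls ⟨M, N, ξ⟩ = 0 := by
  rw [← cls_refl (B := B) (M := M)]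
  symm
  refine cls_congr ⟨M, M, LinearEquiv.refl B _⟩ ⟨M, N, ξ⟩ (LinearEquiv.refl A M) e fun m => ?_
  simpa using h m

end

/-- The decomposition of a module afforded by a linear map with a section. -/
def splitEquiv {X N : Type u} [AddCommGroup X] [AddCommGroup N] [Module A X] [Module A N]
    (p : X →ₗ[A] N) (i : N →ₗ[A] X) (h : p ∘ₗ i = LinearMap.id) :
    X ≃ₗ[A] N × LinearMap.ker p where
  toFun x := (p x, ⟨x - i (p x), by
    rw [LinearMap.mem_ker, map_sub, sub_eq_zero]
    exact (LinearMap.congr_fun h (p x)).symm⟩)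
  invFun y := i y.1 + y.2
  map_add' x y := by
    refine Prod.ext (map_add _ _ _) (Subtype.ext ?_)
    simp only [map_add, Prod.mk_add_mk, Submodule.coe_add]
    abel
  map_smul' a x := by
    refine Prod.ext (map_smul _ _ _) (Subtype.ext ?_)
    simp [smul_sub]
  left_inv x := by simp
  right_inv y := by
    have h1 : p (i y.1 + y.2) = y.1 := by
      rw [map_add, LinearMap.mem_ker.1 y.2.2, add_zero]
      exact LinearMap.congr_fun h y.1
    refine Prod.ext h1 (Subtype.ext ?_)
    simp [h1]

theorem finite_projective_ker {X N : Type u} [AddCommGroup X] [AddCommGroup N] [Module A X]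
    [Module A N] [Module.Finite A X] [Module.Projective A X]
    (p : X →ₗ[A] N) (i : N →ₗ[A] X) (h : p ∘ₗ i = LinearMap.id) :
    Module.Finite A (LinearMap.ker p) ∧ Module.Projective A (LinearMap.ker p) := by
  let e := splitEquiv p i h
  constructor
  · exact Module.Finite.of_surjective (LinearMap.snd A N (LinearMap.ker p) ∘ₗ e.toLinearMap)
      (Prod.snd_surjective.comp e.surjective)
  · refine Module.Projective.of_split (e.symm.toLinearMap ∘ₗ LinearMap.inr A N (LinearMap.ker p))
      (LinearMap.snd A N (LinearMap.ker p) ∘ₗ e.toLinearMap) ?_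
    ext x
    simp

theorem exists_complement (N : Type u) [AddCommGroup N] [Module A N] [Module.Finite A N]
    [Module.Projective A N] : ∃ (n : ℕ) (Q : Type u) (_ : AddCommGroup Q) (_ : Module A Q)
    (_ : Module.Finite A Q) (_ : Module.Projective A Q), Nonempty ((N × Q) ≃ₗ[A] (Fin n → A)) := by
  obtain ⟨n, p, i, hp, hi, hpi⟩ := Module.Finite.exists_comp_eq_id_of_projective A N
  obtain ⟨h1, h2⟩ := finite_projective_ker p i hpi
  exact ⟨n, LinearMap.ker p, inferInstance, inferInstance, h1, h2, ⟨(splitEquiv p i hpi).symm⟩⟩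

/-- Every element of the relative `K`-group is the class of a twisted form whose second module is
free of positive rank. -/
theorem exists_cls_eq (x : RelK0 A B) : ∃ (n : ℕ) (M : Type u) (_ : AddCommGroup M) (_ : Module A M)
    (_ : Module.Finite A M) (_ : Module.Projective A M)
    (ξ : B ⊗[A] M ≃ₗ[B] B ⊗[A] (A × (Fin n → A))), x = TwistedForm.cls ⟨M, A × (Fin n → A), ξ⟩ := by
  have h1 : ∃ X : TwistedForm A B, x = X.cls := by
    induction x using RelK0.induction with
    | hcls X => exact ⟨X, rfl⟩
    | hzero => exact ⟨zeroForm A B, zeroForm_cls.symm⟩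
    | hneg x hx =>
      obtain ⟨⟨M, N, ξ⟩, rfl⟩ := hx
      exact ⟨⟨N, M, ξ.symm⟩, (cls_symm ξ).symm⟩
    | hadd x y hx hy =>
      obtain ⟨⟨M, N, ξ⟩, rfl⟩ := hx
      obtain ⟨⟨M', N', η⟩, rfl⟩ := hy
      exact ⟨⟨M × M', N × N', prodIso ξ η⟩, (cls_prod ξ η).symm⟩
  obtain ⟨⟨M, N, ξ⟩, rfl⟩ := h1
  obtain ⟨n, Q, _, _, _, _, ⟨e⟩⟩ := exists_complement (A := A) N
  -- Adding the identity of Q × A does not change the class. Q makes N free, and the extra copy of A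
  -- makes the rank positive, so that a summand of rank one can remain after splitting off a free
  -- module.
  let e' : (N × (Q × A)) ≃ₗ[A] A × (Fin n → A) :=
    (LinearEquiv.prodAssoc A N Q A).symm ≪≫ₗ e.prodCongr (LinearEquiv.refl A A) ≪≫ₗ
      LinearEquiv.prodComm A _ _
  refine ⟨n, M × (Q × A), inferInstance, inferInstance, inferInstance, inferInstance,
    prodIso ξ (LinearEquiv.refl B _) ≪≫ₗ LinearEquiv.baseChange A B _ _ e', ?_⟩
  rw [TwistedForm.cls_comp, cls_prod, cls_refl, cls_baseChange e', add_zero, add_zero]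
  intro m
  simp

/-- M is flat, so A ⊆ B gives M ⊆ B ⊗ M. This is what makes a rank one class a lattice inside B. -/
theorem injective_of_isBaseChange {M : Type u} [AddCommGroup M] [Module A M]
    [Module.Projective A M] {P : Type u} [AddCommGroup P] [Module A P] [Module B P]
    [IsScalarTower A B P] (hAB : Function.Injective (algebraMap A B)) (f : M →ₗ[A] P)
    (hf : IsBaseChange B f) : Function.Injective f := by
  have h1 : Function.Injective (fun m : M => (1 : B) ⊗ₜ[A] m) := by
    have h2 := Module.Flat.rTensor_preserves_injective_linearMap (M := M)
      (Algebra.linearMap A B) hAB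
    intro m m' h
    have h3 : (Algebra.linearMap A B).rTensor M ((TensorProduct.lid A M).symm m) =
        (Algebra.linearMap A B).rTensor M ((TensorProduct.lid A M).symm m') := by
      simpa using h
    exact (TensorProduct.lid A M).symm.injective (h2 h3)
  intro m m' h
  refine h1 (hf.equiv.injective ?_)
  simpa [hf.equiv_tmul] using h

theorem rankOneClass_congr {M M' : Type u} [AddCommGroup M] [Module A M] [Module.Finite A M]
    [Module.Projective A M] [AddCommGroup M'] [Module A M'] [Module.Finite A M']
    [Module.Projective A M'] (f : M →ₗ[A] B) (hf : IsBaseChange B f) (f' : M' →ₗ[A] B)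
    (hf' : IsBaseChange B f') (e : M ≃ₗ[A] M') (h : ∀ m, f' (e m) = f m) :
    rankOneClass A B M f hf = rankOneClass A B M' f' hf' := by
  refine cls_congr _ _ e (LinearEquiv.refl A A) fun m => ?_
  simp [IsBaseChange.equiv_tmul, h]

/-- The class of a rank one module depends only on the lattice that it defines. -/
theorem rankOneClass_eq_of_range_eq (hAB : Function.Injective (algebraMap A B))
    {M M' : Type u} [AddCommGroup M] [Module A M] [Module.Finite A M]
    [Module.Projective A M] [AddCommGroup M'] [Module A M'] [Module.Finite A M']
    [Module.Projective A M'] (f : M →ₗ[A] B) (hf : IsBaseChange B f) (f' : M' →ₗ[A] B)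
    (hf' : IsBaseChange B f') (h : LinearMap.range f = LinearMap.range f') :
    rankOneClass A B M f hf = rankOneClass A B M' f' hf' := by
  let i := LinearEquiv.ofInjective f (injective_of_isBaseChange hAB f hf)
  let i' := LinearEquiv.ofInjective f' (injective_of_isBaseChange hAB f' hf')
  refine rankOneClass_congr f hf f' hf' (i ≪≫ₗ LinearEquiv.ofEq _ _ h ≪≫ₗ i'.symm) fun m => ?_
  have := congrArg Subtype.val (i'.apply_symm_apply (LinearEquiv.ofEq _ _ h (i m)))
  exact this

end Basic

/-! ### Localising rank one classes -/

section Localise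

open TensorProduct.AlgebraTensorModule

variable {A B A' B' : Type u} [CommRing A] [CommRing B] [CommRing A'] [CommRing B']
  [Algebra A B] [Algebra A A'] [Algebra A B'] [Algebra B B'] [Algebra A' B'] [IsScalarTower A B B']
  [IsScalarTower A A' B']

/-- In terms of lattices, localisation takes the A'-span in B': the module A' ⊗ M maps
isomorphically onto the span of the image of f(M), and the class depends only on the lattice. -/
theorem localise_rankOneClass (hAB : Function.Injective (algebraMap A' B'))
    {M M' : Type u} [AddCommGroup M] [Module A M] [Module.Finite A M]
    [Module.Projective A M] [AddCommGroup M'] [Module A' M'] [Module.Finite A' M']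
    [Module.Projective A' M'] (f : M →ₗ[A] B) (hf : IsBaseChange B f) (f' : M' →ₗ[A'] B')
    (hf' : IsBaseChange B' f')
    (h : Submodule.span A' (algebraMap B B' '' Set.range f) = LinearMap.range f') :
    RelK0.localise A B A' B' (rankOneClass A B M f hf) = rankOneClass A' B' M' f' hf' := by
  let ξ : B ⊗[A] M ≃ₗ[B] B ⊗[A] A := hf.equiv ≪≫ₗ (TensorProduct.AlgebraTensorModule.rid A B B).symm
  have h1 : RelK0.localise A B A' B' (rankOneClass A B M f hf) =
      TwistedForm.cls ⟨A' ⊗[A] M, A' ⊗[A] A, localIso A' (extendIso B' ξ)⟩ := by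
    simp [RelK0.localise, RelK0.extendSource, RelK0.extendTarget, rankOneClass,
      TwistedForm.extendSource, TwistedForm.extendTarget, ξ]
  let e' : A' ⊗[A] A ≃ₗ[A'] A' := TensorProduct.AlgebraTensorModule.rid A A' A'
  let g₀ : M →ₗ[A] B' := (Algebra.linearMap B B').restrictScalars A ∘ₗ f
  let g : A' ⊗[A] M →ₗ[A'] B' := g₀.liftBaseChange A'
  have hg₀ : IsBaseChange B' g₀ := hf.comp (IsBaseChange.linearMap B B')
  -- M is projective, so A' ⊗ M embeds in B' ⊗ M, which is identified with B'.
  have hg : Function.Injective g := by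
    have h2 : (g : A' ⊗[A] M → B') = hg₀.equiv ∘ extendMap A A' B' M := by
      funext y
      induction y using TensorProduct.induction_on with
      | zero => simp
      | add x y hx hy =>
        simp only [Function.comp_apply] at hx hy ⊢
        rw [map_add, map_add, map_add, hx, hy]
      | tmul a m => simp [g, extendMap, hg₀.equiv_tmul, Algebra.smul_def]
    rw [h2]
    exact hg₀.equiv.injective.comp (extendMap_injective M hAB)
  have hrange : LinearMap.range g = LinearMap.range f' := by
    rw [← h]
    apply le_antisymm
    · rintro _ ⟨y, rfl⟩
      induction y using TensorProduct.induction_on with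
      | zero => simp
      | add x y hx hy => rw [map_add]; exact add_mem hx hy
      | tmul a m =>
        have : g (a ⊗ₜ m) = a • algebraMap B B' (f m) := by simp [g, g₀]
        rw [this]
        exact Submodule.smul_mem _ _ (Submodule.subset_span ⟨_, ⟨m, rfl⟩, rfl⟩)
    · rw [Submodule.span_le]
      rintro _ ⟨_, ⟨m, rfl⟩, rfl⟩
      exact ⟨1 ⊗ₜ m, by simp [g, g₀]⟩
  let i := LinearEquiv.ofInjective g hg
  let i' := LinearEquiv.ofInjective f' (injective_of_isBaseChange hAB f' hf')
  let e : A' ⊗[A] M ≃ₗ[A'] M' := i ≪≫ₗ LinearEquiv.ofEq _ _ hrange ≪≫ₗ i'.symm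
  have he (y) : f' (e y) = g y :=
    congrArg Subtype.val (i'.apply_symm_apply (LinearEquiv.ofEq _ _ hrange (i y)))
  rw [h1]
  refine cls_congr _ _ e e' fun y => ?_
  apply (TensorProduct.AlgebraTensorModule.rid A' B' B').injective
  have h3 : (TensorProduct.AlgebraTensorModule.rid A' B' B') ((hf'.equiv ≪≫ₗ
      (TensorProduct.AlgebraTensorModule.rid A' B' B').symm) (1 ⊗ₜ[A'] e y)) = g y := by
    simp [hf'.equiv_tmul, he]
  refine h3.trans ?_
  change g y = (TensorProduct.AlgebraTensorModule.rid A' B' B') (e'.toLinearMap.baseChange B'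
    (localIso A' (extendIso B' ξ) (1 ⊗ₜ[A'] y)))
  have h4 (m : M) : localIso A' (extendIso B' ξ) (1 ⊗ₜ[A'] (1 ⊗ₜ[A] m)) =
      algebraMap B B' (f m) ⊗ₜ (1 ⊗ₜ 1) := by
    rw [localIso_extendIso_one_tmul]
    simp only [ξ, LinearEquiv.trans_apply, hf.equiv_tmul, one_smul,
      TensorProduct.AlgebraTensorModule.rid_symm_apply]
    change (cancelBaseChange A A' B' B' A).symm (cancelBaseChange A B B' B' A _) = _
    rw [LinearEquiv.symm_apply_eq]
    simp [Algebra.smul_def]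
  induction y using TensorProduct.induction_on with
  | zero => simp
  | add x y hx hy =>
    rw [TensorProduct.tmul_add, map_add, map_add, map_add, map_add, hx, hy] <;>
      simp [hf'.equiv_tmul, he]
  | tmul a m =>
    have h5 : (1 : B') ⊗ₜ[A'] (a ⊗ₜ[A] m : A' ⊗[A] M) =
        algebraMap A' B' a • ((1 : B') ⊗ₜ[A'] (1 ⊗ₜ[A] m : A' ⊗[A] M)) := by
      rw [algebraMap_smul, ← TensorProduct.tmul_smul, TensorProduct.smul_tmul', smul_eq_mul,
        mul_one]
    rw [h5, map_smul, map_smul, map_smul, h4]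
    simp [g, g₀, e', Algebra.smul_def]

end Localise

end RelativeK

namespace RelativeK

open scoped AlgebraMonoidAlgebra
open MonoidAlgebra (single)
open IsDedekindDomain NumberField GaloisAlg

section LocalisePsi

variable {F : Type u} [Field F] [NumberField F] {G : Type u} [CommGroup G] [Fintype G]

theorem algebraMap_monoidAlgebra_local_injective (v : HeightOneSpectrum (𝓞 F)) :
    Function.Injective (algebraMap (MonoidAlgebra (v.adicCompletionIntegers F) G)
      (MonoidAlgebra (AlgebraicClosure (v.adicCompletion F)) G)) :=
  algebraMap_monoidAlgebra_injective fun x y h => Subtype.val_injective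
    ((algebraMap (v.adicCompletion F) (AlgebraicClosure (v.adicCompletion F))).injective h)

theorem algebraMap_monoidAlgebra_global_injective :
    Function.Injective (algebraMap (MonoidAlgebra (𝓞 F) G) (MonoidAlgebra (AlgebraicClosure F) G)) :=
  algebraMap_monoidAlgebra_injective fun x y h => RingOfIntegers.coe_injective
    ((algebraMap F (AlgebraicClosure F)).injective h)

theorem lambdaLocal_rankOneClass (v : HeightOneSpectrum (𝓞 F))
    (i : AlgebraicClosure F →ₐ[F] AlgebraicClosure (v.adicCompletion F))
    {M M' : Type u} [AddCommGroup M] [Module (MonoidAlgebra (𝓞 F) G) M]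
    [Module.Finite (MonoidAlgebra (𝓞 F) G) M] [Module.Projective (MonoidAlgebra (𝓞 F) G) M]
    [AddCommGroup M'] [Module (MonoidAlgebra (v.adicCompletionIntegers F) G) M']
    [Module.Finite (MonoidAlgebra (v.adicCompletionIntegers F) G) M']
    [Module.Projective (MonoidAlgebra (v.adicCompletionIntegers F) G) M']
    (f : M →ₗ[MonoidAlgebra (𝓞 F) G] MonoidAlgebra (AlgebraicClosure F) G)
    (hf : IsBaseChange (MonoidAlgebra (AlgebraicClosure F) G) f)
    (f' : M' →ₗ[MonoidAlgebra (v.adicCompletionIntegers F) G]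
      MonoidAlgebra (AlgebraicClosure (v.adicCompletion F)) G)
    (hf' : IsBaseChange (MonoidAlgebra (AlgebraicClosure (v.adicCompletion F)) G) f')
    (h : Submodule.span (MonoidAlgebra (v.adicCompletionIntegers F) G)
      (MonoidAlgebra.mapRingHom G (i : AlgebraicClosure F →+* AlgebraicClosure (v.adicCompletion F)) ''
        Set.range f) = LinearMap.range f') :
    lambdaLocal G v i (rankOneClass _ _ M f hf) = rankOneClass _ _ M' f' hf' := by
  let : Algebra (AlgebraicClosure F) (AlgebraicClosure (v.adicCompletion F)) :=
    i.toRingHom.toAlgebra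
  have : @IsScalarTower (𝓞 F) (AlgebraicClosure F) (AlgebraicClosure (v.adicCompletion F))
      Algebra.toSMul Algebra.toSMul Algebra.toSMul :=
    IsScalarTower.of_algebraMap_eq fun x => (i.commutes (algebraMap (𝓞 F) F x)).symm
  exact localise_rankOneClass (algebraMap_monoidAlgebra_local_injective v) f hf f' hf' h

theorem lambdaLocal_Psi (π : H1Tame F G) (v : HeightOneSpectrum (𝓞 F))
    (i : AlgebraicClosure F →ₐ[F] AlgebraicClosure (v.adicCompletion F)) :
    lambdaLocal G v i (Psi F G π) =
      PsiLocal F G v ⟨π.1.res (v.adicCompletion F) i, isTame_res π.1 π.2 v i⟩ := by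
  have := π.2.projective (finite_quotient_ringOfIntegers F)
  have := (isTame_res π.1 π.2 v i).projective (finite_quotient_adicCompletionIntegers F v)
  exact lambdaLocal_rankOneClass v i _ _ _ _ (span_map_resolvend v i π.1)

end LocalisePsi

end RelativeK

/-! ### Ranks and determinants over semilocal rings -/

namespace RelativeK

section Rank

variable {A B : Type u} [CommRing A] [CommRing B] [Algebra A B]
  {M N : Type u} [AddCommGroup M] [AddCommGroup N] [Module A M] [Module A N]
  [Module.Finite A M] [Module.Finite A N] [Module.Projective A M] [Module.Projective A N]

/-- The rank of a projective module is determined by its base change along an injective ring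
homomorphism. -/
theorem rankAtStalk_eq_of_baseChange_equiv (hAB : Function.Injective (algebraMap A B))
    (ξ : B ⊗[A] M ≃ₗ[B] B ⊗[A] N) : Module.rankAtStalk (R := A) M = Module.rankAtStalk N := by
  funext p
  -- Not every prime of A comes from B, but the minimal ones do, by injectivity. Ranks at p and at a
  -- minimal prime below p agree.
  obtain ⟨q, hq, hqp⟩ := Ideal.exists_minimalPrimes_le (I := (⊥ : Ideal A)) (J := p.asIdeal) bot_le
  obtain ⟨Q, hQ, hQq⟩ := Ideal.exists_comap_eq_of_mem_minimalPrimes_of_injective hAB q hq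
  have hqp' : (PrimeSpectrum.comap (algebraMap A B) ⟨Q, hQ⟩) ≤ p := by
    rw [← PrimeSpectrum.asIdeal_le_asIdeal]
    exact hQq.trans_le hqp
  rw [← Module.rankAtStalk_eq_of_le_of_finite_of_flat M hqp',
    ← Module.rankAtStalk_eq_of_le_of_finite_of_flat N hqp', ← Module.rankAtStalk_baseChange,
    ← Module.rankAtStalk_baseChange, Module.rankAtStalk_eq_of_equiv ξ]

/-- Over a semilocal ring, a projective module whose fibres at the maximal ideals all have dimension
n is free. -/
theorem nonempty_equiv_of_rankAtStalk [Finite (MaximalSpectrum A)] (n : ℕ)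
    (h : ∀ p, Module.rankAtStalk (R := A) M p = n) : Nonempty (M ≃ₗ[A] (Fin n → A)) := by
  obtain ⟨b⟩ := Module.nonempty_basis_of_flat_of_finrank_eq A M n fun P => by
    let := Ideal.Quotient.field P.1
    rw [← h (PrimeSpectrum.comap (algebraMap A (A ⧸ P.1)) ⊥), ← Module.rankAtStalk_baseChange,
      Module.rankAtStalk_eq_finrank_of_free]
    rfl
  exact ⟨b.equivFun⟩

theorem nonempty_equiv_of_rankAtStalk_eq [Finite (MaximalSpectrum A)] [Module.Free A N]
    (h : Module.rankAtStalk (R := A) M = Module.rankAtStalk N) : Nonempty (M ≃ₗ[A] N) := by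
  rcases subsingleton_or_nontrivial A with hA | hA
  · have := Module.subsingleton A M
    have := Module.subsingleton A N
    exact ⟨0⟩
  obtain ⟨e⟩ := nonempty_equiv_of_rankAtStalk (M := M) (Module.finrank A N) fun p => by
    rw [h, Module.rankAtStalk_eq_finrank_of_free]
    rfl
  exact ⟨e ≪≫ₗ (Module.finBasis A N).equivFun.symm⟩

end Rank

section Det

variable {A B : Type u} [CommRing A] [CommRing B] [Algebra A B]

variable (A B) in
/-- The group `Bˣ / Aˣ`. -/
def UnitQuot : Type u := Bˣ ⧸ (Units.map (algebraMap A B : A →* B)).range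

instance : CommGroup (UnitQuot A B) :=
  inferInstanceAs (CommGroup (Bˣ ⧸ (Units.map (algebraMap A B : A →* B)).range))

variable (A) in
/-- The projection `Bˣ → Bˣ / Aˣ`. -/
def UnitQuot.mk : Bˣ →* UnitQuot A B := QuotientGroup.mk' _

theorem UnitQuot.mk_eq_one_iff (c : Bˣ) :
    UnitQuot.mk A c = 1 ↔ ∃ a : Aˣ, Units.map (algebraMap A B : A →* B) a = c :=
  QuotientGroup.eq_one_iff c

variable {X Y Z X' Y' : Type u} [AddCommGroup X] [AddCommGroup Y] [AddCommGroup Z]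
  [AddCommGroup X'] [AddCommGroup Y'] [Module A X] [Module A Y] [Module A Z] [Module A X']
  [Module A Y']

theorem det_shear {R M M' : Type*} [CommRing R] [AddCommGroup M] [AddCommGroup M'] [Module R M]
    [Module R M'] [Module.Free R M] [Module.Free R M'] [Module.Finite R M] [Module.Finite R M']
    (h : M →ₗ[R] M') :
    LinearEquiv.det ((LinearEquiv.refl R M).skewProd (LinearEquiv.refl R M') h) = 1 := by
  classical
  apply Units.ext
  rw [LinearEquiv.coe_det]
  let b := Module.Free.chooseBasis R M
  let b' := Module.Free.chooseBasis R M'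
  rw [← LinearMap.det_toMatrix (b.prod b')]
  have : LinearMap.toMatrix (b.prod b') (b.prod b')
      ((LinearEquiv.refl R M).skewProd (LinearEquiv.refl R M') h).toLinearMap =
      Matrix.fromBlocks 1 0 (LinearMap.toMatrix b b' h) 1 := by
    ext i j
    rcases i with i | i <;> rcases j with j | j <;>
      simp [LinearMap.toMatrix_apply, Matrix.one_apply, Finsupp.single_apply, eq_comm]
  rw [this, Matrix.det_fromBlocks_zero₁₂]
  simp

theorem mk_det_baseChange [Module.Free A X] [Module.Finite A X] (e : X ≃ₗ[A] X) :
    UnitQuot.mk A (LinearEquiv.det (LinearEquiv.baseChange A B _ _ e)) = 1 := by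
  rw [UnitQuot.mk_eq_one_iff]
  refine ⟨LinearEquiv.det e, ?_⟩
  apply Units.ext
  simp only [Units.coe_map, LinearEquiv.coe_det]
  exact (LinearMap.det_baseChange e.toLinearMap).symm

/-- The determinant modulo `Aˣ` of an isomorphism over `B` between isomorphic free `A`-modules. -/
def relDet (ξ : B ⊗[A] X ≃ₗ[B] B ⊗[A] Y) : UnitQuot A B :=
  open Classical in
  if h : Nonempty (Y ≃ₗ[A] X) then
    UnitQuot.mk A (LinearEquiv.det (ξ ≪≫ₗ LinearEquiv.baseChange A B _ _ h.some)) else 1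

variable [Module.Free A X] [Module.Finite A X]

/-- Two identifications of Y with X differ by an automorphism over A, whose determinant lies in Aˣ;
so the arbitrary choice in `relDet` does not matter. -/
theorem relDet_eq (ξ : B ⊗[A] X ≃ₗ[B] B ⊗[A] Y) (e : Y ≃ₗ[A] X) :
    relDet ξ = UnitQuot.mk A (LinearEquiv.det (ξ ≪≫ₗ LinearEquiv.baseChange A B _ _ e)) := by
  have h : Nonempty (Y ≃ₗ[A] X) := ⟨e⟩
  rw [relDet, dif_pos h]
  have h1 : ξ ≪≫ₗ LinearEquiv.baseChange A B _ _ h.some =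
      LinearEquiv.baseChange A B _ _ (e.symm ≪≫ₗ h.some) *
        (ξ ≪≫ₗ LinearEquiv.baseChange A B _ _ e) := by
    ext x
    simp only [LinearEquiv.mul_apply, LinearEquiv.trans_apply]
    generalize ξ x = y
    induction y using TensorProduct.induction_on with
    | zero => simp
    | add x y hx hy => simp only [map_add, hx, hy]
    | tmul b y => simp
  rw [h1, map_mul, map_mul, mk_det_baseChange, one_mul]

theorem relDet_congr [Module.Free A X'] [Module.Finite A X'] (ξ : B ⊗[A] X ≃ₗ[B] B ⊗[A] Y)
    (ξ' : B ⊗[A] X' ≃ₗ[B] B ⊗[A] Y') (e : Y ≃ₗ[A] X) (σ : X ≃ₗ[A] X') (τ : Y ≃ₗ[A] Y')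
    (h : ∀ m, ξ' (1 ⊗ₜ σ m) = τ.toLinearMap.baseChange B (ξ (1 ⊗ₜ m))) : relDet ξ = relDet ξ' := by
  rw [relDet_eq ξ e, relDet_eq ξ' (τ.symm ≪≫ₗ e ≪≫ₗ σ)]
  have h1 : ξ' ≪≫ₗ LinearEquiv.baseChange A B _ _ (τ.symm ≪≫ₗ e ≪≫ₗ σ) =
      (LinearEquiv.baseChange A B _ _ σ).symm ≪≫ₗ (ξ ≪≫ₗ LinearEquiv.baseChange A B _ _ e) ≪≫ₗ
        LinearEquiv.baseChange A B _ _ σ := by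
    have h2 : (ξ'.toLinearMap ∘ₗ σ.toLinearMap.baseChange B) =
      (τ.toLinearMap.baseChange B ∘ₗ ξ.toLinearMap) := eq_of_eq_one_tmul _ _ (by simpa using h)
    ext x
    obtain ⟨x, rfl⟩ := (LinearEquiv.baseChange A B _ _ σ).surjective x
    have h3 := LinearMap.congr_fun h2 x
    simp only [LinearEquiv.trans_apply, LinearEquiv.symm_apply_apply]
    change LinearEquiv.baseChange A B _ _ (τ.symm ≪≫ₗ e ≪≫ₗ σ)
      (ξ' (σ.toLinearMap.baseChange B x)) = _
    refine (congrArg _ h3).trans ?_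
    simp only [LinearMap.comp_apply, LinearEquiv.coe_coe]
    generalize ξ x = y
    induction y using TensorProduct.induction_on with
    | zero => simp
    | add x y hx hy => simp only [map_add, hx, hy]
    | tmul b y => simp
  rw [h1, LinearEquiv.det_conj]

theorem relDet_trans [Module.Free A Y] [Module.Finite A Y] (ξ : B ⊗[A] X ≃ₗ[B] B ⊗[A] Y)
    (η : B ⊗[A] Y ≃ₗ[B] B ⊗[A] Z) (e : Y ≃ₗ[A] X) (e' : Z ≃ₗ[A] Y) :
    relDet (ξ ≪≫ₗ η) = relDet ξ * relDet η := by
  rw [relDet_eq ξ e, relDet_eq η e', relDet_eq _ (e' ≪≫ₗ e), ← map_mul]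
  congr 1
  rw [mul_comm, ← LinearEquiv.det_conj (η ≪≫ₗ LinearEquiv.baseChange A B _ _ e')
    (LinearEquiv.baseChange A B _ _ e), ← map_mul]
  congr 1
  ext x
  simp only [LinearEquiv.mul_apply, LinearEquiv.trans_apply, LinearEquiv.symm_apply_apply]
  generalize η (ξ x) = y
  induction y using TensorProduct.induction_on with
  | zero => simp
  | add x y hx hy => simp only [map_add, hx, hy]
  | tmul b y => simp

theorem relDet_refl : relDet (LinearEquiv.refl B (B ⊗[A] X)) = 1 := by
  rw [relDet_eq _ (LinearEquiv.refl A X)]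
  exact mk_det_baseChange _

theorem prodRight_baseChange_prodCongr (e : Y ≃ₗ[A] X) (e' : Y' ≃ₗ[A] X') (x : B ⊗[A] (Y × Y')) :
    TensorProduct.prodRight A B B X X' (LinearEquiv.baseChange A B _ _ (e.prodCongr e') x) =
      (LinearEquiv.baseChange A B _ _ e (TensorProduct.prodRight A B B Y Y' x).1,
        LinearEquiv.baseChange A B _ _ e' (TensorProduct.prodRight A B B Y Y' x).2) := by
  induction x using TensorProduct.induction_on with
  | zero => simp only [map_zero, Prod.fst_zero, Prod.snd_zero, Prod.mk_zero_zero]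
  | add x y hx hy =>
    rw [map_add, map_add, hx, hy, map_add, Prod.fst_add, Prod.snd_add, map_add, map_add,
      Prod.mk_add_mk]
  | tmul b y => simp

theorem relDet_prod [Module.Free A X'] [Module.Finite A X'] (ξ : B ⊗[A] X ≃ₗ[B] B ⊗[A] Y)
    (η : B ⊗[A] X' ≃ₗ[B] B ⊗[A] Y') (e : Y ≃ₗ[A] X) (e' : Y' ≃ₗ[A] X') :
    relDet (prodIso ξ η) = relDet ξ * relDet η := by
  rw [relDet_eq ξ e, relDet_eq η e', relDet_eq _ (e.prodCongr e'), ← map_mul]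
  congr 1
  rw [← LinearEquiv.det_conj _ (TensorProduct.prodRight A B B X X')]
  apply Units.ext
  rw [Units.val_mul, LinearEquiv.coe_det, LinearEquiv.coe_det, LinearEquiv.coe_det,
    ← LinearMap.det_prodMap]
  congr 1
  apply LinearMap.ext
  rintro ⟨x, y⟩
  change TensorProduct.prodRight A B B X X' (LinearEquiv.baseChange A B _ _ (e.prodCongr e')
    (prodIso ξ η ((TensorProduct.prodRight A B B X X').symm (x, y)))) = _
  rw [prodRight_baseChange_prodCongr, prodIso_apply]
  simp

/-- An automorphism over `B` of a direct sum of free modules that is unipotent with respect to the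
direct sum decomposition has trivial determinant. -/
theorem relDet_unipotent [Module.Free A X'] [Module.Finite A X']
    (η : B ⊗[A] (X × X') ≃ₗ[B] B ⊗[A] (X × X'))
    (h1 : ∀ x, (LinearMap.fst A X X').baseChange B (η x) = (LinearMap.fst A X X').baseChange B x)
    (h2 : ∀ x, η ((LinearMap.inr A X X').baseChange B x) = (LinearMap.inr A X X').baseChange B x) :
    relDet η = 1 := by
  let P := TensorProduct.prodRight A B B X X'
  let h : B ⊗[A] X →ₗ[B] B ⊗[A] X' := (LinearMap.snd A X X').baseChange B ∘ₗ η.toLinearMap ∘ₗ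
    (LinearMap.inl A X X').baseChange B
  have h0 : η ≪≫ₗ LinearEquiv.baseChange A B _ _ (LinearEquiv.refl A _) = η := by
    ext x
    exact LinearMap.congr_fun (LinearMap.baseChange_id (R := A) (A := B)) (η x)
  rw [relDet_eq _ (LinearEquiv.refl A _), h0, ← LinearEquiv.det_conj _ P]
  have : P.symm ≪≫ₗ η ≪≫ₗ P = (LinearEquiv.refl B _).skewProd (LinearEquiv.refl B _) h := by
    ext1 x
    obtain ⟨x, y⟩ := x
    have h3 : P.symm (x, y) = _ := prodRight_symm_apply x y
    simp only [LinearEquiv.trans_apply, h3, map_add, h2]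
    have h4 : P ((LinearMap.inr A X X').baseChange B y) = (0, y) := prodRight_inr y
    have h5 : P (η ((LinearMap.inl A X X').baseChange B x)) = (x, h x) := by
      refine Prod.ext ?_ ?_
      · rw [← prodRight_fst, h1, prodRight_fst, prodRight_inl]
      · rw [← prodRight_snd]
        rfl
    rw [h4, h5]
    simp [add_comm]
  rw [this, det_shear, map_one]

end Det

section LocalDet

variable {A B : Type u} [CommRing A] [CommRing B] [Algebra A B]

variable {M N P M' N' : Type u} [AddCommGroup M] [AddCommGroup N] [AddCommGroup P]
  [AddCommGroup M'] [AddCommGroup N'] [Module A M] [Module A N] [Module A P] [Module A M']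
  [Module A N'] [Module.Finite A M] [Module.Finite A N] [Module.Finite A P]
  [Module.Finite A M'] [Module.Finite A N'] [Module.Projective A M] [Module.Projective A N]
  [Module.Projective A P] [Module.Projective A M'] [Module.Projective A N']

theorem nonempty_equiv_prod [Finite (MaximalSpectrum A)]
    (hAB : Function.Injective (algebraMap A B)) (ξ : B ⊗[A] M ≃ₗ[B] B ⊗[A] N)
    (Q : Type u) [AddCommGroup Q] [Module A Q] [Module.Finite A Q] [Module.Projective A Q]
    [Module.Free A (N × Q)] : Nonempty ((M × Q) ≃ₗ[A] (N × Q)) :=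
  nonempty_equiv_of_rankAtStalk_eq
    (rankAtStalk_eq_of_baseChange_equiv hAB (prodIso ξ (LinearEquiv.refl B _)))

variable [Finite (MaximalSpectrum A)]

/-- Enlarge both sides by an identity, to (M ⊕ Q) ⊕ (N ⊕ Q') and (M ⊕ Q') ⊕ (N ⊕ Q). The two are
matched by exchanging Q with Q', and identities have trivial determinant. -/
theorem relDet_prodIso_refl_eq (hAB : Function.Injective (algebraMap A B)) (ξ : B ⊗[A] M ≃ₗ[B] B ⊗[A] N)
    (Q : Type u) [AddCommGroup Q] [Module A Q] [Module.Finite A Q] [Module.Projective A Q]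
    [Module.Free A (N × Q)]
    (Q' : Type u) [AddCommGroup Q'] [Module A Q'] [Module.Finite A Q'] [Module.Projective A Q']
    [Module.Free A (N × Q')] :
    relDet (prodIso ξ (LinearEquiv.refl B (B ⊗[A] Q))) =
      relDet (prodIso ξ (LinearEquiv.refl B (B ⊗[A] Q'))) := by
  obtain ⟨e⟩ := nonempty_equiv_prod hAB ξ Q
  obtain ⟨e'⟩ := nonempty_equiv_prod hAB ξ Q'
  have := Module.Free.of_equiv e.symm
  have := Module.Free.of_equiv e'.symm
  have h1 := relDet_prod (prodIso ξ (LinearEquiv.refl B (B ⊗[A] Q)))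
    (LinearEquiv.refl B (B ⊗[A] (N × Q'))) e.symm (LinearEquiv.refl A _)
  have h2 := relDet_prod (prodIso ξ (LinearEquiv.refl B (B ⊗[A] Q')))
    (LinearEquiv.refl B (B ⊗[A] (N × Q))) e'.symm (LinearEquiv.refl A _)
  rw [relDet_refl, mul_one] at h1 h2
  rw [← h1, ← h2]
  let σ (X : Type u) [AddCommGroup X] [Module A X] : ((X × Q) × (N × Q')) ≃ₗ[A] ((X × Q') × (N × Q)) :=
    { toFun y := ((y.1.1, y.2.2), (y.2.1, y.1.2))
      invFun y := ((y.1.1, y.2.2), (y.2.1, y.1.2))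
      map_add' _ _ := rfl
      map_smul' _ _ := rfl
      left_inv _ := rfl
      right_inv _ := rfl }
  refine relDet_congr _ _ (e.symm.prodCongr (LinearEquiv.refl A _)) (σ M) (σ N) fun m => ?_
  obtain ⟨⟨m, q⟩, n, q'⟩ := m
  change prodIso _ _ (1 ⊗ₜ ((m, q'), (n, q))) = _
  simp only [prodIso_one_tmul, map_add, LinearEquiv.refl_apply]
  simp only [← LinearMap.comp_apply, ← LinearMap.baseChange_comp]
  simp
  have hc : (σ N).toLinearMap ∘ₗ LinearMap.inl A (N × Q) (N × Q') ∘ₗ LinearMap.inl A N Q =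
      LinearMap.inl A (N × Q') (N × Q) ∘ₗ LinearMap.inl A N Q' := rfl
  rw [hc, add_assoc, add_assoc, ← TensorProduct.tmul_add, ← TensorProduct.tmul_add]
  simp [σ]

end LocalDet

end RelativeK

/-! ### The determinant homomorphism on the relative K-group of a semilocal ring -/

namespace RelativeK

section DetClass

variable {A B : Type u} [CommRing A] [CommRing B] [Algebra A B]

theorem baseChange_apply_baseChange {X Y Z : Type u} [AddCommGroup X] [AddCommGroup Y]
    [AddCommGroup Z] [Module A X] [Module A Y] [Module A Z] (g : Y →ₗ[A] Z) (f : X →ₗ[A] Y)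
    (x : B ⊗[A] X) : g.baseChange B (f.baseChange B x) = (g ∘ₗ f).baseChange B x := by
  rw [LinearMap.baseChange_comp, LinearMap.comp_apply]

variable {M N P M' N' : Type u} [AddCommGroup M] [AddCommGroup N] [AddCommGroup P]
  [AddCommGroup M'] [AddCommGroup N'] [Module A M] [Module A N] [Module A P] [Module A M']
  [Module A N']

theorem prodIso_inl (ξ : B ⊗[A] M ≃ₗ[B] B ⊗[A] N) (η : B ⊗[A] M' ≃ₗ[B] B ⊗[A] N')
    (x : B ⊗[A] M) : prodIso ξ η ((LinearMap.inl A M M').baseChange B x) =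
      (LinearMap.inl A N N').baseChange B (ξ x) := by
  apply (TensorProduct.prodRight A B B N N').injective
  rw [prodIso_apply, prodRight_inl, prodRight_inl, map_zero]

theorem prodIso_inr (ξ : B ⊗[A] M ≃ₗ[B] B ⊗[A] N) (η : B ⊗[A] M' ≃ₗ[B] B ⊗[A] N')
    (x : B ⊗[A] M') : prodIso ξ η ((LinearMap.inr A M M').baseChange B x) =
      (LinearMap.inr A N N').baseChange B (η x) := by
  apply (TensorProduct.prodRight A B B N N').injective
  rw [prodIso_apply, prodRight_inr, prodRight_inr, map_zero]

theorem fst_prodIso (ξ : B ⊗[A] M ≃ₗ[B] B ⊗[A] N) (η : B ⊗[A] M' ≃ₗ[B] B ⊗[A] N')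
    (x : B ⊗[A] (M × M')) : (LinearMap.fst A N N').baseChange B (prodIso ξ η x) =
      ξ ((LinearMap.fst A M M').baseChange B x) := by
  rw [prodRight_fst, prodRight_fst, prodIso_apply]

theorem snd_prodIso (ξ : B ⊗[A] M ≃ₗ[B] B ⊗[A] N) (η : B ⊗[A] M' ≃ₗ[B] B ⊗[A] N')
    (x : B ⊗[A] (M × M')) : (LinearMap.snd A N N').baseChange B (prodIso ξ η x) =
      η ((LinearMap.snd A M M').baseChange B x) := by
  rw [prodRight_snd, prodRight_snd, prodIso_apply]

variable [Module.Finite A M] [Module.Finite A N] [Module.Finite A P]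
  [Module.Finite A M'] [Module.Finite A N'] [Module.Projective A M] [Module.Projective A N]
  [Module.Projective A P] [Module.Projective A M'] [Module.Projective A N']
  [Finite (MaximalSpectrum A)] (hAB : Function.Injective (algebraMap A B))

/-- The modules of a twisted form need not be free, as ranks may vary; the determinant is taken
after adding any Q that makes the second module free, and the value does not depend on Q. -/
theorem exists_detClass (hAB : Function.Injective (algebraMap A B)) (X : TwistedForm A B) :
    ∃ d : UnitQuot A B, ∀ (Q : Type u) [AddCommGroup Q] [Module A Q] [Module.Finite A Q]
      [Module.Projective A Q] [Module.Free A (X.N × Q)],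
      relDet (prodIso X.ξ (LinearEquiv.refl B (B ⊗[A] Q))) = d := by
  obtain ⟨n, Q, _, _, _, _, ⟨e⟩⟩ := exists_complement (A := A) X.N
  have := Module.Free.of_equiv e.symm
  refine ⟨relDet (prodIso X.ξ (LinearEquiv.refl B (B ⊗[A] Q))), fun Q' => ?_⟩
  intros
  exact relDet_prodIso_refl_eq hAB X.ξ _ _

/-- The determinant modulo `Aˣ` of a twisted form over a semilocal ring. -/
def detClass (X : TwistedForm A B) : UnitQuot A B := (exists_detClass hAB X).choose

theorem detClass_eq (ξ : B ⊗[A] M ≃ₗ[B] B ⊗[A] N)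
    (Q : Type u) [AddCommGroup Q] [Module A Q] [Module.Finite A Q]
    [Module.Projective A Q] [Module.Free A (N × Q)] :
    detClass hAB ⟨M, N, ξ⟩ = relDet (prodIso ξ (LinearEquiv.refl B (B ⊗[A] Q))) :=
  ((exists_detClass hAB ⟨M, N, ξ⟩).choose_spec Q).symm

theorem detClass_eq_relDet [Module.Free A M] (ξ : B ⊗[A] M ≃ₗ[B] B ⊗[A] N) (e : N ≃ₗ[A] M) :
    detClass hAB ⟨M, N, ξ⟩ = relDet ξ := by
  have := Module.Free.of_equiv e.symm
  rw [detClass_eq hAB ξ PUnit, relDet_prod _ _ e (LinearEquiv.refl A _), relDet_refl, mul_one]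

theorem detClass_congr (ξ : B ⊗[A] M ≃ₗ[B] B ⊗[A] N) (ξ' : B ⊗[A] M' ≃ₗ[B] B ⊗[A] N')
    (σ : M ≃ₗ[A] M') (τ : N ≃ₗ[A] N')
    (h : ∀ x, ξ' (σ.toLinearMap.baseChange B x) = τ.toLinearMap.baseChange B (ξ x)) :
    detClass hAB ⟨M, N, ξ⟩ = detClass hAB ⟨M', N', ξ'⟩ := by
  obtain ⟨n, Q, _, _, _, _, ⟨e⟩⟩ := exists_complement (A := A) N
  have := Module.Free.of_equiv e.symm
  have := Module.Free.of_equiv (τ.prodCongr (LinearEquiv.refl A Q))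
  obtain ⟨e₁⟩ := nonempty_equiv_prod hAB ξ Q
  obtain ⟨e₂⟩ := nonempty_equiv_prod hAB ξ' Q
  have := Module.Free.of_equiv e₁.symm
  have := Module.Free.of_equiv e₂.symm
  rw [detClass_eq hAB ξ Q, detClass_eq hAB ξ' Q]
  refine relDet_congr _ _ e₁.symm (σ.prodCongr (LinearEquiv.refl A Q))
    (τ.prodCongr (LinearEquiv.refl A Q)) fun m => ?_
  obtain ⟨m, q⟩ := m
  have h1 := h (1 ⊗ₜ m)
  simp only [LinearMap.baseChange_tmul, LinearEquiv.coe_coe] at h1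
  change prodIso _ _ (1 ⊗ₜ (σ m, q)) = _
  rw [prodIso_one_tmul, prodIso_one_tmul, h1, map_add, baseChange_apply_baseChange,
    baseChange_apply_baseChange, baseChange_apply_baseChange]
  have h2 : (τ.prodCongr (LinearEquiv.refl A Q)).toLinearMap ∘ₗ LinearMap.inl A N Q =
    LinearMap.inl A N' Q ∘ₗ τ.toLinearMap := by ext <;> simp
  rw [h2]
  simp

theorem detClass_trans (ξ : B ⊗[A] M ≃ₗ[B] B ⊗[A] N) (η : B ⊗[A] N ≃ₗ[B] B ⊗[A] P) :
    detClass hAB ⟨M, P, ξ ≪≫ₗ η⟩ = detClass hAB ⟨M, N, ξ⟩ * detClass hAB ⟨N, P, η⟩ := by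
  obtain ⟨n, Q, _, _, _, _, ⟨e⟩⟩ := exists_complement (A := A) P
  have := Module.Free.of_equiv e.symm
  obtain ⟨e₁⟩ := nonempty_equiv_prod hAB η Q
  have := Module.Free.of_equiv e₁.symm
  obtain ⟨e₂⟩ := nonempty_equiv_prod hAB ξ Q
  have := Module.Free.of_equiv e₂.symm
  rw [detClass_eq hAB _ Q, detClass_eq hAB _ Q, detClass_eq hAB _ Q,
    ← relDet_trans _ _ e₂.symm e₁.symm]
  congr 1
  ext x
  apply (TensorProduct.prodRight A B B P Q).injective
  simp [prodIso_apply]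

theorem detClass_prod (ξ : B ⊗[A] M ≃ₗ[B] B ⊗[A] N) (ξ' : B ⊗[A] M' ≃ₗ[B] B ⊗[A] N') :
    detClass hAB ⟨M × M', N × N', prodIso ξ ξ'⟩ =
      detClass hAB ⟨M, N, ξ⟩ * detClass hAB ⟨M', N', ξ'⟩ := by
  obtain ⟨n, Q, _, _, _, _, ⟨e⟩⟩ := exists_complement (A := A) N
  have := Module.Free.of_equiv e.symm
  obtain ⟨n', Q', _, _, _, _, ⟨e'⟩⟩ := exists_complement (A := A) N'
  have := Module.Free.of_equiv e'.symm
  obtain ⟨e₁⟩ := nonempty_equiv_prod hAB ξ Q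
  have := Module.Free.of_equiv e₁.symm
  obtain ⟨e₂⟩ := nonempty_equiv_prod hAB ξ' Q'
  have := Module.Free.of_equiv e₂.symm
  let σ (X X' : Type u) [AddCommGroup X] [Module A X] [AddCommGroup X'] [Module A X'] :
      ((X × X') × (Q × Q')) ≃ₗ[A] ((X × Q) × (X' × Q')) := LinearEquiv.prodProdProdComm A X X' Q Q'
  have := Module.Free.of_equiv (σ M M').symm
  have := Module.Free.of_equiv (σ N N').symm
  rw [detClass_eq hAB _ (Q × Q'), detClass_eq hAB ξ Q, detClass_eq hAB ξ' Q',
    ← relDet_prod _ _ e₁.symm e₂.symm]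
  refine relDet_congr _ _ ((σ N N') ≪≫ₗ e₁.symm.prodCongr e₂.symm ≪≫ₗ (σ M M').symm)
    (σ M M') (σ N N') fun m => ?_
  obtain ⟨⟨m, m'⟩, q, q'⟩ := m
  change prodIso _ _ (1 ⊗ₜ ((m, q), (m', q'))) = _
  simp only [prodIso_one_tmul, map_add, LinearEquiv.refl_apply, baseChange_apply_baseChange]
  have h1 : (σ N N').toLinearMap ∘ₗ LinearMap.inl A (N × N') (Q × Q') ∘ₗ LinearMap.inl A N N' =
    LinearMap.inl A (N × Q) (N' × Q') ∘ₗ LinearMap.inl A N Q := rfl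
  have h2 : (σ N N').toLinearMap ∘ₗ LinearMap.inl A (N × N') (Q × Q') ∘ₗ LinearMap.inr A N N' =
    LinearMap.inr A (N × Q) (N' × Q') ∘ₗ LinearMap.inl A N' Q' := rfl
  rw [h1, h2, add_add_add_comm]
  congr 1
  simp only [LinearMap.baseChange_tmul, ← TensorProduct.tmul_add]
  congr 1
  simp [σ]

/-- A unipotent automorphism of a direct sum has trivial determinant. -/
theorem detClass_unipotent (η : B ⊗[A] (M × M') ≃ₗ[B] B ⊗[A] (M × M'))
    (h1 : ∀ x, (LinearMap.fst A M M').baseChange B (η x) = (LinearMap.fst A M M').baseChange B x)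
    (h2 : ∀ x, η ((LinearMap.inr A M M').baseChange B x) = (LinearMap.inr A M M').baseChange B x) :
    detClass hAB ⟨M × M', M × M', η⟩ = 1 := by
  obtain ⟨n, Q, _, _, _, _, ⟨e⟩⟩ := exists_complement (A := A) M
  have := Module.Free.of_equiv e.symm
  obtain ⟨n', Q', _, _, _, _, ⟨e'⟩⟩ := exists_complement (A := A) M'
  have := Module.Free.of_equiv e'.symm
  let σ : ((M × M') × (Q × Q')) ≃ₗ[A] ((M × Q) × (M' × Q')) :=
    LinearEquiv.prodProdProdComm A M M' Q Q'
  have := Module.Free.of_equiv σ.symm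
  rw [detClass_eq hAB η (Q × Q')]
  let κ := prodIso η (LinearEquiv.refl B (B ⊗[A] (Q × Q')))
  -- Regrouped this way, both blocks are free and the stabilised automorphism is still unipotent, so
  -- `relDet_unipotent` applies.
  let η' : B ⊗[A] ((M × Q) × (M' × Q')) ≃ₗ[B] B ⊗[A] ((M × Q) × (M' × Q')) :=
    (LinearEquiv.baseChange A B _ _ σ).symm ≪≫ₗ κ ≪≫ₗ LinearEquiv.baseChange A B _ _ σ
  have hη' (x) : η' (σ.toLinearMap.baseChange B x) = σ.toLinearMap.baseChange B (κ x) := by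
    change LinearEquiv.baseChange A B _ _ σ (κ ((LinearEquiv.baseChange A B _ _ σ).symm
      (LinearEquiv.baseChange A B _ _ σ x))) = _
    rw [LinearEquiv.symm_apply_apply]
    rfl
  rw [relDet_congr κ η' (LinearEquiv.refl A _) σ σ fun m => by
    rw [← hη', LinearMap.baseChange_tmul, LinearEquiv.coe_coe]]
  apply relDet_unipotent
  · intro x
    obtain ⟨x, rfl⟩ := (LinearEquiv.baseChange A B _ _ σ).surjective x
    change (LinearMap.fst A _ _).baseChange B (η' (σ.toLinearMap.baseChange B x)) =
      (LinearMap.fst A _ _).baseChange B (σ.toLinearMap.baseChange B x)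
    rw [hη', baseChange_apply_baseChange, baseChange_apply_baseChange]
    have h3 : LinearMap.fst A (M × Q) (M' × Q') ∘ₗ σ.toLinearMap =
        LinearMap.inl A M Q ∘ₗ LinearMap.fst A M M' ∘ₗ LinearMap.fst A _ _ +
        LinearMap.inr A M Q ∘ₗ LinearMap.fst A Q Q' ∘ₗ LinearMap.snd A _ _ := by
      ext <;> simp [σ]
    rw [h3]
    simp only [LinearMap.baseChange_add, LinearMap.add_apply, ← baseChange_apply_baseChange]
    rw [fst_prodIso, snd_prodIso, h1]
    rfl
  · intro y
    have h3 : LinearMap.inr A (M × Q) (M' × Q') = σ.toLinearMap ∘ₗ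
        (LinearMap.inl A _ _ ∘ₗ LinearMap.inr A M M' ∘ₗ LinearMap.fst A _ _ +
          LinearMap.inr A _ _ ∘ₗ LinearMap.inr A Q Q' ∘ₗ LinearMap.snd A _ _) := by
      ext <;> simp [σ]
    rw [h3, ← baseChange_apply_baseChange, hη']
    congr 1
    simp only [LinearMap.baseChange_add, LinearMap.add_apply, ← baseChange_apply_baseChange, map_add]
    rw [prodIso_inl, prodIso_inr, h2]
    rfl

/-- The splitting of a short exact sequence. -/
theorem exists_split_equiv {X Y Z : Type u} [AddCommGroup X] [AddCommGroup Y] [AddCommGroup Z]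
    [Module A X] [Module A Y] [Module A Z] [Module.Projective A Z] (f : X →ₗ[A] Y) (g : Y →ₗ[A] Z)
    (hf : Function.Injective f) (h : Function.Exact f g) (hg : Function.Surjective g) :
    ∃ φ : (Z × X) ≃ₗ[A] Y, φ.toLinearMap ∘ₗ LinearMap.inr A Z X = f ∧
      g ∘ₗ φ.toLinearMap = LinearMap.fst A Z X := by
  obtain ⟨s, hs⟩ := Module.projective_lifting_property g LinearMap.id hg
  have hs' (z) : g (s z) = z := LinearMap.congr_fun hs z
  have hgf (x) : g (f x) = 0 := h.apply_apply_eq_zero x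
  refine ⟨LinearEquiv.ofBijective (s.coprod f) ⟨?_, fun y => ?_⟩, ?_, ?_⟩
  · rw [injective_iff_map_eq_zero]
    rintro ⟨z, x⟩ hzx
    have h1 : s z + f x = 0 := hzx
    have h2 : z = 0 := by
      have := congrArg g h1
      simpa [hs', hgf] using this
    subst h2
    rw [map_zero, zero_add] at h1
    rw [hf (h1.trans (map_zero f).symm)]
    rfl
  · obtain ⟨x, hx⟩ := (h (y - s (g y))).1 (by rw [map_sub, hs', sub_self])
    exact ⟨(g y, x), by simp [hx]⟩
  · ext x
    change s 0 + f x = f x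
    rw [map_zero, zero_add]
  · refine LinearMap.ext fun y => ?_
    change g (s y.1 + f y.2) = y.1
    rw [map_add, hs', hgf, add_zero]

/-- Splitting both sequences makes the isomorphism of Y triangular with diagonal blocks those of Z
and X. It therefore differs from their direct sum U by a unipotent automorphism. -/
theorem detClass_exact {X Y Z : TwistedForm A B} (h : X.ShortExact Y Z) :
    detClass hAB Y = detClass hAB X * detClass hAB Z := by
  obtain ⟨φ, hφ1, hφ2⟩ := exists_split_equiv h.f h.g h.f_injective h.exact h.g_surjective
  obtain ⟨ψ, hψ1, hψ2⟩ := exists_split_equiv h.f' h.g' h.f'_injective h.exact' h.g'_surjective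
  let T : B ⊗[A] (Z.M × X.M) ≃ₗ[B] B ⊗[A] (Z.N × X.N) :=
    LinearEquiv.baseChange A B _ _ φ ≪≫ₗ Y.ξ ≪≫ₗ (LinearEquiv.baseChange A B _ _ ψ).symm
  have hT (x) : ψ.toLinearMap.baseChange B (T x) = Y.ξ (φ.toLinearMap.baseChange B x) :=
    (LinearEquiv.baseChange A B _ _ ψ).apply_symm_apply _
  let U := prodIso Z.ξ X.ξ
  have hY : detClass hAB ⟨Z.M × X.M, Z.N × X.N, T⟩ = detClass hAB Y :=
    detClass_congr hAB T Y.ξ φ ψ fun x => (hT x).symm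
  have hfst (x) : (LinearMap.fst A Z.N X.N).baseChange B (T x) =
      Z.ξ ((LinearMap.fst A Z.M X.M).baseChange B x) := by
    rw [← hψ2, ← baseChange_apply_baseChange, hT, ← h.comm_right, baseChange_apply_baseChange, hφ2]
  have hinr (x) : T ((LinearMap.inr A Z.M X.M).baseChange B x) =
      (LinearMap.inr A Z.N X.N).baseChange B (X.ξ x) := by
    apply (LinearEquiv.baseChange A B _ _ ψ).injective
    refine (hT _).trans ?_
    rw [baseChange_apply_baseChange, hφ1, h.comm_left, ← hψ1, ← baseChange_apply_baseChange]
    rfl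
  have hTU : T = U ≪≫ₗ (U.symm ≪≫ₗ T) := by
    ext x
    simp
  have h1 : detClass hAB ⟨Z.N × X.N, Z.N × X.N, U.symm ≪≫ₗ T⟩ = 1 := by
    apply detClass_unipotent
    · intro x
      obtain ⟨x, rfl⟩ := U.surjective x
      rw [LinearEquiv.trans_apply, LinearEquiv.symm_apply_apply, hfst, fst_prodIso]
    · intro x
      obtain ⟨x, rfl⟩ := X.ξ.surjective x
      rw [← prodIso_inr Z.ξ X.ξ, LinearEquiv.trans_apply, LinearEquiv.symm_apply_apply, hinr,
        prodIso_inr]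
  rw [← hY, hTU, detClass_trans, h1, mul_one, detClass_prod, mul_comm]

/-- The determinant homomorphism `K₀(A, B) → Bˣ / Aˣ` for a semilocal ring `A`. -/
def detHom : RelK0 A B →+ Additive (UnitQuot A B) :=
  RelK0.lift (fun X => Additive.ofMul (detClass hAB X)) <| by
    rintro _ (⟨X, Y, Z, h⟩ | ⟨M, N, P, ξ, η⟩)
    · simp only [map_sub, map_add, FreeAbelianGroup.lift_apply_of]
      rw [detClass_exact hAB h, ofMul_mul, sub_self]
    · simp only [map_sub, map_add, FreeAbelianGroup.lift_apply_of]
      rw [detClass_trans, ofMul_mul, sub_self]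

/-- Over a semilocal ring M is free of rank one, so its lattice is A·c for a unit c of B, and c is
also the determinant of the class modulo Aˣ. -/
theorem exists_unit_detHom_rankOneClass (f : M →ₗ[A] B) (hf : IsBaseChange B f) :
    ∃ c : Bˣ, LinearMap.range f = Submodule.span A {(c : B)} ∧
      detHom hAB (rankOneClass A B M f hf) = Additive.ofMul (UnitQuot.mk A c) := by
  let ξ : B ⊗[A] M ≃ₗ[B] B ⊗[A] A :=
    hf.equiv ≪≫ₗ (TensorProduct.AlgebraTensorModule.rid A B B).symm
  obtain ⟨e'⟩ := nonempty_equiv_of_rankAtStalk_eq (rankAtStalk_eq_of_baseChange_equiv hAB ξ)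
  let e := e'.symm
  have := Module.Free.of_equiv e
  -- Conjugation by `hf.equiv` turns the automorphism of B ⊗ M into one of B, whose determinant is
  -- its value at 1, namely the generator f (e 1).
  let θ : B ≃ₗ[B] B := hf.equiv.symm ≪≫ₗ (ξ ≪≫ₗ LinearEquiv.baseChange A B _ _ e) ≪≫ₗ hf.equiv
  have hθ : θ 1 = f (e 1) := by simp [θ, ξ, hf.equiv_tmul]
  have hdet : ((LinearEquiv.det θ : Bˣ) : B) = f (e 1) := by
    rw [LinearEquiv.coe_det, LinearMap.det_ring]
    exact hθ
  refine ⟨LinearEquiv.det θ, ?_, ?_⟩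
  · rw [hdet]
    apply le_antisymm
    · rintro _ ⟨m, rfl⟩
      rw [Submodule.mem_span_singleton]
      refine ⟨e' m, ?_⟩
      rw [← map_smul, ← map_smul, smul_eq_mul, mul_one, e'.symm_apply_apply]
    · rw [Submodule.span_singleton_le_iff_mem]
      exact ⟨_, rfl⟩
  · have h1 : detHom hAB (rankOneClass A B M f hf) = Additive.ofMul (detClass hAB ⟨M, A, ξ⟩) :=
      RelK0.lift_cls _ _ _
    rw [h1, detClass_eq_relDet hAB ξ e, relDet_eq ξ e, ← LinearEquiv.det_conj _ hf.equiv]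

/-- Over a semilocal ring the class of a rank one module determines the lattice. -/
theorem range_eq_of_rankOneClass_eq (hAB : Function.Injective (algebraMap A B))
    (f : M →ₗ[A] B) (hf : IsBaseChange B f) (f' : M' →ₗ[A] B)
    (hf' : IsBaseChange B f') (h : rankOneClass A B M f hf = rankOneClass A B M' f' hf') :
    LinearMap.range f = LinearMap.range f' := by
  obtain ⟨c, hc, hcd⟩ := exists_unit_detHom_rankOneClass hAB f hf
  obtain ⟨c', hc', hcd'⟩ := exists_unit_detHom_rankOneClass hAB f' hf'
  rw [h, hcd'] at hcd
  have h1 : UnitQuot.mk A (c' * c⁻¹) = 1 := by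
    rw [map_mul, map_inv, mul_inv_eq_one]
    exact Additive.ofMul.injective hcd
  obtain ⟨a, ha⟩ := (UnitQuot.mk_eq_one_iff _).1 h1
  have h2 : (c' : B) = a • (c : B) := by
    rw [Units.smul_def, Algebra.smul_def]
    have := congrArg (fun u : Bˣ => ((u * c : Bˣ) : B)) ha
    simpa using this.symm
  rw [hc, hc', h2]
  exact (Submodule.span_singleton_group_smul_eq A a (c : B)).symm

end DetClass

section Semilocal

open IsDedekindDomain NumberField

/-- Maximal ideals of a finite algebra lie above the maximal ideal of R, and only finitely many
primes do. Applied to O_{F_v}G. -/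
theorem finite_maximalSpectrum_of_isLocalRing (R S : Type u) [CommRing R] [IsLocalRing R]
    [CommRing S] [Algebra R S] [Module.Finite R S] : Finite (MaximalSpectrum S) := by
  have h := Algebra.QuasiFinite.finite_primesOver (S := S) (IsLocalRing.maximalIdeal R)
  have : Finite ((IsLocalRing.maximalIdeal R).primesOver S) := h
  refine Finite.of_injective (β := (IsLocalRing.maximalIdeal R).primesOver S)
    (fun P => ⟨P.asIdeal, P.isMaximal.isPrime, ⟨?_⟩⟩) fun P Q hPQ => ?_
  · have := P.isMaximal
    exact (IsLocalRing.eq_maximalIdeal (Ideal.IsMaximal.under R P.asIdeal)).symm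
  · exact MaximalSpectrum.ext (congrArg Subtype.val hPQ)

end Semilocal

end RelativeK

/-! ### Serre's splitting theorem for orders -/

namespace RelativeK

section Splitting

/-- An element of a finitely generated projective module that is nonzero modulo every maximal ideal
is unimodular. -/
theorem exists_dual_eq_one {A P : Type*} [CommRing A] [AddCommGroup P] [Module A P]
    [Module.Finite A P] [Module.Projective A P] (p : P)
    (h : ∀ m : Ideal A, m.IsMaximal → p ∉ m • (⊤ : Submodule A P)) :
    ∃ φ : P →ₗ[A] A, φ p = 1 := by
  by_contra! hc
  -- I consists of the values at p of linear forms. If I were inside a maximal ideal m, a dual basis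
  -- would write p with coefficients in m.
  let I : Ideal A := LinearMap.range (LinearMap.applyₗ (R := A) (M₂ := A) p)
  have hI : I ≠ ⊤ := fun hI => by
    obtain ⟨φ, hφ⟩ : (1 : A) ∈ I := hI ▸ Submodule.mem_top
    exact hc φ hφ
  obtain ⟨m, hm, hIm⟩ := Ideal.exists_le_maximal I hI
  refine h m hm ?_
  obtain ⟨n, f, g, -, -, hfg⟩ := Module.Finite.exists_comp_eq_id_of_projective A P
  have h1 : p = ∑ j, g p j • f (Pi.single j 1) := by
    simp only [← map_smul, ← map_sum]
    rw [← pi_eq_sum_univ' (g p)]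
    exact (LinearMap.congr_fun hfg p).symm
  rw [h1]
  refine Submodule.sum_mem _ fun j _ => Submodule.smul_mem_smul (hIm ?_) Submodule.mem_top
  exact ⟨LinearMap.proj j ∘ₗ g, rfl⟩

theorem map_mem_of_mem_smul_top {A P : Type*} [CommRing A] [AddCommGroup P] [Module A P]
    (φ : P →ₗ[A] A) (m : Ideal A) {p : P} (h : p ∈ m • (⊤ : Submodule A P)) : φ p ∈ m := by
  have := Submodule.mem_map_of_mem (f := φ) h
  rw [Submodule.map_smul''] at this
  exact (Ideal.mul_le_right : Submodule.map φ ⊤ * m ≤ m) (by rwa [mul_comm])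

variable {R A P : Type*} [CommRing R] [IsDomain R] [CommRing A] [Algebra R A]
  [AddCommGroup P] [Module A P]

/-- Translating an integral element by multiples of `t` one reaches a divisor of a nonzero element
of the base ring. -/
theorem exists_add_smul_dvd [Infinite R] (b : A) (hb : IsIntegral R b) (t : R) (ht : t ≠ 0) :
    ∃ k d : R, d ≠ 0 ∧ b + algebraMap R A (t * k) ∣ algebraMap R A d := by
  classical
  -- With f monic and f(-b) = 0, the element b + tk divides f(tk) - f(-b) = f(tk), which is nonzero
  -- for some k because R is infinite.
  obtain ⟨f, hf, hfb⟩ := hb.neg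
  obtain ⟨k, hk⟩ : ∃ k, ¬ f.IsRoot (t * k) := by
    by_contra! hc
    have h1 : (Set.range fun k => t * k).Infinite :=
      Set.infinite_range_of_injective (mul_right_injective₀ ht)
    refine h1 ((f.roots.toFinset.finite_toSet).subset ?_)
    rintro _ ⟨k, rfl⟩
    simpa [hf.ne_zero] using hc k
  refine ⟨k, f.eval (t * k), hk, ?_⟩
  have := Polynomial.sub_dvd_eval_sub (algebraMap R A (t * k)) (-b) (f.map (algebraMap R A))
  rw [Polynomial.eval_map, Polynomial.eval_map, hfb, sub_zero, sub_neg_eq_add, add_comm,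
    Polynomial.eval₂_at_apply] at this
  exact this

/-- These ideals correspond to ideals of A/dA, which is a finite ring. -/
theorem finite_isMaximal_of_ne_zero {R A : Type*} [CommRing R] [CommRing A] [Algebra R A]
    [Ring.HasFiniteQuotients R] [Module.Finite R A] (d : R)
    (hd : d ≠ 0) : {m : Ideal A | m.IsMaximal ∧ algebraMap R A d ∈ m}.Finite := by
  let J : Ideal A := (Ideal.span {d}).map (algebraMap R A)
  have : Finite (R ⧸ Ideal.span {d}) := Ring.HasFiniteQuotients.finiteQuotient (by simpa using hd)
  have : Finite (A ⧸ J) := Module.finite_of_finite (R ⧸ Ideal.span {d})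
  have : Finite (Ideal (A ⧸ J)) := Finite.of_injective (fun I => (I : Set (A ⧸ J)))
    SetLike.coe_injective
  refine Set.Finite.of_injOn (f := fun m => m.map (Ideal.Quotient.mk J)) (t := Set.univ)
    (fun _ _ => Set.mem_univ _) ?_ Set.finite_univ
  have key (m : Ideal A) (h : algebraMap R A d ∈ m) :
      (m.map (Ideal.Quotient.mk J)).comap (Ideal.Quotient.mk J) = m := by
    rw [Ideal.comap_map_of_surjective _ Ideal.Quotient.mk_surjective, sup_eq_left,
      ← RingHom.ker_eq_comap_bot, Ideal.mk_ker, show J = _ from Ideal.map_span _ _, Set.image_singleton,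
      Ideal.span_singleton_le_iff_mem]
    exact h
  intro m hm m' hm' h
  rw [← key m hm.2, ← key m' hm'.2]
  exact congrArg _ h

/-- The Chinese remainder theorem for a module: combine the x m with coefficients that are 1 modulo
m and 0 modulo the other ideals of T. -/
theorem exists_forall_notMem_smul_top (T : Set (Ideal A)) (hT : T.Finite)
    (hm : ∀ m ∈ T, m.IsMaximal) (x : Ideal A → P) :
    ∃ p : P, ∀ m ∈ T, p - x m ∈ m • (⊤ : Submodule A P) := by
  classical
  have : Fintype T := hT.fintype
  have hco : Pairwise (Function.onFun IsCoprime fun m : T => (m : Ideal A)) := fun m m' hmm' => by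
    have := hm m m.2
    have := hm m' m'.2
    exact Ideal.isCoprime_of_isMaximal fun h => hmm' (Subtype.ext h)
  choose c hc using fun m : T => Ideal.exists_forall_sub_mem_ideal hco (Pi.single m 1)
  refine ⟨∑ m : T, c m • x m, fun m hmT => ?_⟩
  have h1 : ∑ m' : T, c m' • x m' - x m =
      ∑ m' : T, (c m' - Pi.single (M := fun _ => A) m' 1 ⟨m, hmT⟩) • x m' := by
    simp only [sub_smul, Finset.sum_sub_distrib]
    congr 1
    rw [Finset.sum_eq_single ⟨m, hmT⟩]
    · simp
    · intro b _ hb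
      rw [Pi.single_eq_of_ne (Ne.symm hb), zero_smul]
    · simp
  rw [h1]
  exact Submodule.sum_mem _ fun m' _ =>
    Submodule.smul_mem_smul (hc m' ⟨m, hmT⟩) Submodule.mem_top

/-- A projective module which is generically free of rank at least two has a free direct summand. -/
theorem exists_dual_apply_eq_one_of_generic [Infinite R] [Ring.HasFiniteQuotients R]
    [Module.Finite R A] [Module.Finite A P] [Module.Projective A P]
    (hP : ∀ m : Ideal A, m.IsMaximal → m • (⊤ : Submodule A P) ≠ ⊤) (e₁ e₂ : P)
    (β₁ β₂ : P →ₗ[A] A) (m₁ m₂ : R) (hm₁ : m₁ ≠ 0) (hm₂ : m₂ ≠ 0)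
    (h₁₁ : β₁ e₁ = algebraMap R A m₁) (h₁₂ : β₁ e₂ = 0) (h₂₂ : β₂ e₂ = algebraMap R A m₂) :
    ∃ (p : P) (φ : P →ₗ[A] A), φ p = 1 := by
  classical
  choose! x hx using fun (m : Ideal A) (hm : m.IsMaximal) =>
    (SetLike.exists_not_mem_of_ne_top _ (hP m hm) rfl : ∃ x, x ∉ m • (⊤ : Submodule A P))
  -- p₁ is nonzero modulo each of the finitely many maximal ideals that contain m₂.
  obtain ⟨p₁, hp₁⟩ := exists_forall_notMem_smul_top _
    (finite_isMaximal_of_ne_zero (A := A) m₂ hm₂) (fun m hm => hm.1) x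
  obtain ⟨k, d, hd, hkd⟩ := exists_add_smul_dvd (β₁ p₁) (Algebra.IsIntegral.isIntegral (R := R) _)
    (m₂ * m₁) (mul_ne_zero hm₂ hm₁)
  -- The factor m₂ keeps p congruent to p₁ modulo those ideals, while k makes β₁ p divide a nonzero
  -- d in R. So p can vanish only modulo the finitely many maximal ideals containing d.
  let p : P := p₁ + algebraMap R A (m₂ * k) • e₁
  have hp : ∀ m : Ideal A, m.IsMaximal → algebraMap R A m₂ ∈ m → p ∉ m • (⊤ : Submodule A P) := by
    intro m hm hmm h
    refine hx m hm ?_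
    have h2 : algebraMap R A (m₂ * k) • e₁ ∈ m • (⊤ : Submodule A P) := by
      rw [map_mul]
      exact Submodule.smul_mem_smul (m.mul_mem_right _ hmm) Submodule.mem_top
    have h3 := sub_mem (sub_mem h h2) (hp₁ m ⟨hm, hmm⟩)
    simpa [p] using h3
  have hpd : β₁ p ∣ algebraMap R A d := by
    have : β₁ p = β₁ p₁ + algebraMap R A (m₂ * m₁ * k) := by
      simp only [p, map_add, map_smul, h₁₁, smul_eq_mul, ← map_mul]
      congr 2
      ring
    rwa [this]
  -- Adding a • e₂ does not affect β₁. Where p vanishes modulo m, the coefficient a is 1 modulo m;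
  -- if p + e₂ vanished as well, so would e₂, and then m₂ = β₂ e₂ would lie in m, where p does not
  -- vanish.
  obtain ⟨a, ha⟩ := exists_forall_notMem_smul_top _ (finite_isMaximal_of_ne_zero (A := A) d hd)
    (fun m hm => hm.1) fun m => if p ∈ m • (⊤ : Submodule A P) then (1 : A) else 0
  refine ⟨p + a • e₂, exists_dual_eq_one _ fun m hm hmem => ?_⟩
  by_cases hdm : algebraMap R A d ∈ m
  · have ha' := ha m ⟨hm, hdm⟩
    rw [smul_eq_mul, Ideal.mul_top] at ha'
    have h2 : (a - if p ∈ m • (⊤ : Submodule A P) then (1 : A) else 0) • e₂ ∈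
        m • (⊤ : Submodule A P) := Submodule.smul_mem_smul ha' Submodule.mem_top
    split_ifs at h2 with h
    · have h3 := sub_mem (sub_mem hmem h2) h
      have h4 : e₂ ∈ m • (⊤ : Submodule A P) := by
        convert h3 using 1
        module
      have h5 := map_mem_of_mem_smul_top β₂ m h4
      rw [h₂₂] at h5
      exact hp m hm h5 h
    · apply h
      convert sub_mem hmem h2 using 1
      module
  · have := map_mem_of_mem_smul_top β₁ m hmem
    rw [map_add, map_smul, h₁₂, smul_zero, add_zero] at this
    exact hdm (Ideal.mem_of_dvd _ hpd this)

end Splitting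

section Rank

open nonZeroDivisors

theorem smul_top_ne_top_of_rankAtStalk {A P : Type u} [CommRing A] [AddCommGroup P] [Module A P]
    [Module.Finite A P] [Module.Projective A P] (h : ∀ p, Module.rankAtStalk (R := A) P p ≠ 0)
    (m : Ideal A) (hm : m.IsMaximal) : m • (⊤ : Submodule A P) ≠ ⊤ := by
  intro htop
  let := Ideal.Quotient.field m
  refine h (PrimeSpectrum.comap (algebraMap A (A ⧸ m)) ⊥) ?_
  rw [← Module.rankAtStalk_baseChange, Module.rankAtStalk_eq_finrank_of_free]
  have : Subsingleton (P ⧸ (m • (⊤ : Submodule A P))) := by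
    rw [htop]
    infer_instance
  have : Subsingleton ((A ⧸ m) ⊗[A] P) :=
    (TensorProduct.quotTensorEquivQuotSMul P m).toEquiv.subsingleton
  exact Module.finrank_zero_of_subsingleton

/-- Serre's splitting theorem for orders: a projective module of constant rank at least two has a
free direct summand. -/
theorem exists_dual_apply_eq_one_of_rankAtStalk (R : Type u) {A : Type u} [CommRing R] [IsDomain R]
    [CommRing A] [Algebra R A] [Infinite R] [Ring.HasFiniteQuotients R] [Module.Finite R A]
    [Module.IsTorsionFree R A] {P : Type u} [AddCommGroup P] [Module A P]
    [Module.Finite A P] [Module.Projective A P] (n : ℕ)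
    (h : ∀ p, Module.rankAtStalk (R := A) P p = n + 2) :
    ∃ (p : P) (φ : P →ₗ[A] A), φ p = 1 := by
  have := Module.finitePresentation_of_projective A P
  -- L is A tensored with the fraction field of R. It is Artinian, so P becomes free of rank n + 2
  -- over it; clearing denominators gives two elements of P and two linear forms whose pairing is
  -- diagonal and nonzero.
  let S := Algebra.algebraMapSubmonoid A R⁰
  let L := Localization S
  let K := FractionRing R
  let : Algebra K L := localizationAlgebra R⁰ A
  have : IsScalarTower R K L := isScalarTower_localizationAlgebra _ _
  have : Module.Finite K L := Module.Finite.of_isLocalization R A R⁰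
  have : IsArtinianRing L := IsArtinianRing.of_finite K L
  have hS : S ≤ A⁰ := by
    rintro _ ⟨r, hr, rfl⟩
    refine mem_nonZeroDivisors_iff_right.2 fun a ha => ?_
    rw [mul_comm, ← Algebra.smul_def, smul_eq_zero] at ha
    exact ha.resolve_left (nonZeroDivisors.ne_zero hr)
  have hinj : Function.Injective (algebraMap A L) := IsLocalization.injective L hS
  obtain ⟨e⟩ := nonempty_equiv_of_rankAtStalk (A := L) (M := L ⊗[A] P) (n + 2) fun p => by
    rw [Module.rankAtStalk_baseChange, h]
  let ι : P →ₗ[A] L ⊗[A] P := TensorProduct.mk A L P 1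
  have h1 (j : Fin (n + 2)) : ∃ (p : P) (s : R), s ≠ 0 ∧
      e (ι p) = Pi.single j (algebraMap A L (algebraMap R A s)) := by
    obtain ⟨⟨p, ⟨_, s, hs, rfl⟩⟩, hp⟩ := IsLocalizedModule.surj S ι (e.symm (Pi.single j 1))
    refine ⟨p, s, nonZeroDivisors.ne_zero hs, ?_⟩
    have hp' : algebraMap A L (algebraMap R A s) • e.symm (Pi.single j 1) = ι p := by
      rw [algebraMap_smul]
      exact hp
    rw [← hp', map_smul, e.apply_symm_apply, ← Pi.single_smul, smul_eq_mul, mul_one]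
  have h2 (j : Fin (n + 2)) : ∃ (β : P →ₗ[A] A) (s : R), s ≠ 0 ∧
      ∀ p, algebraMap A L (β p) = algebraMap A L (algebraMap R A s) * e (ι p) j := by
    obtain ⟨β, ⟨_, s, hs, rfl⟩, hβ⟩ := Module.FinitePresentation.exists_lift_of_isLocalizedModule S
      (Algebra.linearMap A L) ((LinearMap.proj j ∘ₗ e.toLinearMap).restrictScalars A ∘ₗ ι)
    refine ⟨β, s, nonZeroDivisors.ne_zero hs, fun p => ?_⟩
    rw [← Algebra.smul_def]
    exact LinearMap.congr_fun hβ p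
  obtain ⟨e₁, s₁, hs₁, he₁⟩ := h1 0
  obtain ⟨e₂, s₂, hs₂, he₂⟩ := h1 1
  obtain ⟨β₁, t₁, ht₁, hβ₁⟩ := h2 0
  obtain ⟨β₂, t₂, ht₂, hβ₂⟩ := h2 1
  refine exists_dual_apply_eq_one_of_generic (R := R)
    (smul_top_ne_top_of_rankAtStalk fun p => by rw [h]; omega) e₁ e₂ β₁ β₂ (t₁ * s₁) (t₂ * s₂)
    (mul_ne_zero ht₁ hs₁) (mul_ne_zero ht₂ hs₂) (hinj ?_) (hinj ?_) (hinj ?_)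
  · rw [hβ₁, he₁]
    simp
  · rw [hβ₁, he₂]
    simp
  · rw [hβ₂, he₂]
    simp

/-- A projective module of constant rank `n + 1` over an order is the direct sum of a module of
rank one and a free module. -/
theorem exists_equiv_prod_free (R : Type u) {A : Type u} [CommRing R] [IsDomain R]
    [CommRing A] [Algebra R A] [Infinite R] [Ring.HasFiniteQuotients R] [Module.Finite R A]
    [Module.IsTorsionFree R A] (n : ℕ) (P : Type u) [AddCommGroup P] [Module A P]
    [Module.Finite A P] [Module.Projective A P]
    (h : ∀ p, Module.rankAtStalk (R := A) P p = n + 1) :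
    ∃ (I : Type u) (_ : AddCommGroup I) (_ : Module A I) (_ : Module.Finite A I)
      (_ : Module.Projective A I), (∀ p, Module.rankAtStalk (R := A) I p = 1) ∧
      Nonempty (P ≃ₗ[A] I × (Fin n → A)) := by
  induction n generalizing P with
  | zero => exact ⟨P, inferInstance, inferInstance, inferInstance, inferInstance, h,
      ⟨LinearEquiv.prodUnique.symm⟩⟩
  | succ n ih =>
    obtain ⟨p, φ, hφ⟩ := exists_dual_apply_eq_one_of_rankAtStalk R n h
    -- The pair (p, φ) splits off a copy of A, and the kernel of φ has rank one less.
    have hs : φ ∘ₗ LinearMap.toSpanSingleton A P p = LinearMap.id := by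
      ext
      simp [hφ]
    obtain ⟨h1, h2⟩ := finite_projective_ker φ _ hs
    let e := splitEquiv φ _ hs
    obtain ⟨I, i1, i2, i3, i4, hI, ⟨e'⟩⟩ := ih (LinearMap.ker φ) fun p => by
      have h3 := h p
      have : Nontrivial A := p.nontrivial
      rw [Module.rankAtStalk_eq_of_equiv e, Module.rankAtStalk_prod, Pi.add_apply,
        Module.rankAtStalk_self] at h3
      simp at h3
      omega
    refine ⟨I, i1, i2, i3, i4, hI, ⟨?_⟩⟩
    exact e ≪≫ₗ (LinearEquiv.refl A A).prodCongr e' ≪≫ₗ LinearEquiv.prodComm _ _ _ ≪≫ₗ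
      LinearEquiv.prodAssoc A I (Fin n → A) A ≪≫ₗ (LinearEquiv.refl A I).prodCongr
        (LinearEquiv.prodComm _ _ _ ≪≫ₗ Fin.consLinearEquiv A fun _ => A)

end Rank

end RelativeK

/-! ### Stable range one, and reduction to rank one -/

namespace RelativeK

section Semilocal

/-- Semilocal rings have stable range one. -/
theorem exists_isUnit_add_mul {B : Type*} [CommRing B] [Finite (MaximalSpectrum B)] (a b s : B)
    (h : s * a + b = 1) : ∃ r, IsUnit (a + r * b) := by
  classical
  have hco : Pairwise (Function.onFun IsCoprime fun m : MaximalSpectrum B => m.asIdeal) :=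
    fun m m' hmm' => by
      have := m.isMaximal
      have := m'.isMaximal
      exact Ideal.isCoprime_of_isMaximal fun h => hmm' (MaximalSpectrum.ext h)
  -- When a lies in m, b does not, because s a + b = 1; so a + r b avoids every maximal ideal.
  obtain ⟨r, hr⟩ := Ideal.exists_forall_sub_mem_ideal hco fun m => if a ∈ m.asIdeal then 1 else 0
  refine ⟨r, ?_⟩
  by_contra hu
  obtain ⟨m, hm, hmem⟩ := exists_max_ideal_of_mem_nonunits hu
  have h1 := hr ⟨m, hm⟩
  split_ifs at h1 with ha
  · apply hm.ne_top
    rw [Ideal.eq_top_iff_one, ← h]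
    refine add_mem (m.mul_mem_left _ ha) ?_
    have h2 := sub_mem (sub_mem hmem ha) (m.mul_mem_right b h1)
    convert h2 using 1
    ring
  · refine ha ?_
    have h2 := sub_mem hmem (m.mul_mem_right b h1)
    convert h2 using 1
    ring

variable {A B : Type u} [CommRing A] [CommRing B] [Algebra A B]
  {X Y : Type u} [AddCommGroup X] [AddCommGroup Y] [Module A X] [Module A Y]
  [Module.Finite A X] [Module.Finite A Y] [Module.Projective A X] [Module.Projective A Y]

/-- The class of an automorphism of `(B ⊗ X) × (B ⊗ Y)`. -/
def autClass (Θ : ((B ⊗[A] X) × (B ⊗[A] Y)) ≃ₗ[B] ((B ⊗[A] X) × (B ⊗[A] Y))) : RelK0 A B :=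
  TwistedForm.cls ⟨X × Y, X × Y,
    TensorProduct.prodRight A B B X Y ≪≫ₗ Θ ≪≫ₗ (TensorProduct.prodRight A B B X Y).symm⟩

theorem autClass_trans (Θ Θ' : ((B ⊗[A] X) × (B ⊗[A] Y)) ≃ₗ[B] ((B ⊗[A] X) × (B ⊗[A] Y))) :
    autClass (Θ ≪≫ₗ Θ') = autClass Θ + autClass Θ' := by
  rw [autClass, autClass, autClass, ← TwistedForm.cls_comp]
  congr 2
  ext x
  simp

/-- A triangular automorphism is an extension of twisted forms, so only its diagonal counts. In
particular elementary automorphisms have class zero. -/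
theorem autClass_upper (Θ : ((B ⊗[A] X) × (B ⊗[A] Y)) ≃ₗ[B] ((B ⊗[A] X) × (B ⊗[A] Y)))
    (a : (B ⊗[A] X) ≃ₗ[B] (B ⊗[A] X)) (d : (B ⊗[A] Y) ≃ₗ[B] (B ⊗[A] Y))
    (ha : ∀ v, Θ (v, 0) = (a v, 0)) (hd : ∀ z, (Θ z).2 = d z.2) :
    autClass Θ = TwistedForm.cls ⟨X, X, a⟩ + TwistedForm.cls ⟨Y, Y, d⟩ := by
  refine TwistedForm.cls_exact (X := ⟨X, X, a⟩) (Z := ⟨Y, Y, d⟩)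
    { f := LinearMap.inl A X Y
      g := LinearMap.snd A X Y
      f' := LinearMap.inl A X Y
      g' := LinearMap.snd A X Y
      f_injective := LinearMap.inl_injective
      exact := .inl_snd
      g_surjective := LinearMap.snd_surjective
      f'_injective := LinearMap.inl_injective
      exact' := .inl_snd
      g'_surjective := LinearMap.snd_surjective
      comm_left := fun x => ?_
      comm_right := fun y => ?_ }
  · apply (TensorProduct.prodRight A B B X Y).injective
    simp only [LinearEquiv.trans_apply, LinearEquiv.apply_symm_apply]
    rw [prodRight_inl, ha, prodRight_inl]
  · change d _ = _
    rw [prodRight_snd, prodRight_snd]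
    simp only [LinearEquiv.trans_apply, LinearEquiv.apply_symm_apply]
    rw [hd]

theorem autClass_lower (Θ : ((B ⊗[A] X) × (B ⊗[A] Y)) ≃ₗ[B] ((B ⊗[A] X) × (B ⊗[A] Y)))
    (a : (B ⊗[A] X) ≃ₗ[B] (B ⊗[A] X)) (d : (B ⊗[A] Y) ≃ₗ[B] (B ⊗[A] Y))
    (ha : ∀ z, (Θ z).1 = a z.1) (hd : ∀ w, Θ (0, w) = (0, d w)) :
    autClass Θ = TwistedForm.cls ⟨Y, Y, d⟩ + TwistedForm.cls ⟨X, X, a⟩ := by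
  refine TwistedForm.cls_exact (X := ⟨Y, Y, d⟩) (Z := ⟨X, X, a⟩)
    { f := LinearMap.inr A X Y
      g := LinearMap.fst A X Y
      f' := LinearMap.inr A X Y
      g' := LinearMap.fst A X Y
      f_injective := LinearMap.inr_injective
      exact := .inr_fst
      g_surjective := LinearMap.fst_surjective
      f'_injective := LinearMap.inr_injective
      exact' := .inr_fst
      g'_surjective := LinearMap.fst_surjective
      comm_left := fun x => ?_
      comm_right := fun y => ?_ }
  · apply (TensorProduct.prodRight A B B X Y).injective
    simp only [LinearEquiv.trans_apply, LinearEquiv.apply_symm_apply]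
    rw [prodRight_inr, hd, prodRight_inr]
  · change a _ = _
    rw [prodRight_fst, prodRight_fst]
    simp only [LinearEquiv.trans_apply, LinearEquiv.apply_symm_apply]
    rw [ha]

/-- An automorphism with an invertible corner is equivalent to a diagonal one. -/
theorem exists_autClass_eq_of_corner
    (Θ : ((B ⊗[A] X) × (B ⊗[A] Y)) ≃ₗ[B] ((B ⊗[A] X) × (B ⊗[A] Y)))
    (a : (B ⊗[A] X) ≃ₗ[B] (B ⊗[A] X)) (ha : ∀ v, (Θ (v, 0)).1 = a v) :
    ∃ d : (B ⊗[A] Y) ≃ₗ[B] (B ⊗[A] Y),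
      autClass Θ = TwistedForm.cls ⟨X, X, a⟩ + TwistedForm.cls ⟨Y, Y, d⟩ := by
  let c : B ⊗[A] X →ₗ[B] B ⊗[A] Y := LinearMap.snd B _ _ ∘ₗ Θ.toLinearMap ∘ₗ LinearMap.inl B _ _
  -- Elementary elimination: subtracting c a⁻¹ times the first coordinate clears the entry below the
  -- invertible corner.
  let S := (LinearEquiv.refl B (B ⊗[A] X)).skewProd (LinearEquiv.refl B (B ⊗[A] Y))
    (-(c ∘ₗ a.symm.toLinearMap))
  have hS : autClass S = 0 := by
    rw [autClass_lower S (LinearEquiv.refl B _) (LinearEquiv.refl B _) (fun z => by simp [S])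
      fun w => by simp [S], cls_refl, cls_refl, add_zero]
  have h0 (v) : (Θ ≪≫ₗ S) (v, 0) = (a v, 0) := by
    simp [S, ha, c]
  let d : B ⊗[A] Y →ₗ[B] B ⊗[A] Y :=
    LinearMap.snd B _ _ ∘ₗ (Θ ≪≫ₗ S).toLinearMap ∘ₗ LinearMap.inr B _ _
  have hd (z) : ((Θ ≪≫ₗ S) z).2 = d z.2 := by
    have : z = (z.1, 0) + (0, z.2) := by simp
    rw [this, map_add, h0]
    simp [d]
  have hbij : Function.Bijective d := by
    constructor
    · rw [injective_iff_map_eq_zero]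
      intro w hw
      have h1 : (Θ ≪≫ₗ S) (0, w) = (Θ ≪≫ₗ S) (a.symm ((Θ ≪≫ₗ S) (0, w)).1, 0) := by
        rw [h0, a.apply_symm_apply]
        exact Prod.ext rfl hw
      exact congrArg Prod.snd ((Θ ≪≫ₗ S).injective h1)
    · intro w
      refine ⟨((Θ ≪≫ₗ S).symm (0, w)).2, ?_⟩
      rw [← hd, LinearEquiv.apply_symm_apply]
  refine ⟨LinearEquiv.ofBijective d hbij, ?_⟩
  rw [← autClass_upper (Θ ≪≫ₗ S) a (LinearEquiv.ofBijective d hbij) h0 hd, autClass_trans, hS,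
    add_zero]

variable (A) in
/-- The class `[A, A; u]` of a unit `u` of `B`. -/
def unitClass (u : Bˣ) : RelK0 A B :=
  TwistedForm.cls ⟨A, A, LinearEquiv.smulOfUnit u⟩

theorem unitClass_mul (u u' : Bˣ) : unitClass A (u * u') = unitClass A u + unitClass A u' := by
  rw [unitClass, unitClass, unitClass, ← TwistedForm.cls_comp]
  congr 2
  ext x
  change (u * u') • x = u' • u • x
  rw [mul_comm, mul_smul]

/-- The first column of Θ is unimodular, so stable range one provides an elementary automorphism
that makes its corner a unit; elimination then splits off that unit. -/
theorem exists_autClass_eq [Finite (MaximalSpectrum B)]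
    (Θ : ((B ⊗[A] A) × (B ⊗[A] Y)) ≃ₗ[B] ((B ⊗[A] A) × (B ⊗[A] Y))) :
    ∃ (u : Bˣ) (d : (B ⊗[A] Y) ≃ₗ[B] (B ⊗[A] Y)),
      autClass Θ = unitClass A u + TwistedForm.cls ⟨Y, Y, d⟩ := by
  let ρ : B ⊗[A] A ≃ₗ[B] B := TensorProduct.AlgebraTensorModule.rid A B B
  let e : B ⊗[A] A := 1 ⊗ₜ 1
  have he (v) : v = ρ v • e := ρ.injective (by simp [ρ, e])
  let ψ : ((B ⊗[A] A) × (B ⊗[A] Y)) →ₗ[B] B := ρ.toLinearMap ∘ₗ LinearMap.fst B _ _ ∘ₗ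
    Θ.symm.toLinearMap
  -- ψ is the first row of the inverse of Θ, applied here to the first column of Θ.
  have h1 : ψ (e, 0) * ρ (Θ (e, 0)).1 + ψ (0, (Θ (e, 0)).2) = 1 := by
    have h2 : ψ (Θ (e, 0)) = 1 := by simp [ψ, ρ, e]
    rw [← h2, mul_comm, ← smul_eq_mul, ← map_smul, ← map_add]
    congr 1
    refine Prod.ext ?_ ?_
    · simp [← he]
    · simp
  obtain ⟨r, hr⟩ := exists_isUnit_add_mul _ _ _ h1
  let t : B ⊗[A] Y →ₗ[B] B ⊗[A] A :=
    r • (LinearMap.toSpanSingleton B _ e ∘ₗ ψ ∘ₗ LinearMap.inr B _ _)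
  let S := LinearEquiv.prodComm B _ _ ≪≫ₗ
    ((LinearEquiv.refl B (B ⊗[A] Y)).skewProd (LinearEquiv.refl B (B ⊗[A] A)) t) ≪≫ₗ
    LinearEquiv.prodComm B _ _
  have hS : autClass S = 0 := by
    rw [autClass_upper S (LinearEquiv.refl B _) (LinearEquiv.refl B _) (fun z => by simp [S])
      fun w => by simp [S], cls_refl, cls_refl, add_zero]
  obtain ⟨d, hd⟩ := exists_autClass_eq_of_corner (Θ ≪≫ₗ S) (LinearEquiv.smulOfUnit hr.unit)
    fun v => by
      obtain ⟨b, rfl⟩ : ∃ b : B, v = b • e := ⟨_, he v⟩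
      have : ((b • e, 0) : (B ⊗[A] A) × (B ⊗[A] Y)) = b • (e, 0) := by simp
      rw [this, map_smul]
      change b • ((Θ ≪≫ₗ S) (e, 0)).1 = (_ : B) • b • e
      rw [IsUnit.unit_spec, smul_comm]
      congr 1
      rw [add_smul, ← he]
      simp [S, t, mul_smul]
  refine ⟨hr.unit, d, ?_⟩
  rw [autClass_trans, hS, add_zero] at hd
  exact hd

/-- Over a semilocal ring `B`, the class of an automorphism of a free module is the class of a
unit. -/
theorem exists_unitClass_eq [Finite (MaximalSpectrum B)] (n : ℕ)
    (ξ : B ⊗[A] (A × (Fin n → A)) ≃ₗ[B] B ⊗[A] (A × (Fin n → A))) :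
    ∃ u : Bˣ, TwistedForm.cls ⟨_, _, ξ⟩ = unitClass A u := by
  induction n with
  | zero =>
    obtain ⟨u, d, h⟩ := exists_autClass_eq ((TensorProduct.prodRight A B B A (Fin 0 → A)).symm ≪≫ₗ
      ξ ≪≫ₗ TensorProduct.prodRight A B B A (Fin 0 → A))
    refine ⟨u, ?_⟩
    rw [cls_baseChange (LinearEquiv.refl A _) d fun m => by
      rw [Subsingleton.elim m 0, TensorProduct.tmul_zero, map_zero, map_zero,
        TensorProduct.tmul_zero], add_zero] at h
    rw [← h, autClass]
    congr 2
    ext x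
    simp
  | succ n ih =>
    obtain ⟨u, d, h⟩ := exists_autClass_eq ((TensorProduct.prodRight A B B A _).symm ≪≫ₗ
      ξ ≪≫ₗ TensorProduct.prodRight A B B A _)
    let e : (A × (Fin n → A)) ≃ₗ[A] (Fin (n + 1) → A) := Fin.consLinearEquiv A fun _ => A
    let E := LinearEquiv.baseChange A B _ _ e
    obtain ⟨u', hu'⟩ := ih (E ≪≫ₗ d ≪≫ₗ E.symm)
    refine ⟨u * u', ?_⟩
    have h2 : TwistedForm.cls ⟨_, _, d⟩ = unitClass A u' := by
      rw [← hu']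
      symm
      refine cls_congr _ _ e e fun m => ?_
      have h3 (y) : e.toLinearMap.baseChange B (E.symm y) = y := E.apply_symm_apply y
      simp [h3, E]
    rw [unitClass_mul, ← h2, ← h, autClass]
    congr 2
    ext x
    simp

end Semilocal

section RankOne

variable {A B : Type u} [CommRing A] [CommRing B] [Algebra A B]

theorem exists_rankOneClass_eq_cls {I : Type u} [AddCommGroup I] [Module A I] [Module.Finite A I]
    [Module.Projective A I] (g : B ⊗[A] I ≃ₗ[B] B ⊗[A] A) :
    ∃ (f : I →ₗ[A] B) (hf : IsBaseChange B f),
      TwistedForm.cls ⟨I, A, g⟩ = rankOneClass A B I f hf := by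
  let ρ : B ⊗[A] A ≃ₗ[B] B := TensorProduct.AlgebraTensorModule.rid A B B
  let f : I →ₗ[A] B := ((g ≪≫ₗ ρ).toLinearMap.restrictScalars A) ∘ₗ TensorProduct.mk A B I 1
  have hf : IsBaseChange B f := IsBaseChange.of_equiv (g ≪≫ₗ ρ) fun x => rfl
  refine ⟨f, hf, cls_congr _ _ (LinearEquiv.refl A I) (LinearEquiv.refl A A) fun m => ?_⟩
  simp only [LinearEquiv.trans_apply, LinearEquiv.refl_apply, IsBaseChange.equiv_tmul]
  rw [one_smul, LinearEquiv.symm_apply_eq]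
  simp [f, ρ]

/-- Every element of the relative `K`-group of an order is the class of a module of rank one. -/
theorem exists_rankOneClass_eq (R : Type u) [CommRing R] [IsDomain R] [Algebra R A] [Infinite R]
    [Ring.HasFiniteQuotients R] [Module.Finite R A] [Module.IsTorsionFree R A]
    [Finite (MaximalSpectrum B)] (hAB : Function.Injective (algebraMap A B)) (x : RelK0 A B) :
    ∃ (I : Type u) (_ : AddCommGroup I) (_ : Module A I) (_ : Module.Finite A I)
      (_ : Module.Projective A I) (f : I →ₗ[A] B) (hf : IsBaseChange B f),
      x = rankOneClass A B I f hf := by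
  obtain ⟨n, M, _, _, _, _, ξ, rfl⟩ := exists_cls_eq x
  obtain ⟨I, _, _, _, _, hI, ⟨e⟩⟩ := exists_equiv_prod_free R n M fun p => by
    have : Nontrivial A := p.nontrivial
    rw [rankAtStalk_eq_of_baseChange_equiv hAB ξ, Module.rankAtStalk_eq_finrank_of_free]
    simp [add_comm]
  -- B is semilocal, so B ⊗ I, being projective of rank one, is free. This g is arbitrary and still
  -- has to be corrected by a unit.
  obtain ⟨g⟩ := nonempty_equiv_of_rankAtStalk_eq (A := B) (M := B ⊗[A] I) (N := B ⊗[A] A) (by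
    funext p
    have : Nontrivial A := (p.comap (algebraMap A B)).nontrivial
    rw [Module.rankAtStalk_baseChange, hI, Module.rankAtStalk_baseChange, Module.rankAtStalk_self]
    rfl)
  let E := LinearEquiv.baseChange A B _ _ e
  let Γ := prodIso g (LinearEquiv.refl B (B ⊗[A] (Fin n → A)))
  -- ξ differs from g ⊕ id by an automorphism over B of a free module; its class is that of a unit
  -- u, which is absorbed into g.
  obtain ⟨u, hu⟩ := exists_unitClass_eq n (Γ.symm ≪≫ₗ E.symm ≪≫ₗ ξ)
  obtain ⟨f, hf, h⟩ := exists_rankOneClass_eq_cls (g ≪≫ₗ LinearEquiv.smulOfUnit u)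
  refine ⟨I, inferInstance, inferInstance, inferInstance, inferInstance, f, hf, ?_⟩
  rw [← h, TwistedForm.cls_comp, ← unitClass, ← hu, TwistedForm.cls_comp, TwistedForm.cls_comp,
    cls_symm, cls_symm, cls_prod, cls_refl, cls_baseChange e E fun m => by simp [E]]
  simp

end RankOne

end RelativeK

/-! ### From local classes to local lattices, and gluing the local homomorphisms -/

namespace RelativeK

open scoped AlgebraMonoidAlgebra
open MonoidAlgebra (single)
open IsDedekindDomain NumberField GaloisAlg

section Localise

variable {A B A' B' : Type u} [CommRing A] [CommRing B] [CommRing A'] [CommRing B']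
  [Algebra A B] [Algebra A A'] [Algebra A B'] [Algebra B B'] [Algebra A' B'] [IsScalarTower A B B']
  [IsScalarTower A A' B']

variable (A' B') in
theorem exists_isBaseChange_range_eq_span {M : Type u} [AddCommGroup M] [Module A M]
    [Module.Finite A M] [Module.Projective A M] (f : M →ₗ[A] B) (hf : IsBaseChange B f) :
    ∃ (M' : Type u) (_ : AddCommGroup M') (_ : Module A' M') (_ : Module.Finite A' M')
      (_ : Module.Projective A' M') (f' : M' →ₗ[A'] B'), IsBaseChange B' f' ∧
      Submodule.span A' (algebraMap B B' '' Set.range f) = LinearMap.range f' := by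
  let g₀ : M →ₗ[A] B' := (Algebra.linearMap B B').restrictScalars A ∘ₗ f
  have hg₀ : IsBaseChange B' g₀ := hf.comp (IsBaseChange.linearMap B B')
  refine ⟨A' ⊗[A] M, inferInstance, inferInstance, inferInstance, inferInstance,
    g₀.liftBaseChange A', ?_, ?_⟩
  · refine IsBaseChange.of_comp (TensorProduct.isBaseChange A M A') ?_
    convert hg₀
    ext m
    simp
  · rw [LinearMap.range_liftBaseChange]
    congr 1
    ext x
    simp [g₀]

end Localise

section Lattice

variable {F : Type u} [Field F] [NumberField F] {G : Type u} [CommGroup G] [Fintype G]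

/-- Equality in the K-group becomes equality of submodules of F_v^c G, because O_{F_v}G is semilocal
and the determinant separates lattices there. This is where the local hypothesis becomes concrete.
-/
theorem span_eq_range_of_lambdaLocal_eq (v : HeightOneSpectrum (𝓞 F))
    (i : AlgebraicClosure F →ₐ[F] AlgebraicClosure (v.adicCompletion F))
    {M : Type u} [AddCommGroup M] [Module (MonoidAlgebra (𝓞 F) G) M]
    [Module.Finite (MonoidAlgebra (𝓞 F) G) M] [Module.Projective (MonoidAlgebra (𝓞 F) G) M]
    (f : M →ₗ[MonoidAlgebra (𝓞 F) G] MonoidAlgebra (AlgebraicClosure F) G)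
    (hf : IsBaseChange (MonoidAlgebra (AlgebraicClosure F) G) f) (π : H1TameLocal F G v)
    (h : lambdaLocal G v i (rankOneClass _ _ M f hf) = PsiLocal F G v π) :
    Submodule.span (MonoidAlgebra (v.adicCompletionIntegers F) G)
      (MonoidAlgebra.mapRingHom G (i : AlgebraicClosure F →+* AlgebraicClosure (v.adicCompletion F)) ''
        Set.range f) = LinearMap.range (π.1.resolvend (v.adicCompletionIntegers F)) := by
  have : Finite (MaximalSpectrum (MonoidAlgebra (v.adicCompletionIntegers F) G)) :=
    finite_maximalSpectrum_of_isLocalRing (v.adicCompletionIntegers F) _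
  have := π.2.projective (finite_quotient_adicCompletionIntegers F v)
  have h1 : ∃ (M' : Type u) (_ : AddCommGroup M')
      (_ : Module (MonoidAlgebra (v.adicCompletionIntegers F) G) M')
      (_ : Module.Finite (MonoidAlgebra (v.adicCompletionIntegers F) G) M')
      (_ : Module.Projective (MonoidAlgebra (v.adicCompletionIntegers F) G) M')
      (f' : M' →ₗ[MonoidAlgebra (v.adicCompletionIntegers F) G]
        MonoidAlgebra (AlgebraicClosure (v.adicCompletion F)) G),
      IsBaseChange (MonoidAlgebra (AlgebraicClosure (v.adicCompletion F)) G) f' ∧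
      Submodule.span (MonoidAlgebra (v.adicCompletionIntegers F) G) (MonoidAlgebra.mapRingHom G
        (i : AlgebraicClosure F →+* AlgebraicClosure (v.adicCompletion F)) '' Set.range f) =
        LinearMap.range f' := by
    let : Algebra (AlgebraicClosure F) (AlgebraicClosure (v.adicCompletion F)) :=
      i.toRingHom.toAlgebra
    have : @IsScalarTower (𝓞 F) (AlgebraicClosure F) (AlgebraicClosure (v.adicCompletion F))
        Algebra.toSMul Algebra.toSMul Algebra.toSMul :=
      IsScalarTower.of_algebraMap_eq fun x => (i.commutes (algebraMap (𝓞 F) F x)).symm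
    exact exists_isBaseChange_range_eq_span _ _ f hf
  obtain ⟨M', _, _, _, _, f', hf', h2⟩ := h1
  rw [lambdaLocal_rankOneClass v i f hf f' hf' h2] at h
  rw [h2]
  exact range_eq_of_rankOneClass_eq (algebraMap_monoidAlgebra_local_injective v) f' hf' _ _ h

/-- The subgroup of those `ω` that fix the elements of `Λ`. -/
def fixSubgroup (Λ : Set (MonoidAlgebra (AlgebraicClosure F) G)) :
    Subgroup Gal(AlgebraicClosure F/F) where
  carrier := {ω | ∀ y ∈ Λ, ∀ t, ω (y.coeff t) = y.coeff t}
  one_mem' _ _ _ := rfl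
  mul_mem' ha hb y hy t := by rw [AlgEquiv.mul_apply, hb y hy, ha y hy]
  inv_mem' {a} ha y hy t := by
    have := congrArg (a⁻¹ : Gal(AlgebraicClosure F/F)) (ha y hy t)
    rw [← AlgEquiv.mul_apply, inv_mul_cancel, AlgEquiv.one_apply] at this
    exact this.symm

theorem isOpen_fixSubgroup (s : Finset (MonoidAlgebra (AlgebraicClosure F) G)) :
    IsOpen (fixSubgroup (s : Set (MonoidAlgebra (AlgebraicClosure F) G)) :
      Set Gal(AlgebraicClosure F/F)) := by
  let T : Set (AlgebraicClosure F) := ⋃ y ∈ s, Set.range fun t => y.coeff t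
  have hT : T.Finite := s.finite_toSet.biUnion fun y _ => Set.finite_range _
  have : Finite T := hT.to_subtype
  let E := IntermediateField.adjoin F T
  have hE : FiniteDimensional F E := IntermediateField.finiteDimensional_adjoin fun x _ =>
    Algebra.IsIntegral.isIntegral x
  refine Subgroup.isOpen_mono (H₁ := E.fixingSubgroup) (fun ω hω y hy t => ?_)
    (IntermediateField.fixingSubgroup_isOpen E)
  rw [IntermediateField.mem_fixingSubgroup_iff] at hω
  exact hω _ (IntermediateField.subset_adjoin F T (Set.mem_biUnion hy ⟨t, rfl⟩))

/-- Scalars in O_F G have Galois-invariant coefficients, so fixing generators suffices; for a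
finitely generated lattice this makes the fixer open. -/
theorem fixSubgroup_span (s : Set (MonoidAlgebra (AlgebraicClosure F) G)) :
    fixSubgroup (Submodule.span (MonoidAlgebra (𝓞 F) G) s :
      Set (MonoidAlgebra (AlgebraicClosure F) G)) = fixSubgroup s := by
  have key (ω : Gal(AlgebraicClosure F/F)) (y : MonoidAlgebra (AlgebraicClosure F) G) :
      (∀ t, ω (y.coeff t) = y.coeff t) ↔ MonoidAlgebra.mapRingHom G
        (ω : AlgebraicClosure F →+* AlgebraicClosure F) y = y := by
    constructor
    · intro h
      ext t
      rw [MonoidAlgebra.coeff_mapRingHom]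
      exact h t
    · intro h t
      have := congrArg (fun x => MonoidAlgebra.coeff x t) h
      simpa [MonoidAlgebra.coeff_mapRingHom] using this
  apply le_antisymm
  · exact fun ω hω y hy => hω y (Submodule.subset_span hy)
  · intro ω hω y hy
    rw [key]
    induction hy using Submodule.span_induction with
    | mem x hx => exact (key ω x).1 (hω x hx)
    | zero => exact map_zero _
    | add x y _ _ hx hy => rw [map_add, hx, hy]
    | smul a x _ hx =>
      rw [Algebra.smul_def, map_mul, hx]
      congr 1
      ext t
      rw [MonoidAlgebra.coeff_mapRingHom, MonoidAlgebra.algebraMap_def,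
        MonoidAlgebra.coeff_mapRingHom]
      exact ω.commutes (a.coeff t : F)

/-- As Λ spans the group ring, the equality extends to the element 1. This uniqueness is what makes
the glued map well defined and multiplicative. -/
theorem eq_of_forall_single_mul_eq {C : Type u} [Field C]
    (Λ : Set (MonoidAlgebra C G)) (hΛ : Submodule.span (MonoidAlgebra C G) Λ = ⊤) (g g' : G)
    (h : ∀ y ∈ Λ, single g 1 * y = single g' 1 * y) : g = g' := by
  have h1 (x : MonoidAlgebra C G) (hx : x ∈ Submodule.span (MonoidAlgebra C G) Λ) :
      single g 1 * x = single g' 1 * x := by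
    induction hx using Submodule.span_induction with
    | mem x hx => exact h x hx
    | zero => simp
    | add x y _ _ hx hy => rw [mul_add, mul_add, hx, hy]
    | smul a x _ hx => rw [smul_eq_mul, mul_left_comm, hx, mul_left_comm]
  have h2 := h1 1 (hΛ ▸ Submodule.mem_top)
  rw [mul_one, mul_one] at h2
  exact MonoidAlgebra.of_injective (R := C) h2

/-- A homomorphism which is compatible with the Galois action on a finitely generated spanning
lattice can be glued from its restrictions to the decomposition groups. -/
theorem exists_H1_of_forall_local (i : ∀ v : HeightOneSpectrum (𝓞 F),
      AlgebraicClosure F →ₐ[F] AlgebraicClosure (v.adicCompletion F))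
    (Λ : Submodule (MonoidAlgebra (𝓞 F) G) (MonoidAlgebra (AlgebraicClosure F) G)) (hfg : Λ.FG)
    (hΛ : Submodule.span (MonoidAlgebra (AlgebraicClosure F) G)
      (Λ : Set (MonoidAlgebra (AlgebraicClosure F) G)) = ⊤)
    (π : ∀ v : HeightOneSpectrum (𝓞 F),
      H1 (v.adicCompletion F) (AlgebraicClosure (v.adicCompletion F)) G)
    (hloc : ∀ v ω, ∀ y ∈ Λ, MonoidAlgebra.mapRingHom G
      ((resGal (v.adicCompletion F) (i v) ω : Gal(AlgebraicClosure F/F)) :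
        AlgebraicClosure F →+* AlgebraicClosure F) y = single ((π v).toHom ω) 1 * y) :
    ∃ ρ : H1 F (AlgebraicClosure F) G, (∀ v, ρ.res (v.adicCompletion F) (i v) = π v) ∧
      ∀ ω : Gal(AlgebraicClosure F/F), ∀ y ∈ Λ, MonoidAlgebra.mapRingHom G
        (ω : AlgebraicClosure F →+* AlgebraicClosure F) y = single (ρ.toHom ω) 1 * y := by
  let m (ω : Gal(AlgebraicClosure F/F)) : MonoidAlgebra (AlgebraicClosure F) G →+*
    MonoidAlgebra (AlgebraicClosure F) G :=
      MonoidAlgebra.mapRingHom G (ω : AlgebraicClosure F →+* AlgebraicClosure F)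
  have hm1 (ω g) (y) : m ω (single g 1 * y) = single g 1 * m ω y := by
    rw [map_mul, MonoidAlgebra.mapRingHom_single, map_one]
  have hmm (ω ω' y) : m (ω * ω') y = m ω (m ω' y) := by
    ext t
    simp only [m, MonoidAlgebra.coeff_mapRingHom]
    rfl
  have hmone (y) : m 1 y = y := by
    ext t
    simp only [m, MonoidAlgebra.coeff_mapRingHom]
    rfl
  have hss (g g' : G) (y : MonoidAlgebra (AlgebraicClosure F) G) :
      single g 1 * (single g' 1 * y) = single (g * g') 1 * y := by
    rw [← mul_assoc, MonoidAlgebra.single_mul_single, one_mul]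
  have hs1 (y : MonoidAlgebra (AlgebraicClosure F) G) : single (1 : G) 1 * y = y := one_mul y
  have hopen : IsOpen (fixSubgroup (Λ : Set (MonoidAlgebra (AlgebraicClosure F) G)) :
      Set Gal(AlgebraicClosure F/F)) := by
    obtain ⟨s, rfl⟩ := hfg
    rw [fixSubgroup_span]
    exact isOpen_fixSubgroup s
  have hfix (ω) (hω : ω ∈ fixSubgroup (Λ : Set (MonoidAlgebra (AlgebraicClosure F) G)))
      (y) (hy : y ∈ Λ) : m ω y = y := by
    ext t
    rw [MonoidAlgebra.coeff_mapRingHom]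
    exact hω y hy t
  let H : Subgroup Gal(AlgebraicClosure F/F) :=
    { carrier := {ω | ∃ g : G, ∀ y ∈ Λ, m ω y = single g 1 * y}
      one_mem' := ⟨1, fun y _ => by rw [hmone, hs1]⟩
      mul_mem' := by
        rintro a b ⟨g, hg⟩ ⟨g', hg'⟩
        exact ⟨g' * g, fun y hy => by rw [hmm, hg' y hy, hm1, hg y hy, hss]⟩
      inv_mem' := by
        rintro a ⟨g, hg⟩
        refine ⟨g⁻¹, fun y hy => ?_⟩
        have := congrArg (m a⁻¹) (hg y hy)
        rw [← hmm, inv_mul_cancel, hmone, hm1] at this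
        conv_rhs => rw [this, hss, inv_mul_cancel, hs1] }
  -- H is open since it contains the fixer of Λ, and it contains the chosen decomposition group at
  -- each v by hypothesis.
  have hH : H = ⊤ := by
    refine eq_top_of_forall_resGal_mem i H (Subgroup.isOpen_mono
      (H₁ := fixSubgroup (Λ : Set (MonoidAlgebra (AlgebraicClosure F) G))) ?_ hopen) ?_
    · exact fun ω hω => ⟨1, fun y hy => by rw [hs1, hfix ω hω y hy]⟩
    · exact fun v ω => ⟨_, hloc v ω⟩
  choose p hp using fun ω => (hH ▸ Subgroup.mem_top ω : ω ∈ H)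
  have huniq (ω g) (h : ∀ y ∈ Λ, m ω y = single g 1 * y) : p ω = g :=
    eq_of_forall_single_mul_eq _ hΛ _ _ fun y hy => by rw [← hp ω y hy, h y hy]
  -- Composing the two actions yields p ω' * p ω; commutativity of G restores the order.
  let P : Gal(AlgebraicClosure F/F) →* G := MonoidHom.mk' p fun ω ω' =>
    huniq _ _ fun y hy => by rw [hmm, hp ω' y hy, hm1, hp ω y hy, hss, mul_comm (p ω')]
  let ρ : H1 F (AlgebraicClosure F) G := ⟨P, Subgroup.isOpen_mono
    (H₁ := fixSubgroup (Λ : Set (MonoidAlgebra (AlgebraicClosure F) G)))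
    (fun ω hω => huniq ω 1 fun y hy => by rw [hs1, hfix ω hω y hy]) hopen⟩
  refine ⟨ρ, fun v => ?_, hp⟩
  have h1 : (ρ.res (v.adicCompletion F) (i v)).toHom = (π v).toHom := by
    ext ω
    exact huniq _ _ (hloc v ω)
  rcases hv : π v with ⟨q, hq⟩
  rw [hv] at h1
  change (⟨(ρ.res (v.adicCompletion F) (i v)).toHom, _⟩ : H1 _ _ G) = _
  congr 1

end Lattice

end RelativeK

/-! ### Equality of lattices from equality at every place -/

namespace RelativeK

open scoped AlgebraMonoidAlgebra
open MonoidAlgebra (single)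
open IsDedekindDomain NumberField GaloisAlg

section Approximation

variable {F : Type u} [Field F] [NumberField F] {G : Type u} [CommGroup G] [Fintype G]
  (v : HeightOneSpectrum (𝓞 F))

/-- O_F surjects onto the residue field of O_{F_v}, and a uniformizer can be taken in O_F itself. -/
theorem exists_eq_add_mul_of_adicCompletionIntegers : ∃ ϖ : 𝓞 F, ϖ ≠ 0 ∧ ϖ ∈ v.asIdeal ∧
    ∀ a : v.adicCompletionIntegers F, ∃ (α : 𝓞 F) (b : v.adicCompletionIntegers F),
      a = algebraMap (𝓞 F) _ α + algebraMap (𝓞 F) _ ϖ * b := by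
  obtain ⟨ϖ, hϖ⟩ := v.intValuation_exists_uniformizer
  have hϖ0 : ϖ ≠ 0 := by
    rintro rfl
    rw [map_zero] at hϖ
    exact WithZero.exp_ne_zero hϖ.symm
  have hval : Valued.v (algebraMap F (v.adicCompletion F) ϖ) = WithZero.exp (-1 : ℤ) := by
    rw [← hϖ]
    exact (HeightOneSpectrum.valuedAdicCompletion_eq_valuation' v (ϖ : F)).trans
      (HeightOneSpectrum.valuation_of_algebraMap v ϖ)
  have hne : algebraMap F (v.adicCompletion F) ϖ ≠ 0 := by
    rw [map_ne_zero]
    exact RingOfIntegers.coe_ne_zero_iff.2 hϖ0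
  refine ⟨ϖ, hϖ0, ?_, fun a => ?_⟩
  · rw [← HeightOneSpectrum.intValuation_lt_one_iff_mem, hϖ]
    exact WithZero.exp_lt_exp.2 (by norm_num)
  obtain ⟨α, hα⟩ := exists_sub_lt_one F v a a.2
  refine ⟨α, ⟨(a - algebraMap F (v.adicCompletion F) α) / algebraMap F (v.adicCompletion F) ϖ, ?_⟩,
    Subtype.ext ?_⟩
  -- The valuation is discrete: below 1 means at most the value of ϖ, so the quotient by ϖ is
  -- integral.
  · rw [HeightOneSpectrum.mem_adicCompletionIntegers, map_div₀, hval,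
      div_le_one₀ WithZero.exp_pos, ← WithZero.lt_mul_exp_iff_le WithZero.exp_ne_zero,
      ← WithZero.exp_add, neg_add_cancel, WithZero.exp_zero]
    exact hα
  · change (a : v.adicCompletion F) = algebraMap F (v.adicCompletion F) α +
      algebraMap F (v.adicCompletion F) ϖ * _
    field_simp
    ring

theorem exists_eq_add_smul_of_monoidAlgebra : ∃ ϖ : 𝓞 F, ϖ ≠ 0 ∧ ϖ ∈ v.asIdeal ∧
    ∀ a : MonoidAlgebra (v.adicCompletionIntegers F) G, ∃ (α : MonoidAlgebra (𝓞 F) G)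
      (b : MonoidAlgebra (v.adicCompletionIntegers F) G),
      a = algebraMap _ _ α + single 1 (algebraMap (𝓞 F) _ ϖ) * b := by
  classical
  obtain ⟨ϖ, h0, hϖ, h⟩ := exists_eq_add_mul_of_adicCompletionIntegers v
  refine ⟨ϖ, h0, hϖ, fun a => ?_⟩
  choose α b hab using fun t => h (a.coeff t)
  refine ⟨∑ t, single t (α t), ∑ t, single t (b t), ?_⟩
  ext t
  rw [hab t]
  simp [MonoidAlgebra.algebraMap_def, Finsupp.single_apply]

end Approximation

section Lattice

variable {F : Type u} [Field F] [NumberField F] {G : Type u} [CommGroup G] [Fintype G]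

theorem algebraMap_smul_eq (s : 𝓞 F) (x : MonoidAlgebra (AlgebraicClosure F) G) :
    algebraMap (𝓞 F) (MonoidAlgebra (𝓞 F) G) s • x =
      single 1 (algebraMap (𝓞 F) (AlgebraicClosure F) s) * x := by
  rw [Algebra.smul_def, MonoidAlgebra.coe_algebraMap]
  simp [MonoidAlgebra.algebraMap_def]

theorem ideal_eq_top_of_forall_notMem (I : Ideal (𝓞 F))
    (h : ∀ v : HeightOneSpectrum (𝓞 F), ∃ s ∈ I, s ∉ v.asIdeal) : I = ⊤ := by
  by_contra hne
  obtain ⟨p, hp, hle⟩ := Ideal.exists_le_maximal I hne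
  obtain ⟨s, hs, hsv⟩ := h ⟨p, hp.isPrime,
    Ring.ne_bot_of_isMaximal_of_not_isField hp (RingOfIntegers.not_isField F)⟩
  exact hsv (hle hs)

variable (i : ∀ v : HeightOneSpectrum (𝓞 F),
    AlgebraicClosure F →ₐ[F] AlgebraicClosure (v.adicCompletion F))
  (Λ : Submodule (MonoidAlgebra (𝓞 F) G) (MonoidAlgebra (AlgebraicClosure F) G))
  (ρ : H1 F (AlgebraicClosure F) G)

/-- For y in Λ, the ideal of those r in O_F with r y in the lattice of resolvends contains an
element prime to v for each v, so it contains 1. -/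
theorem le_range_resolvend_of_forall_local
    (hρ : ∀ ω : Gal(AlgebraicClosure F/F), ∀ y ∈ Λ, MonoidAlgebra.mapRingHom G
      (ω : AlgebraicClosure F →+* AlgebraicClosure F) y = single (ρ.toHom ω) 1 * y)
    (h : ∀ v, ∀ y ∈ Λ, ∀ t, IsIntegral (v.adicCompletionIntegers F) (i v (y.coeff t))) :
    Λ ≤ LinearMap.range (ρ.resolvend (𝓞 F)) := by
  intro y hy
  let I : Ideal (𝓞 F) := Ideal.comap (algebraMap (𝓞 F) (MonoidAlgebra (𝓞 F) G))
    ((LinearMap.range (ρ.resolvend (𝓞 F))).comap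
      (LinearMap.toSpanSingleton (MonoidAlgebra (𝓞 F) G) _ y))
  have hI : I = ⊤ := ideal_eq_top_of_forall_notMem I fun v => by
    obtain ⟨s, hs, hsy⟩ := exists_mul_mem_range_resolvend v (i v) ρ y (fun ω => hρ ω y hy) (h v y hy)
    refine ⟨s, ?_, hs⟩
    rw [← algebraMap_smul_eq] at hsy
    exact hsy
  have h1 : (1 : 𝓞 F) ∈ I := hI ▸ Submodule.mem_top
  have h2 : algebraMap (𝓞 F) (MonoidAlgebra (𝓞 F) G) 1 • y ∈ LinearMap.range (ρ.resolvend (𝓞 F)) :=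
    h1
  rwa [map_one, one_smul] at h2

theorem mapRingHom_smul (v : HeightOneSpectrum (𝓞 F))
    (i : AlgebraicClosure F →ₐ[F] AlgebraicClosure (v.adicCompletion F))
    (α : MonoidAlgebra (𝓞 F) G) (y : MonoidAlgebra (AlgebraicClosure F) G) :
    MonoidAlgebra.mapRingHom G (i : AlgebraicClosure F →+* AlgebraicClosure (v.adicCompletion F))
      (α • y) = algebraMap _ (MonoidAlgebra (v.adicCompletionIntegers F) G) α •
        MonoidAlgebra.mapRingHom G
          (i : AlgebraicClosure F →+* AlgebraicClosure (v.adicCompletion F)) y := by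
  rw [Algebra.smul_def, Algebra.smul_def, map_mul]
  congr 1
  ext t
  simp only [MonoidAlgebra.algebraMap_def, MonoidAlgebra.coeff_mapRingHom]
  exact i.commutes (α.coeff t : F)

/-- A lattice which generates the local lattices of resolvends at all places is dense in the global
one modulo every prime. -/
theorem range_resolvend_le_sup_smul (v : HeightOneSpectrum (𝓞 F))
    (i : AlgebraicClosure F →ₐ[F] AlgebraicClosure (v.adicCompletion F))
    (hle : Λ ≤ LinearMap.range (ρ.resolvend (𝓞 F)))
    (h : Submodule.span (MonoidAlgebra (v.adicCompletionIntegers F) G)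
      (MonoidAlgebra.mapRingHom G (i : AlgebraicClosure F →+* AlgebraicClosure (v.adicCompletion F)) ''
        (Λ : Set (MonoidAlgebra (AlgebraicClosure F) G))) = LinearMap.range
          ((ρ.res (v.adicCompletion F) i).resolvend (v.adicCompletionIntegers F))) :
    LinearMap.range (ρ.resolvend (𝓞 F)) ≤
      Λ ⊔ v.asIdeal.map (algebraMap (𝓞 F) (MonoidAlgebra (𝓞 F) G)) •
        LinearMap.range (ρ.resolvend (𝓞 F)) := by
  set J := LinearMap.range (ρ.resolvend (𝓞 F)) with hJ
  let ι := MonoidAlgebra.mapRingHom G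
    (i : AlgebraicClosure F →+* AlgebraicClosure (v.adicCompletion F))
  obtain ⟨ϖ, h0, hϖ, hdec⟩ := exists_eq_add_smul_of_monoidAlgebra (G := G) v
  let ϖ' : MonoidAlgebra (v.adicCompletionIntegers F) G := single 1 (algebraMap (𝓞 F) _ ϖ)
  -- The local span of Λ equals Λ plus ϖ times itself, because O_{F_v}G equals O_F G plus ϖ times
  -- itself.
  have key (x) (hx : x ∈ Submodule.span (MonoidAlgebra (v.adicCompletionIntegers F) G)
      (ι '' (Λ : Set (MonoidAlgebra (AlgebraicClosure F) G)))) : ∃ l ∈ Λ,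
      ∃ z ∈ Submodule.span (MonoidAlgebra (v.adicCompletionIntegers F) G)
      (ι '' (Λ : Set (MonoidAlgebra (AlgebraicClosure F) G))), x = ι l + ϖ' • z := by
    induction hx using Submodule.span_induction with
    | mem x hx =>
      obtain ⟨l, hl, rfl⟩ := hx
      exact ⟨l, hl, 0, zero_mem _, by rw [smul_zero, add_zero]⟩
    | zero => exact ⟨0, zero_mem _, 0, zero_mem _, by rw [smul_zero, add_zero, map_zero]⟩
    | add x y _ _ hx hy =>
      obtain ⟨l, hl, z, hz, rfl⟩ := hx
      obtain ⟨l', hl', z', hz', rfl⟩ := hy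
      exact ⟨l + l', add_mem hl hl', z + z', add_mem hz hz', by rw [map_add, smul_add]; abel⟩
    | smul a x hx' hx =>
      obtain ⟨l, hl, z, hz, hx⟩ := hx
      obtain ⟨α, b, rfl⟩ := hdec a
      refine ⟨α • l, Λ.smul_mem _ hl, b • x + algebraMap _ _ α • z,
        add_mem (Submodule.smul_mem _ _ hx') (Submodule.smul_mem _ _ hz), ?_⟩
      have h1 : ι (α • l) = algebraMap _ (MonoidAlgebra (v.adicCompletionIntegers F) G) α • ι l :=
        mapRingHom_smul v i α l
      rw [h1, add_smul, mul_smul, smul_add ϖ', smul_comm ϖ' (algebraMap _ _ α) z, ← add_assoc,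
        add_right_comm, ← smul_add, ← hx]
  intro y hy
  have hyv : ι y ∈ Submodule.span (MonoidAlgebra (v.adicCompletionIntegers F) G)
      (ι '' (Λ : Set (MonoidAlgebra (AlgebraicClosure F) G))) := by
    obtain ⟨a, rfl⟩ := hy
    rw [h]
    exact map_resolvend_mem_range v i ρ a
  obtain ⟨l, hl, z, hz, hyz⟩ := key _ hyv
  rw [h] at hz
  have hw : y - l ∈ J := sub_mem hy (hle hl)
  -- Write y = l + ϖ z locally. Then w = (y - l)/ϖ is a global element that equals z at v; it is
  -- equivariant and integral at v, so s w is a resolvend for some s prime to v.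
  let w : MonoidAlgebra (AlgebraicClosure F) G :=
    single 1 (algebraMap (𝓞 F) (AlgebraicClosure F) ϖ)⁻¹ * (y - l)
  have hϖ0 : algebraMap (𝓞 F) (AlgebraicClosure F) ϖ ≠ 0 := by
    intro hc
    exact h0 (RingOfIntegers.coe_injective ((algebraMap F (AlgebraicClosure F)).injective
      (hc.trans (map_zero (algebraMap (𝓞 F) (AlgebraicClosure F))).symm)))
  have hϖw : single 1 (algebraMap (𝓞 F) (AlgebraicClosure F) ϖ) * w = y - l := by
    rw [← mul_assoc, MonoidAlgebra.single_mul_single, mul_inv_cancel₀ hϖ0, one_mul,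
      ← MonoidAlgebra.one_def, one_mul]
  have hιϖ : ι (single 1 (algebraMap (𝓞 F) (AlgebraicClosure F) ϖ)) = algebraMap _ _ ϖ' := by
    rw [MonoidAlgebra.algebraMap_def, MonoidAlgebra.mapRingHom_single,
      MonoidAlgebra.mapRingHom_single]
    congr 1
    exact i.commutes (ϖ : F)
  have hwz : ι w = z := by
    have hu : IsUnit (ι (single 1 (algebraMap (𝓞 F) (AlgebraicClosure F) ϖ))) := by
      refine IsUnit.map ι (IsUnit.of_mul_eq_one
        (single 1 (algebraMap (𝓞 F) (AlgebraicClosure F) ϖ)⁻¹) ?_)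
      rw [MonoidAlgebra.single_mul_single, mul_inv_cancel₀ hϖ0, one_mul, MonoidAlgebra.one_def]
    apply hu.mul_left_cancel
    rw [← map_mul, hϖw, hιϖ, ← Algebra.smul_def, map_sub, hyz, add_sub_cancel_left]
  have hwω (ω : Gal(AlgebraicClosure F/F)) : MonoidAlgebra.mapRingHom G
      (ω : AlgebraicClosure F →+* AlgebraicClosure F) w = single (ρ.toHom ω) 1 * w := by
    rw [map_mul, ((H1.mem_range_resolvend (𝓞 F) ρ _).1 hw).1 ω, mul_left_comm,
      MonoidAlgebra.mapRingHom_single]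
    congr 3
    rw [map_inv₀]
    congr 1
    exact ω.commutes (ϖ : F)
  obtain ⟨s, hs, hsw⟩ := exists_mul_mem_range_resolvend v i ρ w hwω fun t => by
    have := ((H1.mem_range_resolvend _ _ _).1 hz).2 t
    rwa [← hwz, MonoidAlgebra.coeff_mapRingHom] at this
  rw [← algebraMap_smul_eq] at hsw
  rw [← algebraMap_smul_eq] at hϖw
  have hsy : algebraMap (𝓞 F) (MonoidAlgebra (𝓞 F) G) s • y =
      algebraMap (𝓞 F) (MonoidAlgebra (𝓞 F) G) s • l + algebraMap (𝓞 F) (MonoidAlgebra (𝓞 F) G) ϖ •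
        algebraMap (𝓞 F) (MonoidAlgebra (𝓞 F) G) s • w := by
    rw [smul_comm, hϖw, ← smul_add, add_sub_cancel]
  -- From r s + p = 1 with p in v, y = r(s y) + p y, and s y = s l + ϖ(s w) already has the required
  -- form.
  obtain ⟨r, p, hp, hrp⟩ := v.isMaximal.exists_inv hs
  have hy1 : y = algebraMap (𝓞 F) (MonoidAlgebra (𝓞 F) G) r •
      algebraMap (𝓞 F) (MonoidAlgebra (𝓞 F) G) s • y +
        algebraMap (𝓞 F) (MonoidAlgebra (𝓞 F) G) p • y := by
    rw [← mul_smul, ← map_mul, ← add_smul, ← map_add, hrp, map_one, one_smul]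
  rw [hy1, hsy]
  refine add_mem (Submodule.smul_mem _ _ (add_mem (Submodule.mem_sup_left (Λ.smul_mem _ hl))
    (Submodule.mem_sup_right (Submodule.smul_mem_smul (Ideal.mem_map_of_mem _ hϖ) hsw))))
    (Submodule.mem_sup_right (Submodule.smul_mem_smul (Ideal.mem_map_of_mem _ hp) hy))

/-- Nakayama's lemma. If the ideal of elements of O_F G that carry J into Λ were inside a maximal
ideal m, then at the place v below m the inclusion J ≤ Λ + vJ would give an element of that ideal
congruent to 1 modulo v, hence modulo m. -/
theorem eq_range_resolvend_of_forall_local (hle : Λ ≤ LinearMap.range (ρ.resolvend (𝓞 F)))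
    (hfg : (LinearMap.range (ρ.resolvend (𝓞 F))).FG)
    (h : ∀ v : HeightOneSpectrum (𝓞 F),
      Submodule.span (MonoidAlgebra (v.adicCompletionIntegers F) G) (MonoidAlgebra.mapRingHom G
        (i v : AlgebraicClosure F →+* AlgebraicClosure (v.adicCompletion F)) ''
          (Λ : Set (MonoidAlgebra (AlgebraicClosure F) G))) = LinearMap.range
            ((ρ.res (v.adicCompletion F) (i v)).resolvend (v.adicCompletionIntegers F))) :
    Λ = LinearMap.range (ρ.resolvend (𝓞 F)) := by
  set J := LinearMap.range (ρ.resolvend (𝓞 F)) with hJ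
  refine le_antisymm hle ?_
  let I : Ideal (MonoidAlgebra (𝓞 F) G) :=
    { carrier := {r | ∀ y ∈ J, r • y ∈ Λ}
      add_mem' := fun ha hb y hy => by rw [add_smul]; exact add_mem (ha y hy) (hb y hy)
      zero_mem' := fun y _ => by rw [zero_smul]; exact zero_mem _
      smul_mem' := fun c r hr y hy => by rw [smul_assoc]; exact Λ.smul_mem c (hr y hy) }
  have hI : I = ⊤ := by
    by_contra hne
    obtain ⟨m, hm, hIm⟩ := Ideal.exists_le_maximal I hne
    have hp : (m.comap (algebraMap (𝓞 F) (MonoidAlgebra (𝓞 F) G))).IsMaximal :=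
      Ideal.isMaximal_comap_of_isIntegral_of_isMaximal m
    let v : HeightOneSpectrum (𝓞 F) := ⟨_, hp.isPrime,
      Ring.ne_bot_of_isMaximal_of_not_isField hp (RingOfIntegers.not_isField F)⟩
    obtain ⟨r, hr1, hr⟩ := Submodule.exists_sub_one_mem_and_smul_le_of_fg_of_le_sup hfg le_rfl
      (range_resolvend_le_sup_smul Λ ρ v (i v) hle (h v))
    have hrm : r ∈ m := hIm fun y hy => hr (Submodule.smul_mem_pointwise_smul y r J hy)
    have hr1m : r - 1 ∈ m := Ideal.map_comap_le hr1
    refine hm.ne_top ((Ideal.eq_top_iff_one m).2 ?_)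
    convert sub_mem hrm hr1m using 1
    ring
  intro y hy
  have h1 : (1 : MonoidAlgebra (𝓞 F) G) ∈ I := hI ▸ Submodule.mem_top
  simpa using h1 y hy

end Lattice

end RelativeK

/-! ### The local-global principle -/

namespace RelativeK

open scoped AlgebraMonoidAlgebra
open MonoidAlgebra (single)
open IsDedekindDomain NumberField GaloisAlg

section LocalGlobal

variable {F : Type u} [Field F] [NumberField F] {G : Type u} [CommGroup G] [Fintype G]
  (i : ∀ v : HeightOneSpectrum (𝓞 F),
    AlgebraicClosure F →ₐ[F] AlgebraicClosure (v.adicCompletion F))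

theorem IsCohomological.isLocallyCohomological {x : K0 F G} (h : IsCohomological x) :
    IsLocallyCohomological i x := by
  obtain ⟨π, rfl⟩ := h
  exact fun v => ⟨_, (lambdaLocal_Psi π v (i v)).symm⟩

theorem span_range_eq_top_of_isBaseChange {A B M : Type*} [CommRing A] [CommRing B] [Algebra A B]
    [AddCommGroup M] [Module A M] (f : M →ₗ[A] B) (hf : IsBaseChange B f) :
    Submodule.span B (Set.range f) = ⊤ := by
  rw [eq_top_iff]
  intro b hb
  clear hb
  induction b using hf.inductionOn with
  | zero => exact zero_mem _
  | tmul m => exact Submodule.subset_span ⟨m, rfl⟩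
  | smul s n hn => exact Submodule.smul_mem _ s hn
  | add a b ha hb => exact add_mem ha hb

theorem IsLocallyCohomological.isCohomological {x : K0 F G} (h : IsLocallyCohomological i x) :
    IsCohomological x := by
  have : IsArtinianRing (MonoidAlgebra (AlgebraicClosure F) G) :=
    IsArtinianRing.of_finite (AlgebraicClosure F) _
  obtain ⟨I, _, _, _, _, f, hf, rfl⟩ :=
    exists_rankOneClass_eq (𝓞 F) algebraMap_monoidAlgebra_global_injective x
  choose π hπ using h
  -- From here on only the lattice `range f` and its localisations matter.
  have hspan (v) := span_eq_range_of_lambdaLocal_eq v (i v) f hf (π v) (hπ v).symm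
  have hmem (v) (y) (hy : y ∈ LinearMap.range f) : MonoidAlgebra.mapRingHom G
      (i v : AlgebraicClosure F →+* AlgebraicClosure (v.adicCompletion F)) y ∈
        LinearMap.range ((π v).1.resolvend (v.adicCompletionIntegers F)) := by
    rw [← hspan]
    exact Submodule.subset_span ⟨y, hy, rfl⟩
  obtain ⟨ρ, hρv, hρ⟩ := exists_H1_of_forall_local i (LinearMap.range f)
    (Module.Finite.iff_fg.1 (Module.Finite.range f)) (span_range_eq_top_of_isBaseChange f hf) (fun v => (π v).1)
    fun v ω y hy => by
      have h1 := ((H1.mem_range_resolvend _ _ _).1 (hmem v y hy)).1 ω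
      have h2 : single ((π v).1.toHom ω) 1 * MonoidAlgebra.mapRingHom G
          (i v : AlgebraicClosure F →+* AlgebraicClosure (v.adicCompletion F)) y =
          MonoidAlgebra.mapRingHom G
            (i v : AlgebraicClosure F →+* AlgebraicClosure (v.adicCompletion F))
            (single ((π v).1.toHom ω) 1 * y) := by
        rw [map_mul, MonoidAlgebra.mapRingHom_single, map_one]
      -- The action of ω on the image of y in F_v^c G is known there; injectivity of the embedding
      -- brings the identity back to F^c G.
      rw [mapRingHom_resGal, h2] at h1
      ext t
      have h3 := congrArg (fun x => MonoidAlgebra.coeff x t) h1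
      simp only [MonoidAlgebra.coeff_mapRingHom] at h3
      rw [MonoidAlgebra.coeff_mapRingHom]
      exact (i v).injective h3
  have htame : ρ.IsTame (𝓞 F) := isTame_of_forall_res ρ i fun v => by
    rw [hρv]
    exact (π v).2
  have := htame.projective (finite_quotient_ringOfIntegers F)
  have hle := le_range_resolvend_of_forall_local i (LinearMap.range f) ρ hρ fun v y hy t => by
    have := ((H1.mem_range_resolvend _ _ _).1 (hmem v y hy)).2 t
    rwa [MonoidAlgebra.coeff_mapRingHom] at this
  have heq := eq_range_resolvend_of_forall_local i (LinearMap.range f) ρ hle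
    (Module.Finite.iff_fg.1 (Module.Finite.range _)) fun v => by
      rw [hρv]
      exact hspan v
  exact ⟨⟨ρ, htame⟩, (rankOneClass_eq_of_range_eq algebraMap_monoidAlgebra_global_injective
    _ _ _ _ heq).symm⟩

/-- The family of the restrictions of a global class to all completions. -/
def resIdele (π : H1Tame F G) : H1Idele F G :=
  ⟨fun v => ⟨π.1.res (v.adicCompletion F) (i v), isTame_res π.1 π.2 v (i v)⟩,
    eventually_isUnramified_res π.1 i⟩

theorem lambda_Psi (π : H1Tame F G) :
    lambda G i (Psi F G π) = PsiIdele F G (resIdele i π) :=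
  Subtype.ext (funext fun v => lambdaLocal_Psi π v (i v))

end LocalGlobal

end RelativeK

end

theorem theorem5p5 (F : Type u) [Field F] [NumberField F] (G : Type u) [CommGroup G] [Fintype G]
    (i : ∀ v : IsDedekindDomain.HeightOneSpectrum (NumberField.RingOfIntegers F),
      AlgebraicClosure F →ₐ[F] AlgebraicClosure (v.adicCompletion F)) :
    (∀ x : RelativeK.K0 F G,
      RelativeK.IsCohomological x ↔ RelativeK.IsLocallyCohomological i x) ∧
    RelativeK.lambda G i '' RelativeK.KR F G =
      Set.range (RelativeK.lambda G i) ∩ Set.range (RelativeK.PsiIdele F G) := by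
  refine ⟨fun x => ⟨fun h => h.isLocallyCohomological i, fun h => h.isCohomological⟩, ?_⟩
  apply Set.Subset.antisymm
  · rintro _ ⟨_, ⟨π, rfl⟩, rfl⟩
    exact ⟨⟨_, rfl⟩, ⟨_, (RelativeK.lambda_Psi i π).symm⟩⟩
  -- Injectivity of λ is not needed: the components of π witness that x itself is locally
  -- cohomological, so x already lies in the image of Ψ.
  · rintro _ ⟨⟨x, rfl⟩, ⟨π, hπ⟩⟩
    refine ⟨x, RelativeK.IsLocallyCohomological.isCohomological i fun v => ⟨π v, ?_⟩, rfl⟩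
    exact congrFun (congrArg Subtype.val hπ) v
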